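/- **Notation.** $\mathbb C(\!(z)\!)$ and $\mathbb C(\!\{z\}\!)$ are the formal and the convergent Laurent series; $\mathcal P=\bigcup_{s\ge1}\mathbb C(\!(z^{1/s})\!)$ is the field of Puiseux series, $\mathcal P^-=\bigcup_{s\ge 1} z^{-1/s}\mathbb C[z^{-1/s}]$, $\mathcal P^+=\bigcup_{s\ge1}\mathbb C[\![z^{1/s}]\!]$, and $\mathrm{pr}^-$ is the projection of $\mathcal P=\mathcal P^-\oplus\mathcal P^+$ onto $\mathcal P^-$; $\mathrm{ord}$ is the $z$-order ($\mathrm{ord}\,0=\infty$); $\xi(f)(z)=f(e^{2\pi i}z)$. For $q\in\mathcal P^-$ the ramification index $r$ is the least positive integer with $q\in z^{-1/r}\mathbb C[z^{-1/r}]$, and for $R\in\mathbb C$ the HTL cell of multiplicity one is $E_{q,R}=\mathrm{diag}\big(q+R,\xi(q)+R,\dots,\xi^{r-1}(q)+R\big)z^{-1}$. A differential module $M$ over $\mathbb C(\!\{z\}\!)$ with matrix $G$ (derivation $\frac{d}{dz}-G$) has HTL normal form $E$ if $E=XGX^{-1}+X'X^{-1}$ for some $X\in\mathrm{GL}(\mathcal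 P)$. For a linear endomorphism $\Phi$ put $\chi(\Phi)=\dim_{\mathbb C}\mathrm{Ker}\,\Phi-\dim_{\mathbb C}\mathrm{Coker}\,\Phi$; the Komatsu–Malgrange irregularity is $\mathrm{Irr}(M)=\chi(\nabla_{\widetilde M})-\chi(\nabla_M)$ with $\widetilde M=\mathbb C(\!(z)\!)\otimes_{\mathbb C(\!\{z\}\!)} M$. $\mathrm{Hom}(M,M')$ carries the derivation $\varphi\mapsto\nabla_{M'}\varphi-\varphi\nabla_M$. **Setting.** Let $q_1,\dots,q_m\in\mathcal P^-$ have pairwise disjoint $\mathrm{Gal}(\mathcal P/\mathbb C(\!(z)\!))$-orbits and let $R_1,\dots,R_m\in\mathbb C$, so that $\mathrm{diag}(E_{q_1,R_1},\dots,E_{q_m,R_m})$ is a multiplicity free HTL normal form. Let $r_i$ be the ramification index of $q_i$, and let the integer $p_i$ be given by $\mathrm{ord}\,q_i=-p_i/r_i$ if $q_i\ne0$ and $p_i=0$ if $q_i=0$. Let $\tilde q_i\in\mathbb C(\!\{z^{1/r_i}\}\!)$ satisfy $\mathrm{pr}^-(\tilde q_i)=q_i$. (For instance, the $\tilde q_i$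 may come from a decomposition $\det(yI_n-G)=\prod_{i}\prod_{k=0}^{r_i-1}\big(y-\xi^k(\tilde q_i)/z\big)$ of the characteristic polynomial of a differential module with this normal form.) If $\mathrm{ord}(\tilde q_i/z)<0$, let $C_{\tilde q_i}$ be the plane curve germ at $(\zeta,z)=(0,0)$ with equation $$F_i:=\prod_{k=0}^{r_i-1}\Big(\zeta-\frac{z}{\xi^k(\tilde q_i)(z)}\Big)=0 .$$ **Proposition.** Let $i\ne j$ with $\mathrm{ord}(\tilde q_i/z)<0$ and $\mathrm{ord}(\tilde q_j/z)<0$. Let $M_{E_{q_i,R_i}}$ and $M_{E_{q_j,R_j}}$ be any differential modules over $\mathbb C(\!\{z\}\!)$ with HTL normal forms $E_{q_i,R_i}$ and $E_{q_j,R_j}$. Then $F_i$ and $F_j$ lie in $\mathbb C\{z,\zeta\}$, the space $\mathbb C\{z,\zeta\}/(F_i,F_j)$ is finite dimensional, the kernels and cokernels defining $\mathrm{Irr}(\mathrm{Hom}_{\mathbb C(\!\{z\}\!)}(M_{E_{q_i,R_i}},M_{E_{q_j,R_j}}))$ are finite dimensional, and the intersection number $(C_{\tilde q_i},C_{\tilde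 q_j})=\dim_{\mathbb C}\mathbb C\{z,\zeta\}/(F_i,F_j)$ is $$(C_{\tilde q_i},C_{\tilde q_j})=p_ir_j+p_jr_i+r_ir_j-\mathrm{Irr}\big(\mathrm{Hom}_{\mathbb C(\!\{z\}\!)}(M_{E_{q_i,R_i}},M_{E_{q_j,R_j}})\big).$$ -/

import Mathlib

-- Mathlib has two `Algebra` structures on `HahnSeries Γ ℂ`; we always use the coefficientwise one.
attribute [local instance 2000] HahnSeries.instAlgebra

namespace HTL

noncomputable section

open scoped Kronecker

/-! ### Convergent power series and Laurent series -/

theorem summable_conv_mul {A : Type*} [AddCommMonoid A] [Finset.HasAntidiagonal A]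
    {w : A → ℝ} (hw : ∀ a, 0 ≤ w a) (hadd : ∀ a b, w (a + b) = w a * w b) {f g : A → ℂ}
    (hf : Summable fun a => ‖f a‖ * w a) (hg : Summable fun a => ‖g a‖ * w a) :
    Summable fun n => ‖∑ p ∈ Finset.HasAntidiagonal.antidiagonal n, f p.1 * g p.2‖ * w n := by
  have h := summable_sum_mul_antidiagonal_of_summable_mul
    (Summable.mul_of_nonneg hf hg (fun a => mul_nonneg (norm_nonneg _) (hw a))
      (fun a => mul_nonneg (norm_nonneg _) (hw a)))
  refine h.of_nonneg_of_le (fun n => mul_nonneg (norm_nonneg _) (hw n)) fun n => ?_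
  calc ‖∑ p ∈ Finset.HasAntidiagonal.antidiagonal n, f p.1 * g p.2‖ * w n
      ≤ (∑ p ∈ Finset.HasAntidiagonal.antidiagonal n, ‖f p.1 * g p.2‖) * w n :=
        mul_le_mul_of_nonneg_right (norm_sum_le _ _) (hw n)
    _ = ∑ p ∈ Finset.HasAntidiagonal.antidiagonal n, (‖f p.1‖ * w p.1) * (‖g p.2‖ * w p.2) := by
        rw [Finset.sum_mul]
        refine Finset.sum_congr rfl fun p hp => ?_
        rw [← Finset.HasAntidiagonal.mem_antidiagonal.mp hp, hadd, norm_mul]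
        ring

theorem summable_shrink {A : Type*} (d : A → ℕ) {f : A → ℂ} {ρ ρ' : ℝ} (h0 : 0 < ρ')
    (hle : ρ' ≤ ρ) (hf : Summable fun a => ‖f a‖ * ρ ^ d a) :
    Summable fun a => ‖f a‖ * ρ' ^ d a :=
  hf.of_nonneg_of_le (fun _ => by positivity)
    fun a => mul_le_mul_of_nonneg_left (pow_le_pow_left₀ h0.le hle _) (norm_nonneg _)

theorem summable_conv_add {A : Type*} (d : A → ℕ) {f g : A → ℂ} {ρ ρ' : ℝ} (h0 : 0 < ρ)
    (h0' : 0 < ρ') (hf : Summable fun a => ‖f a‖ * ρ ^ d a)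
    (hg : Summable fun a => ‖g a‖ * ρ' ^ d a) :
    Summable fun a => ‖f a + g a‖ * (min ρ ρ') ^ d a := by
  have hm : 0 < min ρ ρ' := lt_min h0 h0'
  refine ((summable_shrink d hm (min_le_left _ _) hf).add
    (summable_shrink d hm (min_le_right _ _) hg)).of_nonneg_of_le
    (fun _ => by positivity) fun a => ?_
  rw [← add_mul]
  exact mul_le_mul_of_nonneg_right (norm_add_le _ _) (by positivity)

/-- `ℂ{z}`: the power series in one variable with a positive radius of convergence. -/
def convPowerSeries : Subalgebra ℂ (PowerSeries ℂ) where
  carrier := {f | ∃ ρ : ℝ, 0 < ρ ∧ Summable fun n : ℕ => ‖PowerSeries.coeff n f‖ * ρ ^ n}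
  add_mem' := by
    rintro f g ⟨ρ, h0, hf⟩ ⟨ρ', h0', hg⟩
    exact ⟨min ρ ρ', lt_min h0 h0', by
      simpa using summable_conv_add (fun n : ℕ => n) h0 h0' hf hg⟩
  mul_mem' := by
    rintro f g ⟨ρ, h0, hf⟩ ⟨ρ', h0', hg⟩
    have hm : 0 < min ρ ρ' := lt_min h0 h0'
    refine ⟨min ρ ρ', hm, ?_⟩
    simp only [PowerSeries.coeff_mul]
    have h1 := summable_shrink (fun n : ℕ => n) hm (min_le_left _ _) hf
    have h2 := summable_shrink (fun n : ℕ => n) hm (min_le_right _ _) hg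
    exact summable_conv_mul (w := fun n : ℕ => (min ρ ρ') ^ n)
      (f := fun n => PowerSeries.coeff n f) (g := fun n => PowerSeries.coeff n g)
      (fun _ => by positivity) (fun _ _ => pow_add _ _ _) h1 h2
  algebraMap_mem' := by
    intro c
    refine ⟨1, one_pos, summable_of_ne_finset_zero (s := {0}) fun n hn => ?_⟩
    have : n ≠ 0 := by simpa using hn
    simp [PowerSeries.coeff_C, this]

/-- `ℂ{z, ζ}`: the power series in two variables (`z` is variable `0`, `ζ` is variable `1`) that
converge in a neighbourhood of the origin. -/
def convPowerSeries₂ : Subalgebra ℂ (MvPowerSeries (Fin 2) ℂ) where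
  carrier := {f | ∃ ρ : ℝ, 0 < ρ ∧
    Summable fun d : Fin 2 →₀ ℕ => ‖MvPowerSeries.coeff d f‖ * ρ ^ (d 0 + d 1)}
  add_mem' := by
    rintro f g ⟨ρ, h0, hf⟩ ⟨ρ', h0', hg⟩
    exact ⟨min ρ ρ', lt_min h0 h0', by
      simpa using summable_conv_add (fun d : Fin 2 →₀ ℕ => d 0 + d 1) h0 h0' hf hg⟩
  mul_mem' := by
    rintro f g ⟨ρ, h0, hf⟩ ⟨ρ', h0', hg⟩
    have hm : 0 < min ρ ρ' := lt_min h0 h0'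
    refine ⟨min ρ ρ', hm, ?_⟩
    classical
    simp only [MvPowerSeries.coeff_mul]
    refine summable_conv_mul (w := fun d : Fin 2 →₀ ℕ => (min ρ ρ') ^ (d 0 + d 1))
      (fun _ => by positivity) (fun a b => ?_)
      (summable_shrink (fun d : Fin 2 →₀ ℕ => d 0 + d 1) hm (min_le_left _ _) hf)
      (summable_shrink (fun d : Fin 2 →₀ ℕ => d 0 + d 1) hm (min_le_right _ _) hg)
    rw [← pow_add, Finsupp.add_apply, Finsupp.add_apply, add_add_add_comm]
  algebraMap_mem' := by
    intro c
    classical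
    refine ⟨1, one_pos, summable_of_ne_finset_zero (s := {0}) fun n hn => ?_⟩
    have : n ≠ 0 := by simpa using hn
    simp [MvPowerSeries.algebraMap_apply, MvPowerSeries.coeff_C, this]

/-- `ℂ({z})`: the convergent Laurent series `z ^ (-N) * g(z)` with `g ∈ ℂ{z}`, inside the field
`ℂ((z))` of formal Laurent series. -/
def convLaurent : Subalgebra ℂ (LaurentSeries ℂ) where
  carrier := {f | ∃ N : ℕ, ∃ g ∈ convPowerSeries,
    f = HahnSeries.single (-(N : ℤ)) 1 * HahnSeries.ofPowerSeries ℤ ℂ g}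
  add_mem' := by
    rintro _ _ ⟨N, g, hg, rfl⟩ ⟨N', g', hg', rfl⟩
    have hX : (PowerSeries.X : PowerSeries ℂ) ∈ convPowerSeries :=
      ⟨1, one_pos, summable_of_ne_finset_zero (s := {1}) fun n hn => by
        have : n ≠ 1 := by simpa using hn
        simp [PowerSeries.coeff_X, this]⟩
    refine ⟨N + N', PowerSeries.X ^ N' * g + PowerSeries.X ^ N * g',
      add_mem (mul_mem (pow_mem hX _) hg) (mul_mem (pow_mem hX _) hg'), ?_⟩
    simp only [map_add, map_mul, HahnSeries.ofPowerSeries_X_pow, mul_add, ← mul_assoc,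
      HahnSeries.single_mul_single]
    have h1 : -((N + N' : ℕ) : ℤ) + (N' : ℤ) = -N := by push_cast; abel
    have h2 : -((N + N' : ℕ) : ℤ) + (N : ℤ) = -N' := by push_cast; abel
    rw [h1, h2, one_mul]
  mul_mem' := by
    rintro _ _ ⟨N, g, hg, rfl⟩ ⟨N', g', hg', rfl⟩
    refine ⟨N + N', g * g', mul_mem hg hg', ?_⟩
    have : (HahnSeries.single (-((N + N' : ℕ) : ℤ)) (1 : ℂ)) =
        HahnSeries.single (-(N : ℤ)) 1 * HahnSeries.single (-(N' : ℤ)) 1 := by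
      rw [HahnSeries.single_mul_single]
      congr 1
      · push_cast; ring
      · simp
    rw [map_mul, this, mul_mul_mul_comm]
  algebraMap_mem' := by
    intro c
    refine ⟨0, PowerSeries.C c, convPowerSeries.algebraMap_mem c, ?_⟩
    simp [HahnSeries.algebraMap_apply, HahnSeries.ofPowerSeries_C]

/-- `d/dz` on `ℂ((z))`. -/
abbrev ddz : LaurentSeries ℂ →ₗ[ℂ] LaurentSeries ℂ := LaurentSeries.derivative ℂ

theorem ddz_mem {f : LaurentSeries ℂ} (hf : f ∈ convLaurent) : ddz f ∈ convLaurent := by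
  obtain ⟨N, g, ⟨ρ, h0, hg⟩, rfl⟩ := hf
  refine ⟨N + 1, PowerSeries.mk fun k => ((k : ℂ) - N) * PowerSeries.coeff k g,
    ⟨ρ / 2, by positivity, ?_⟩, ?_⟩
  · refine (hg.mul_left ((N : ℝ) + 1)).of_nonneg_of_le (fun _ => by positivity) fun k => ?_
    rw [PowerSeries.coeff_mk, norm_mul, div_pow]
    have h1 : ‖(k : ℂ) - N‖ ≤ k + N := by
      refine (norm_sub_le _ _).trans ?_
      simp
    have h2 : (k : ℝ) + 1 ≤ 2 ^ k := by
      exact_mod_cast Nat.lt_two_pow_self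
    have h3 : ‖(k : ℂ) - N‖ ≤ (N + 1) * 2 ^ k := by
      have : (0 : ℝ) ≤ N := Nat.cast_nonneg _
      have hk : (0 : ℝ) ≤ k := Nat.cast_nonneg _
      nlinarith
    calc ‖(k : ℂ) - N‖ * ‖PowerSeries.coeff k g‖ * (ρ ^ k / 2 ^ k)
        ≤ ((N + 1) * 2 ^ k) * ‖PowerSeries.coeff k g‖ * (ρ ^ k / 2 ^ k) := by gcongr
      _ = ((N : ℝ) + 1) * (‖PowerSeries.coeff k g‖ * ρ ^ k) := by field_simp
  · ext n
    rw [LaurentSeries.derivative_apply, LaurentSeries.hasseDeriv_coeff,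
      HahnSeries.coeff_single_mul, HahnSeries.coeff_single_mul]
    have e : n - -((N + 1 : ℕ) : ℤ) = n + (1 : ℕ) - -(N : ℤ) := by push_cast; ring
    rw [e]
    set j : ℤ := n + (1 : ℕ) - -(N : ℤ) with hj
    rcases lt_or_ge j 0 with hneg | hpos
    · have hz : ∀ u : PowerSeries ℂ, (HahnSeries.ofPowerSeries ℤ ℂ u).coeff j = 0 := by
        intro u
        rw [HahnSeries.ofPowerSeries_apply]
        refine HahnSeries.embDomain_of_notMem_range ?_
        rintro ⟨a, ha⟩
        simp at ha
        omega
      simp [hz]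
    · obtain ⟨k, hk⟩ := Int.eq_ofNat_of_zero_le hpos
      have hc : ∀ u : PowerSeries ℂ,
          (HahnSeries.ofPowerSeries ℤ ℂ u).coeff j = PowerSeries.coeff k u := by
        intro u
        rw [hk]
        exact HahnSeries.ofPowerSeries_apply_coeff u k
      rw [hc, hc, PowerSeries.coeff_mk, one_mul, one_mul]
      have hn : n + (1 : ℕ) = (k : ℤ) - N := by omega
      rw [hn, Ring.choose_one_right]
      simp

/-- `d/dz` on `ℂ({z})`. -/
def ddzConv : convLaurent →ₗ[ℂ] convLaurent :=
  (ddz.comp convLaurent.val.toLinearMap).codRestrict (Subalgebra.toSubmodule convLaurent)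
    fun f => ddz_mem f.2

/-! ### Puiseux series -/

/-- The substitution `f(z) ↦ f(z ^ (1 / s))`, a map from `ℂ((z))` to series with rational exponents.
Its image is the field `ℂ((z ^ (1 / s)))`. -/
def ramify (s : ℕ+) : LaurentSeries ℂ →+* HahnSeries ℚ ℂ :=
  have hs : (0 : ℚ) < ((s : ℕ) : ℚ) := by exact_mod_cast s.pos
  have hle : ∀ a b : ℤ, (a : ℚ) / (s : ℕ) ≤ (b : ℚ) / (s : ℕ) ↔ a ≤ b := fun a b => by
    rw [div_le_div_iff_of_pos_right hs, Int.cast_le]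
  HahnSeries.embDomainRingHom
    { toFun := fun n : ℤ => (n : ℚ) / (s : ℕ)
      map_zero' := by simp
      map_add' := fun a b => by rw [Int.cast_add, add_div] }
    (fun a b h => le_antisymm ((hle a b).1 h.le) ((hle b a).1 h.ge))
    hle

theorem ramify_coeff (s : ℕ+) (f : LaurentSeries ℂ) (n : ℤ) :
    (ramify s f).coeff ((n : ℚ) / (s : ℕ)) = f.coeff n := by
  exact HahnSeries.embDomain_coeff (f := ⟨⟨fun n : ℤ => (n : ℚ) / (s : ℕ), _⟩, _⟩)

theorem exists_of_ramify_coeff_ne_zero (s : ℕ+) (f : LaurentSeries ℂ) {e : ℚ}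
    (h : (ramify s f).coeff e ≠ 0) : ∃ n : ℤ, e = (n : ℚ) / (s : ℕ) := by
  by_contra hn
  refine h (HahnSeries.embDomain_of_notMem_range ?_)
  rintro ⟨n, rfl⟩
  exact hn ⟨n, rfl⟩

/-- `𝒫 = ⋃ₛ ℂ((z ^ (1 / s)))`: the series with complex coefficients whose exponents lie in
`(1 / s) ℤ` for some positive integer `s`. -/
def Puiseux : Subalgebra ℂ (HahnSeries ℚ ℂ) where
  carrier := {f | ∃ s : ℕ+, ∀ e : ℚ, f.coeff e ≠ 0 → ∃ n : ℤ, e = (n : ℚ) / (s : ℕ)}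
  add_mem' := by
    rintro f g ⟨s, hf⟩ ⟨t, hg⟩
    have hs : ((s : ℕ) : ℚ) ≠ 0 := by exact_mod_cast s.ne_zero
    have ht : ((t : ℕ) : ℚ) ≠ 0 := by exact_mod_cast t.ne_zero
    refine ⟨s * t, fun e he => ?_⟩
    by_cases h : f.coeff e = 0
    · obtain ⟨n, rfl⟩ := hg e (fun h' => he (by rw [HahnSeries.coeff_add, h, h', add_zero]))
      exact ⟨n * (s : ℕ), by push_cast; field_simp⟩
    · obtain ⟨n, rfl⟩ := hf e h
      exact ⟨n * (t : ℕ), by push_cast; field_simp⟩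
  mul_mem' := by
    rintro f g ⟨s, hf⟩ ⟨t, hg⟩
    have hs : ((s : ℕ) : ℚ) ≠ 0 := by exact_mod_cast s.ne_zero
    have ht : ((t : ℕ) : ℚ) ≠ 0 := by exact_mod_cast t.ne_zero
    refine ⟨s * t, fun e he => ?_⟩
    obtain ⟨a, ha, b, hb, rfl⟩ := Set.mem_add.1 (HahnSeries.support_mul_subset he)
    obtain ⟨n, rfl⟩ := hf a ha
    obtain ⟨k, rfl⟩ := hg b hb
    exact ⟨n * (t : ℕ) + k * (s : ℕ), by push_cast; field_simp⟩
  algebraMap_mem' := by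
    intro c
    refine ⟨1, fun e he => ⟨0, ?_⟩⟩
    by_contra h
    refine he ?_
    have h' : e ≠ 0 := by simpa using h
    simp [HahnSeries.algebraMap_apply, HahnSeries.C_apply, HahnSeries.coeff_single_of_ne h']

theorem ramify_mem (s : ℕ+) (f : LaurentSeries ℂ) : ramify s f ∈ Puiseux :=
  ⟨s, fun _ => exists_of_ramify_coeff_ne_zero s f⟩

/-- The inclusion `ℂ((z)) ⊆ 𝒫`. -/
def toPuiseux : LaurentSeries ℂ →+* Puiseux :=
  (ramify 1).codRestrict Puiseux (ramify_mem 1)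

instance : Algebra (LaurentSeries ℂ) Puiseux := toPuiseux.toAlgebra

/-- The orbit `Gal(𝒫 / ℂ((z))) · q`. -/
def galoisOrbit (q : Puiseux) : Set Puiseux :=
  MulAction.orbit (Puiseux ≃ₐ[LaurentSeries ℂ] Puiseux) q

/-- The monodromy `ξ : f(z) ↦ f(e ^ (2πi) z)`, i.e. `∑ aₑ zᵉ ↦ ∑ aₑ e ^ (2πi e) zᵉ`. -/
def xi (f : HahnSeries ℚ ℂ) : HahnSeries ℚ ℂ where
  coeff e := Complex.exp (2 * Real.pi * Complex.I * (e : ℂ)) * f.coeff e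
  isPWO_support' := f.isPWO_support.mono fun e he h => he (by
    simp only [h, mul_zero])

/-- The monodromy as a self-map of `𝒫`. -/
def xiP (f : Puiseux) : Puiseux :=
  ⟨xi f, f.2.imp fun _ hs e he => hs e (right_ne_zero_of_mul he)⟩

/-- `z ^ e` for a rational exponent `e`. -/
def zpow (e : ℚ) : HahnSeries ℚ ℂ := HahnSeries.single e 1

theorem zpow_mem (e : ℚ) : zpow e ∈ Puiseux := by
  refine ⟨⟨e.den, e.pos⟩, fun e' he' => ⟨e.num, ?_⟩⟩
  by_contra h
  refine he' (HahnSeries.coeff_single_of_ne fun h' => h ?_)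
  rw [h']
  exact (Rat.num_div_den e).symm

/-- The derivation `d/dz` on `𝒫`: `∑ aₑ zᵉ ↦ ∑ e aₑ z ^ (e - 1)`. -/
def ddzP (f : Puiseux) : Puiseux :=
  ⟨zpow (-1), zpow_mem (-1)⟩ *
    ⟨{ coeff := fun e => (e : ℂ) * (f : HahnSeries ℚ ℂ).coeff e
       isPWO_support' := (f : HahnSeries ℚ ℂ).isPWO_support.mono fun e he h => he (by
        simp only [h, mul_zero]) },
      f.2.imp fun _ hs e he => hs e (right_ne_zero_of_mul he)⟩

/-- `𝒫⁻ = ⋃ₛ z ^ (-1 / s) ℂ[z ^ (-1 / s)]`: the Puiseux series with negative exponents only. -/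
def PuiseuxNeg : Set Puiseux :=
  {q | ∀ e : ℚ, 0 ≤ e → (q : HahnSeries ℚ ℂ).coeff e = 0}

open Classical in
/-- The ramification index of `q`: the least `s > 0` such that all exponents of `q` lie in
`(1 / s) ℤ`. -/
def ramIndex (q : Puiseux) : ℕ+ := PNat.find q.2

/-- `ℂ({z ^ (1 / s)})`: the convergent Laurent series in `z ^ (1 / s)`. -/
def convPuiseux (s : ℕ+) : Set (HahnSeries ℚ ℂ) :=
  {f | ∃ g ∈ convLaurent, f = ramify s g}

/-! ### Differential modules and irregularity -/

section Modules

variable {ι κ : Type*} [Fintype ι] [DecidableEq ι] [Fintype κ] [DecidableEq κ]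

/-- The derivation `d/dz - G` of the differential module `M_G = K ^ ι`. -/
def connection {K : Type*} [CommRing K] [Algebra ℂ K] (D : K →ₗ[ℂ] K) (G : Matrix ι ι K) :
    (ι → K) →ₗ[ℂ] (ι → K) :=
  LinearMap.pi (fun i => D.comp (LinearMap.proj i)) - (Matrix.mulVecLin G).restrictScalars ℂ

/-- The matrix of the differential module `Hom(M_G, M_H) = M_G^* ⊗ M_H`: the dual of `M_G` has
matrix `-Gᵀ`. -/
def homMatrix {K : Type*} [CommRing K] (G : Matrix ι ι K) (H : Matrix κ κ K) :
    Matrix (κ × ι) (κ × ι) K :=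
  H ⊗ₖ (1 : Matrix ι ι K) + (1 : Matrix κ κ K) ⊗ₖ (-G.transpose)

/-- Under `Hom(K ^ ι, K ^ κ) = K ^ (κ × ι)` the derivation with matrix `homMatrix G H` is
`φ ↦ ∇_H ∘ φ - φ ∘ ∇_G`, i.e. `φ ↦ φ' - H φ + φ G`. -/
theorem connection_homMatrix {K : Type*} [CommRing K] [Algebra ℂ K] (D : K →ₗ[ℂ] K)
    (G : Matrix ι ι K) (H : Matrix κ κ K) (φ : Matrix κ ι K) (a : κ × ι) :
    connection D (homMatrix G H) (fun b => φ b.1 b.2) a =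
      (φ.map D - H * φ + φ * G) a.1 a.2 := by
  obtain ⟨a, b⟩ := a
  simp [connection, homMatrix, Matrix.mulVec, dotProduct, Fintype.sum_prod_type, Matrix.mul_apply,
    Matrix.one_apply, Finset.sum_neg_distrib, mul_comm, sub_eq_add_neg, add_assoc]
  exact add_comm _ _

/-- Kernel and cokernel of a linear endomorphism are finite dimensional. -/
def HasIndex {V : Type*} [AddCommGroup V] [Module ℂ V] (Φ : V →ₗ[ℂ] V) : Prop :=
  Module.Finite ℂ (LinearMap.ker Φ) ∧ Module.Finite ℂ (V ⧸ LinearMap.range Φ)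

/-- The index `χ(Φ) = dim Ker Φ - dim Coker Φ`. -/
def index {V : Type*} [AddCommGroup V] [Module ℂ V] (Φ : V →ₗ[ℂ] V) : ℤ :=
  (Module.finrank ℂ (LinearMap.ker Φ) : ℤ) - (Module.finrank ℂ (V ⧸ LinearMap.range Φ) : ℤ)

/-- The derivation of the differential module `M_G` over `ℂ({z})`. -/
def nablaConv (G : Matrix ι ι convLaurent) : (ι → convLaurent) →ₗ[ℂ] (ι → convLaurent) :=
  connection ddzConv G

/-- The derivation of the formalization `ℂ((z)) ⊗ M_G`. -/
def nablaFormal (G : Matrix ι ι convLaurent) :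
    (ι → LaurentSeries ℂ) →ₗ[ℂ] (ι → LaurentSeries ℂ) :=
  connection ddz (G.map fun f => (f : LaurentSeries ℂ))

/-- The Komatsu-Malgrange irregularity `χ(∇ on ℂ((z)) ⊗ M_G) - χ(∇ on M_G)`. -/
def irregularity (G : Matrix ι ι convLaurent) : ℤ := 
  index (nablaFormal G) - index (V := ι → convLaurent) (nablaConv G)

/-- The irregularity of `M_G` is defined: both indices are indices of operators with finite
dimensional kernel and cokernel. -/
def HasIrregularity (G : Matrix ι ι convLaurent) : Prop :=
  HasIndex (nablaFormal G) ∧ HasIndex (V := ι → convLaurent) (nablaConv G)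

/-- `E` is the matrix of the differential module `𝒫 ⊗ M_G` with respect to a suitable basis:
`E = X G X⁻¹ + X' X⁻¹` for some `X ∈ GL(𝒫)`. -/
def IsPuiseuxMatrixOf (G : Matrix ι ι convLaurent) (E : Matrix ι ι Puiseux) : Prop :=
  ∃ X : GL ι Puiseux,
    E = X.1 * (G.map fun f => toPuiseux (f : LaurentSeries ℂ)) * X⁻¹.1 + X.1.map ddzP * X⁻¹.1

end Modules

/-- The elementary HTL cell of multiplicity one
`E_{q,R} = diag(q + R, ξ(q) + R, …, ξ^(r-1)(q) + R) z⁻¹`, with `r` the ramification index of `q`. -/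
def cell (q : Puiseux) (R : ℂ) : Matrix (Fin (ramIndex q)) (Fin (ramIndex q)) Puiseux :=
  Matrix.diagonal fun k =>
    (xiP^[(k : ℕ)] q + algebraMap ℂ Puiseux R) * ⟨zpow (-1), zpow_mem (-1)⟩

/-! ### Plane curve germs -/

/-- The polynomial `∏_{k < r} (ζ - z / ξ^k(q̃))` in `ζ`. -/
def branchPolynomial (r : ℕ) (qt : HahnSeries ℚ ℂ) : Polynomial (HahnSeries ℚ ℂ) :=
  ∏ k ∈ Finset.range r, (Polynomial.X - Polynomial.C (zpow 1 * (xi^[k] qt)⁻¹))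

/-- `f ∈ ℂ{z, ζ}` is the polynomial `P` in `ζ`: for each `b` the coefficient of `ζ ^ b` in `P` is a
power series in `z`, and it equals the coefficient of `ζ ^ b` in `f`. -/
def IsPolynomialIn (f : convPowerSeries₂) (P : Polynomial (HahnSeries ℚ ℂ)) : Prop :=
  ∀ b : ℕ, P.coeff b = HahnSeries.ofPowerSeries ℚ ℂ (PowerSeries.mk fun a =>
    MvPowerSeries.coeff (Finsupp.single 0 a + Finsupp.single 1 b) (f : MvPowerSeries (Fin 2) ℂ))

/-- `f = 0` is the equation of the germ `C_{q̃}` at `(ζ, z) = (0, 0)`, where `q̃ ∈ ℂ({z ^ (1 / r)})`. -/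
def IsEquationOfGerm (f : convPowerSeries₂) (r : ℕ) (qt : HahnSeries ℚ ℂ) : Prop :=
  IsPolynomialIn f (branchPolynomial r qt)

/-- The local ring `ℂ{z, ζ} / (f, g)` of the intersection of two germs at the origin. -/
abbrev IntersectionRing (f g : convPowerSeries₂) : Type :=
  convPowerSeries₂ ⧸ Ideal.span {f, g}

/-- The intersection number `dim_ℂ ℂ{z, ζ} / (f, g)` of the germs `f = 0` and `g = 0` at the
origin. -/
def intersectionNumber (f g : convPowerSeries₂) : ℕ := Module.finrank ℂ (IntersectionRing f g)

end

end HTL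

/-! Put z = t^s, with s divisible by both ramification indices and by the denominators of the
exponents in the gauge matrices. The formula is proved after multiplication by s, as an equality of
two sums over pairs of conjugates. Let -P(l,k) be the t-order of ξ^l(q_j) - ξ^k(q_i). Since the
orbits are disjoint and only negative exponents occur, P(l,k) is a positive integer.

Intersection number. ℂ{t,ζ} is free of rank s over ℂ{z,ζ}, so the passage to t multiplies the
dimension of the local ring by s (`pairLength_dilate₂`). Over t each germ becomes a product of
smooth branches ζ = α_k(t), α_k = t^s / ξ^k(q̃), which vanish at t = 0 because ord(q̃/z) < 0. Two
branches meet with multiplicity ord_t(α_k - β_l), and lengths are additive in the branches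
(`pairLength_prod_prod`). From t^s/g - t^s/h = t^s (h - g)/(gh) this multiplicity is s + n_i + n_j -
P(l,k), where n_i = s p_i / r_i; the holomorphic parts of the q̃ do not affect these orders
(`exists_germs`).

Irregularity. The two gauge matrices combine to diagonalize Hom over ℂ((t)), with entries ξ^l(q_j) -
ξ^k(q_i) up to constants (`Diagonalizes.hom`). Then s·Irr is the sum of the P(l,k)
(`IsDiagonalization.irregularity`). Summing s + n_i + n_j - P(l,k) over all pairs gives the claim.

The irregularity is computed by lattices. Let n be the rank and let T = z^e (z d/dz - zG), with e
large. All exponents have poles, so the derivation is a small perturbation of multiplication by the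
exponents and T is bijective on the space W of formal Laurent vectors. The formal index is therefore
0, and Irr is the dimension of the cokernel of T on the convergent Laurent vectors V. If L is the
lattice of formal power series vectors, then V + L = W, and the cokernel of T on V ∩ L has dimension
equal to the sum of those on V and on L (`relLength_inf_map`). On V ∩ L = ℂ{z}^n it is n e, whatever
the matrix is (`relLength_convVec`). On L, s times the dimension is the sum of the s e - p_i, p_i
being the pole order of the i-th exponent in t (`mul_relLength_latticeOp`). The difference is the
irregularity.

The value n e is obtained on spaces of series with a weighted sup norm: on high degrees z^e (z d/dz)
has a small right inverse, so the matrix term is a contraction there. The cokernel is spanned by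
polynomials, which permits passing to the union over all radii.

Lengths take values in `ℕ∞`, so that each finiteness statement comes together with the value. -/

namespace HTL

/-! ### Relative length of submodules -/

section RelLength

variable {R : Type*} [Ring R] {W W' : Type*} [AddCommGroup W] [Module R W]
  [AddCommGroup W'] [Module R W']

/-- The length of `A / (A ⊓ B)`. -/
noncomputable def relLength (A B : Submodule R W) : ℕ∞ := Module.length R (A ⧸ B.submoduleOf A)

/-- The exact sequence 0 → B/C → A/C → A/B → 0. -/
theorem relLength_add {A B C : Submodule R W} (hBA : B ≤ A) (hCB : C ≤ B) :
    relLength A C = relLength B C + relLength A B := by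
  let f : (B ⧸ C.submoduleOf B) →ₗ[R] (A ⧸ C.submoduleOf A) :=
    Submodule.mapQ _ _ (Submodule.inclusion hBA) (fun x hx => by
      simpa [Submodule.submoduleOf] using hx)
  let g : (A ⧸ C.submoduleOf A) →ₗ[R] (A ⧸ B.submoduleOf A) :=
    Submodule.mapQ _ _ LinearMap.id (fun x hx => by
      simp only [Submodule.submoduleOf, Submodule.mem_comap, Submodule.subtype_apply] at hx
      simpa [Submodule.submoduleOf] using hCB hx)
  refine Module.length_eq_add_of_exact f g ?_ ?_ ?_
  · rw [← LinearMap.ker_eq_bot, LinearMap.ker_eq_bot']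
    intro x
    induction x using Submodule.Quotient.induction_on with
    | _ x =>
      intro hx
      simp only [f, Submodule.mapQ_apply, Submodule.Quotient.mk_eq_zero] at hx ⊢
      simpa [Submodule.submoduleOf] using hx
  · intro x
    induction x using Submodule.Quotient.induction_on with
    | _ x => exact ⟨Submodule.Quotient.mk x, rfl⟩
  · intro x
    induction x using Submodule.Quotient.induction_on with
    | _ x =>
      simp only [g, Submodule.mapQ_apply, LinearMap.id_apply, Submodule.Quotient.mk_eq_zero]
      constructor
      · intro hx
        exact ⟨Submodule.Quotient.mk ⟨x, by simpa [Submodule.submoduleOf] using hx⟩, rfl⟩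
      · rintro ⟨y, hy⟩
        induction y using Submodule.Quotient.induction_on with
        | _ y =>
          simp only [f, Submodule.mapQ_apply] at hy
          rw [Submodule.Quotient.eq] at hy
          simp only [Submodule.submoduleOf, Submodule.mem_comap, Submodule.subtype_apply,
            AddSubgroupClass.coe_sub, Submodule.coe_inclusion] at hy ⊢
          have := B.sub_mem y.2 (hCB hy)
          simpa using this

theorem relLength_top_left (B : Submodule R W) : relLength ⊤ B = Module.length R (W ⧸ B) :=
  LinearEquiv.length_eq (Submodule.Quotient.equiv _ _ Submodule.topEquiv (by
    ext x; simp [Submodule.submoduleOf]))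

theorem relLength_map {f : W →ₗ[R] W'} (hf : Function.Injective f) (A B : Submodule R W) :
    relLength (A.map f) (B.map f) = relLength A B := by
  refine (LinearEquiv.length_eq (Submodule.Quotient.equiv _ _
    (Submodule.equivMapOfInjective f hf A) ?_)).symm
  ext ⟨y, hy⟩
  obtain ⟨x, hx, rfl⟩ := hy
  simp only [Submodule.submoduleOf, Submodule.mem_map, Submodule.mem_comap,
    Submodule.subtype_apply, Subtype.exists]
  constructor
  · rintro ⟨a, ha, hab, h⟩
    have := congrArg Subtype.val h
    exact ⟨a, hab, by simpa using this⟩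
  · rintro ⟨b, hb, h⟩
    obtain rfl := hf h
    exact ⟨b, hx, hb, Subtype.ext (by simp)⟩

/-- Second isomorphism theorem. -/
theorem relLength_sup (A B : Submodule R W) : relLength (A ⊔ B) B = relLength A (A ⊓ B) :=
  (LinearEquiv.length_eq ((Submodule.quotEquivOfEq _ _ (by
    ext x; simp [Submodule.submoduleOf])).trans
    (LinearMap.quotientInfEquivSupQuotient A B))).symm

theorem relLength_self (A : Submodule R W) : relLength A A = 0 := by
  rw [relLength, Module.length_eq_zero_iff, Submodule.submoduleOf_self]
  infer_instance

theorem le_of_relLength_eq_zero {A B : Submodule R W} (h : relLength A B = 0) : A ≤ B := by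
  rw [relLength, Module.length_eq_zero_iff, Submodule.Quotient.subsingleton_iff] at h
  exact Submodule.submoduleOf_eq_top.mp h

theorem relLength_mono_right {A B B' : Submodule R W} (h : B ≤ B') (hB : B' ≤ A) :
    relLength A B' ≤ relLength A B := by
  rw [relLength_add hB h]
  exact le_add_self

theorem relLength_pi {ι : Type*} [Fintype ι] {V : ι → Type*} [∀ i, AddCommGroup (V i)]
    [∀ i, Module R (V i)] (A B : ∀ i, Submodule R (V i)) :
    relLength (Submodule.pi Set.univ A) (Submodule.pi Set.univ B) =
      ∑ i, relLength (A i) (B i) := by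
  classical
  unfold relLength
  rw [← Module.length_pi_of_fintype]
  refine LinearEquiv.length_eq ?_
  let f : (Submodule.pi Set.univ A) →ₗ[R] (∀ i, A i ⧸ (B i).submoduleOf (A i)) :=
    LinearMap.pi fun i => (Submodule.mkQ _).comp
      (((LinearMap.proj i).comp (Submodule.subtype _)).codRestrict (A i)
        fun x => x.2 i (Set.mem_univ i))
  have hf : Function.Surjective f := by
    intro y
    choose x hx using fun i => Submodule.Quotient.mk_surjective _ (y i)
    exact ⟨⟨fun i => x i, fun i _ => (x i).2⟩, funext hx⟩
  refine (Submodule.quotEquivOfEq _ _ ?_).trans (f.quotKerEquivOfSurjective hf)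
  ext x
  rw [LinearMap.mem_ker, funext_iff]
  have hfx : ∀ i, f x i = Submodule.Quotient.mk ⟨x.1 i, x.2 i (Set.mem_univ i)⟩ := fun _ => rfl
  simp only [hfx, Pi.zero_apply, Submodule.Quotient.mk_eq_zero]
  simp [Submodule.submoduleOf, Submodule.mem_pi]

/-- The source of the explicit colengths: a map reading off finitely many coefficients, onto when
restricted to A. -/
theorem relLength_inf_ker {f : W →ₗ[R] W'} {A : Submodule R W} (hf : A.map f = ⊤) :
    relLength A (A ⊓ LinearMap.ker f) = Module.length R W' := by
  have hs : Function.Surjective (f.domRestrict A) := fun y => by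
    obtain ⟨x, hx, rfl⟩ : y ∈ A.map f := hf ▸ Submodule.mem_top
    exact ⟨⟨x, hx⟩, rfl⟩
  rw [relLength, ← ((f.domRestrict A).quotKerEquivOfSurjective hs).length_eq]
  refine LinearEquiv.length_eq (Submodule.quotEquivOfEq _ _ ?_)
  ext x
  simp [Submodule.submoduleOf]

theorem relLength_comap {f : W →ₗ[R] W'} (hf : Function.Bijective f) (A B : Submodule R W') :
    relLength (A.comap f) (B.comap f) = relLength A B := by
  rw [← relLength_map hf.1, Submodule.map_comap_eq_of_surjective hf.2,
    Submodule.map_comap_eq_of_surjective hf.2]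

theorem map_eq_of_forall_mem_iff {f : W →ₗ[R] W'} (hf : Function.Surjective f)
    {A : Submodule R W} {B : Submodule R W'} (h : ∀ v, f v ∈ B ↔ v ∈ A) : A.map f = B := by
  ext w
  obtain ⟨v, rfl⟩ := hf w
  refine ⟨?_, fun hv => ⟨v, (h v).mp hv, rfl⟩⟩
  rintro ⟨v', hv', e⟩
  rw [← e]
  exact (h v').mpr hv'

/-- If `T` is injective, `A / T A` has the same length for commensurable `A`. -/
theorem relLength_map_eq_of_le {T : W →ₗ[R] W} (hT : Function.Injective T) {A A' : Submodule R W}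
    (hA : A.map T ≤ A) (hA' : A'.map T ≤ A') (h : A' ≤ A) (hfin : relLength A A' ≠ ⊤) :
    relLength A (A.map T) = relLength A' (A'.map T) := by
  -- The length of A / T A' is computed along A ≥ T A ≥ T A' and along A ≥ A' ≥ T A'. Since T A / T
  -- A' and A / A' have the same finite length, it cancels.
  have h1 := relLength_add hA (Submodule.map_mono (f := T) h)
  have h2 := relLength_add h hA'
  rw [relLength_map hT] at h1
  rw [h1, add_comm (relLength A' _)] at h2
  exact (ENat.add_right_injective_of_ne_top hfin) h2

/-- If `T` is bijective and `V`, `L` are stable under `T` and span, then the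
lengths of the cokernels of `T` on `V` and `L` add up to that on `V ⊓ L`. -/
theorem relLength_inf_map {T : W →ₗ[R] W} (hT : Function.Bijective T) {V L : Submodule R W}
    (hV : V.map T ≤ V) (hL : L.map T ≤ L) (hVL : V ⊔ L = ⊤) :
    relLength (V ⊓ L) ((V ⊓ L).map T) = relLength V (V.map T) + relLength L (L.map T) := by
  -- By the modular law, V = (V ⊓ L) + T V and L = (L ⊓ T V) + T L. Hence V / T V and L / T L are
  -- the successive quotients of the chain V ⊓ L ≥ L ⊓ T V ≥ T (V ⊓ L).
  have e : (V ⊓ L).map T = V.map T ⊓ L.map T := Submodule.map_inf _ hT.1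
  have etop : V.map T ⊔ L.map T = ⊤ := by
    rw [← Submodule.map_sup, hVL, Submodule.map_top, LinearMap.range_eq_top.mpr hT.2]
  have e1 : (V ⊓ L) ⊔ V.map T = V := by
    rw [sup_comm, inf_comm, ← sup_inf_assoc_of_le _ hV]
    refine inf_eq_right.mpr (le_top.trans ?_)
    rw [← etop]
    exact sup_le_sup_left hL _
  have e2 : (L ⊓ V.map T) ⊔ L.map T = L := by
    rw [sup_comm, inf_comm, ← sup_inf_assoc_of_le _ hL, sup_comm (L.map T), etop, top_inf_eq]
  have e3 : V ⊓ L ⊓ V.map T = L ⊓ V.map T := by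
    rw [inf_right_comm, inf_eq_right.mpr hV, inf_comm]
  have e4 : L ⊓ V.map T ⊓ L.map T = (V ⊓ L).map T := by
    rw [e, inf_right_comm, inf_eq_right.mpr hL, inf_comm]
  rw [relLength_add (B := V ⊓ L ⊓ V.map T) inf_le_left (by
    rw [e3, ← e4]; exact inf_le_left), ← relLength_sup, e1, e3, ← e4, ← relLength_sup, e2, add_comm]

end RelLength


/-! ### The order filtration on Laurent series -/

section Filtration

/-- Makes multiplication by a Laurent series linear for the coefficientwise action, as
`LinearMap.mulLeft ℂ` requires. -/
instance : SMulCommClass ℂ (LaurentSeries ℂ) (LaurentSeries ℂ) :=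
  ⟨fun a f g => by
    simp only [smul_eq_mul, ← HahnSeries.C_mul_eq_smul, mul_left_comm]⟩

/-- The Laurent series of order at least `m`. -/
noncomputable def ordGE (m : ℤ) : Submodule ℂ (LaurentSeries ℂ) where
  carrier := {f | ∀ j < m, f.coeff j = 0}
  add_mem' := fun {f g} hf hg j hj => by
    rw [HahnSeries.coeff_add, hf j hj, hg j hj, add_zero]
  zero_mem' := fun j _ => HahnSeries.coeff_zero
  smul_mem' := fun c f hf j hj => by rw [HahnSeries.coeff_smul, hf j hj, smul_zero]

theorem mem_ordGE {m : ℤ} {f : LaurentSeries ℂ} : f ∈ ordGE m ↔ ∀ j < m, f.coeff j = 0 := Iff.rfl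

theorem mem_ordGE_iff_le_orderTop {m : ℤ} {f : LaurentSeries ℂ} :
    f ∈ ordGE m ↔ (m : WithTop ℤ) ≤ f.orderTop := by
  rw [mem_ordGE, HahnSeries.le_orderTop_iff_forall]
  simp only [WithTop.coe_lt_coe]

theorem ordGE_anti {m n : ℤ} (h : m ≤ n) : ordGE n ≤ ordGE m :=
  fun _ hf j hj => hf j (hj.trans_le h)

theorem exists_mem_ordGE (f : LaurentSeries ℂ) : ∃ m : ℤ, f ∈ ordGE m :=
  ⟨f.order, fun _ hj => HahnSeries.coeff_eq_zero_of_lt_order hj⟩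

theorem exists_forall_mem_ordGE {α : Type*} [Finite α] (f : α → LaurentSeries ℂ) :
    ∃ m : ℤ, ∀ a, f a ∈ ordGE m := by
  choose m hm using fun a => exists_mem_ordGE (f a)
  obtain ⟨k, hk⟩ := (Set.finite_range m).bddBelow
  exact ⟨k, fun a => ordGE_anti (hk ⟨a, rfl⟩) (hm a)⟩

theorem mul_mem_ordGE {a b : ℤ} {f g : LaurentSeries ℂ} (hf : f ∈ ordGE a) (hg : g ∈ ordGE b) :
    f * g ∈ ordGE (a + b) := by
  rw [mem_ordGE_iff_le_orderTop] at *
  rw [HahnSeries.orderTop_mul, WithTop.coe_add]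
  exact add_le_add hf hg

theorem mul_mem_ordGE_iff {a : ℤ} {f g : LaurentSeries ℂ} (hf : f.orderTop = a) {m : ℤ} :
    f * g ∈ ordGE (a + m) ↔ g ∈ ordGE m := by
  rw [mem_ordGE_iff_le_orderTop, mem_ordGE_iff_le_orderTop, HahnSeries.orderTop_mul, hf,
    WithTop.coe_add]
  exact WithTop.add_le_add_iff_left WithTop.coe_ne_top

theorem eq_zero_of_forall_mem_ordGE {f : LaurentSeries ℂ} (m : ℤ)
    (h : ∀ n : ℕ, f ∈ ordGE (m + n)) : f = 0 := by
  ext j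
  exact h ((j - m).toNat + 1) j (by push_cast; omega)

/-- A Laurent series given by its coefficients in degrees at least `m`. -/
noncomputable def laurentOfCoeff (m : ℤ) (c : ℤ → ℂ) : LaurentSeries ℂ :=
  HahnSeries.ofSuppBddBelow (fun j => if j < m then 0 else c j)
    ⟨m, fun _ hj => not_lt.mp fun h => hj (if_pos h)⟩

theorem laurentOfCoeff_coeff (m : ℤ) (c : ℤ → ℂ) (j : ℤ) :
    (laurentOfCoeff m c).coeff j = if j < m then 0 else c j := rfl

theorem laurentOfCoeff_mem (m : ℤ) (c : ℤ → ℂ) : laurentOfCoeff m c ∈ ordGE m :=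
  fun j hj => by rw [laurentOfCoeff_coeff, if_pos hj]

theorem relLength_ordGE (m : ℤ) (d : ℕ) : relLength (ordGE m) (ordGE (m + d)) = d := by
  let f : LaurentSeries ℂ →ₗ[ℂ] (Fin d → ℂ) :=
    { toFun := fun x k => x.coeff (m + (k : ℕ))
      map_add' := fun x y => by ext; simp
      map_smul' := fun c x => by ext; simp }
  have hf : (ordGE m).map f = ⊤ := by
    refine eq_top_iff.mpr fun y _ => ⟨laurentOfCoeff m fun j =>
      if h : (j - m).toNat < d then y ⟨(j - m).toNat, h⟩ else 0, laurentOfCoeff_mem _ _, ?_⟩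
    ext k
    simp [f, laurentOfCoeff_coeff]
  have e : ordGE (m + d) = ordGE m ⊓ LinearMap.ker f := by
    ext x
    rw [Submodule.mem_inf, LinearMap.mem_ker, mem_ordGE]
    constructor
    · intro h
      refine ⟨fun j hj => h j (by omega), ?_⟩
      ext k
      exact h _ (by have := k.2; omega)
    · rintro ⟨hx, h⟩ j hj
      by_cases hjm : j < m
      · exact hx j hjm
      · have := congrFun h ⟨(j - m).toNat, by omega⟩
        simp only [f, LinearMap.coe_mk, AddHom.coe_mk, Pi.zero_apply] at this
        rwa [show m + ((j - m).toNat : ℤ) = j by omega] at this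
  rw [e, relLength_inf_ker hf, Module.length_eq_finrank]
  simp

/-- If `Q` raises the order then `1 - Q` is surjective. -/
theorem exists_sub_eq_of_raises {Q : LaurentSeries ℂ →ₗ[ℂ] LaurentSeries ℂ}
    (hQ : ∀ k, ∀ f ∈ ordGE k, Q f ∈ ordGE (k + 1)) (b : LaurentSeries ℂ) :
    ∃ y, y - Q y = b := by
  obtain ⟨m, hb⟩ := exists_mem_ordGE b
  -- Fixed point iteration for x = b + Q x. Consecutive iterates differ by Q^n b, of order at least
  -- m + n.
  let y : ℕ → LaurentSeries ℂ := fun n => (fun x => b + Q x)^[n] 0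
  have hs : ∀ n, y (n + 1) = b + Q (y n) := fun n => Function.iterate_succ_apply' _ _ _
  have hd : ∀ n : ℕ, y (n + 1) - y n ∈ ordGE (m + n) := by
    intro n
    induction n with
    | zero => simpa [hs, y] using hb
    | succ n ih =>
      have h1 : y (n + 1 + 1) - y (n + 1) = Q (y (n + 1) - y n) := by
        rw [map_sub, hs (n + 1), hs n, add_sub_add_left_eq_sub, ← hs n]
      rw [h1]
      have := hQ _ _ ih
      rwa [add_assoc] at this
  have hd' : ∀ n k : ℕ, y (n + k) - y n ∈ ordGE (m + n) := by
    intro n k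
    induction k with
    | zero => simp
    | succ k ih =>
      have := add_mem (ordGE_anti (by push_cast; omega) (hd (n + k))) ih
      rwa [sub_add_sub_cancel] at this
  -- The limit, coefficient by coefficient: the coefficient of degree j is constant from the iterate
  -- j - m + 1 on.
  let z := laurentOfCoeff m fun j => (y ((j - m).toNat + 1)).coeff j
  have hz : ∀ n : ℕ, z - y n ∈ ordGE (m + n) := by
    intro n j hj
    rw [HahnSeries.coeff_sub, laurentOfCoeff_coeff]
    split_ifs with h
    · have h0 := hd' 0 n j (by simpa using h)
      have y0 : y 0 = 0 := rfl
      rw [y0, sub_zero, zero_add] at h0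
      rw [h0, sub_zero]
    · obtain ⟨k, hk⟩ := Nat.exists_eq_add_of_le (show (j - m).toNat + 1 ≤ n by omega)
      have := hd' ((j - m).toNat + 1) k j (by push_cast; omega)
      rw [← hk, HahnSeries.coeff_sub] at this
      rw [← neg_sub, this, neg_zero]
  refine ⟨z, ?_⟩
  rw [← sub_eq_zero]
  refine eq_zero_of_forall_mem_ordGE m fun n => ?_
  have h1 : z - Q z - b = (z - y (n + 1)) - Q (z - y n) := by
    rw [hs, map_sub]; abel
  rw [h1]
  refine sub_mem (ordGE_anti (by push_cast; omega) (hz (n + 1))) ?_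
  exact ordGE_anti (n := m + n + 1) (by omega) (hQ _ _ (hz n))

/-- Bootstrapping: writing y = (y - Q y) + Q y improves a known lower bound for the order of y by
one, until m is reached. -/
theorem sub_mem_ordGE_iff_of_raises {Q : LaurentSeries ℂ →ₗ[ℂ] LaurentSeries ℂ}
    (hQ : ∀ k, ∀ f ∈ ordGE k, Q f ∈ ordGE (k + 1)) {y : LaurentSeries ℂ} {m : ℤ} :
    y - Q y ∈ ordGE m ↔ y ∈ ordGE m := by
  refine ⟨fun h => ?_, fun h => sub_mem h (ordGE_anti (by omega) (hQ _ _ h))⟩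
  obtain ⟨k, hk⟩ := exists_mem_ordGE y
  have key : ∀ n : ℕ, y ∈ ordGE (min m (k + n)) := by
    intro n
    induction n with
    | zero => exact ordGE_anti (by simp) hk
    | succ n ih =>
      have h1 := add_mem (ordGE_anti (min_le_left m (k + (n + 1 : ℕ))) h)
        (ordGE_anti (m := min m (k + (n + 1 : ℕ))) (by push_cast; omega) (hQ _ _ ih))
      rwa [sub_add_cancel] at h1
  exact ordGE_anti (by omega) (key (m - k).toNat)

/-- Coefficientwise multiplication `∑ fⱼ zʲ ↦ ∑ cⱼ fⱼ zʲ`. -/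
noncomputable def coeffMul (c : ℤ → ℂ) : LaurentSeries ℂ →ₗ[ℂ] LaurentSeries ℂ where
  toFun f :=
    { coeff := fun j => c j * f.coeff j
      isPWO_support' := f.isPWO_support.mono fun j hj h => hj (by simp only [h, mul_zero]) }
  map_add' f g := by ext j; simp [mul_add]
  map_smul' a f := by ext j; simp [mul_left_comm]

@[simp] theorem coeffMul_coeff (c : ℤ → ℂ) (f : LaurentSeries ℂ) (j : ℤ) :
    (coeffMul c f).coeff j = c j * f.coeff j := rfl

theorem coeffMul_mem {c : ℤ → ℂ} {m : ℤ} {f : LaurentSeries ℂ} (hf : f ∈ ordGE m) :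
    coeffMul c f ∈ ordGE m := fun j hj => by rw [coeffMul_coeff, hf j hj, mul_zero]

theorem orderTop_inv {a : LaurentSeries ℂ} {p : ℤ} (ha : a.orderTop = (p : WithTop ℤ)) :
    a⁻¹.orderTop = ((-p : ℤ) : WithTop ℤ) := by
  have ha0 : a ≠ 0 := HahnSeries.orderTop_ne_top.mp (ha ▸ WithTop.coe_ne_top)
  have h := HahnSeries.orderTop_mul a a⁻¹
  obtain ⟨k, hk⟩ := WithTop.ne_top_iff_exists.mp
    (HahnSeries.orderTop_ne_top.mpr (inv_ne_zero ha0))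
  rw [mul_inv_cancel₀ ha0, HahnSeries.orderTop_one, ha, ← hk, ← WithTop.coe_add,
    ← WithTop.coe_zero, WithTop.coe_inj] at h
  rw [← hk, WithTop.coe_inj]
  omega

/-- Here the pole of the exponent enters: a⁻¹ has order p > 0, while the Euler derivation does not
lower orders. Thus the derivation is a small perturbation of multiplication by a. -/
theorem raises_inv_mul_coeffMul (c : ℤ → ℂ) {a : LaurentSeries ℂ} {p : ℤ} (hp : 0 < p)
    (ha : a.orderTop = ((-p : ℤ) : WithTop ℤ)) (k : ℤ) (f : LaurentSeries ℂ) (hf : f ∈ ordGE k) :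
    (LinearMap.mulLeft ℂ a⁻¹).comp (coeffMul c) f ∈ ordGE (k + 1) := by
  refine ordGE_anti (n := - -p + k) (by omega) (mul_mem_ordGE ?_ (coeffMul_mem (c := c) hf))
  exact mem_ordGE_iff_le_orderTop.mpr (orderTop_inv ha).ge

theorem coeffMul_sub_mul_eq (c : ℤ → ℂ) {a : LaurentSeries ℂ} (ha : a ≠ 0)
    (y : LaurentSeries ℂ) : coeffMul c y - a * y =
      -(a * (y - (LinearMap.mulLeft ℂ a⁻¹).comp (coeffMul c) y)) := by
  simp only [LinearMap.comp_apply, LinearMap.mulLeft_apply, mul_sub, mul_inv_cancel_left₀ ha]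
  ring

/-- The operator is -a (1 - Q) with Q raising orders. The factor 1 - Q preserves the filtration
exactly and a shifts it by exactly p, so the pole order can be read off from colengths. -/
theorem coeffMul_sub_mul_mem_iff (c : ℤ → ℂ) {a : LaurentSeries ℂ} {p : ℤ} (hp : 0 < p)
    (ha : a.orderTop = ((-p : ℤ) : WithTop ℤ)) {y : LaurentSeries ℂ} {m : ℤ} :
    coeffMul c y - a * y ∈ ordGE (m - p) ↔ y ∈ ordGE m := by
  have ha0 : a ≠ 0 := HahnSeries.orderTop_ne_top.mp (ha ▸ WithTop.coe_ne_top)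
  rw [coeffMul_sub_mul_eq c ha0, neg_mem_iff, sub_eq_neg_add, mul_mem_ordGE_iff ha,
    sub_mem_ordGE_iff_of_raises (raises_inv_mul_coeffMul c hp ha)]

theorem coeffMul_sub_mul_surjective (c : ℤ → ℂ) {a : LaurentSeries ℂ} {p : ℤ} (hp : 0 < p)
    (ha : a.orderTop = ((-p : ℤ) : WithTop ℤ)) (b : LaurentSeries ℂ) :
    ∃ y, coeffMul c y - a * y = b := by
  have ha0 : a ≠ 0 := HahnSeries.orderTop_ne_top.mp (ha ▸ WithTop.coe_ne_top)
  obtain ⟨y, hy⟩ := exists_sub_eq_of_raises (raises_inv_mul_coeffMul c hp ha) (-(a⁻¹ * b))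
  refine ⟨y, ?_⟩
  rw [coeffMul_sub_mul_eq c ha0, hy]
  linear_combination mul_inv_cancel_left₀ ha0 b

end Filtration


/-! ### Ramification `z = t ^ s` of Laurent series -/

section Dilation

/-- Leibniz rule for a twisted derivation θ + l: the constant l is absorbed by the second factor,
and the first is differentiated by θ alone. -/
theorem coeffMul_mul {c c₀ : ℤ → ℂ} (hc : ∀ a b, c (a + b) = c₀ a + c b) (f g : LaurentSeries ℂ) :
    coeffMul c (f * g) = coeffMul c₀ f * g + f * coeffMul c g := by
  ext n
  have h1 : (coeffMul c₀ f).support ⊆ f.support := fun j hj h =>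
    hj (by rw [coeffMul_coeff, h, mul_zero])
  have h2 : (coeffMul c g).support ⊆ g.support := fun j hj h =>
    hj (by rw [coeffMul_coeff, h, mul_zero])
  rw [coeffMul_coeff, HahnSeries.coeff_add, HahnSeries.coeff_mul_left' f.isPWO_support h1,
    HahnSeries.coeff_mul_right' g.isPWO_support h2, HahnSeries.coeff_mul, Finset.mul_sum,
    ← Finset.sum_add_distrib]
  refine Finset.sum_congr rfl fun p hp => ?_
  rw [← (Finset.mem_antidiagonal.mp hp).2.2, hc, coeffMul_coeff, coeffMul_coeff]
  ring

/-- The substitution `f(z) ↦ f(t ^ s)`. -/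
noncomputable def dilate (s : ℕ+) : LaurentSeries ℂ →+* LaurentSeries ℂ :=
  have hs : (0 : ℤ) < ((s : ℕ) : ℤ) := by exact_mod_cast s.pos
  HahnSeries.embDomainRingHom
    { toFun := fun n : ℤ => ((s : ℕ) : ℤ) * n
      map_zero' := by simp
      map_add' := fun a b => mul_add _ _ _ }
    (fun _ _ h => mul_left_cancel₀ hs.ne' h)
    (fun _ _ => mul_le_mul_iff_right₀ hs)

theorem dilate_coeff (s : ℕ+) (f : LaurentSeries ℂ) (n : ℤ) :
    (dilate s f).coeff ((s : ℕ) * n) = f.coeff n := by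
  exact HahnSeries.embDomain_coeff (f := ⟨⟨fun n : ℤ => ((s : ℕ) : ℤ) * n, _⟩, _⟩)

theorem dilate_coeff_of_not_dvd (s : ℕ+) (f : LaurentSeries ℂ) {j : ℤ}
    (h : ¬ ((s : ℕ) : ℤ) ∣ j) : (dilate s f).coeff j = 0 := by
  refine HahnSeries.embDomain_of_notMem_range ?_
  rintro ⟨n, rfl⟩
  exact h ⟨n, rfl⟩

theorem dilate_mem_ordGE (s : ℕ+) {f : LaurentSeries ℂ} {m : ℤ} (hf : f ∈ ordGE m) :
    dilate s f ∈ ordGE ((s : ℕ) * m) := by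
  intro j hj
  by_cases h : ((s : ℕ) : ℤ) ∣ j
  · obtain ⟨n, rfl⟩ := h
    rw [dilate_coeff]
    exact hf n (lt_of_mul_lt_mul_left hj (by positivity))
  · exact dilate_coeff_of_not_dvd s f h

theorem mem_ordGE_zero_of_dilate (s : ℕ+) {f : LaurentSeries ℂ} (hf : dilate s f ∈ ordGE 0) :
    f ∈ ordGE 0 := fun j hj => by
  rw [← dilate_coeff s]
  exact hf _ (mul_neg_of_pos_of_neg (by exact_mod_cast s.pos) hj)

theorem dilate_injective (s : ℕ+) : Function.Injective (dilate s) := fun f g h => by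
  ext n
  rw [← dilate_coeff s, h, dilate_coeff]

theorem dilate_single (s : ℕ+) (n : ℤ) (c : ℂ) :
    dilate s (HahnSeries.single n c) = HahnSeries.single ((s : ℕ) * n) c := by
  exact HahnSeries.embDomain_single (f := ⟨⟨fun n : ℤ => ((s : ℕ) : ℤ) * n, _⟩, _⟩)

/-- The component `∑ a_{sn+k} z ^ n` of `∑ aⱼ t ^ j`, where `z = t ^ s`. -/
noncomputable def component (s : ℕ+) (k : ℕ) : LaurentSeries ℂ →ₗ[ℂ] LaurentSeries ℂ where
  toFun f := HahnSeries.ofSuppBddBelow (fun n => f.coeff ((s : ℕ) * n + k)) (by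
    obtain ⟨m, hm⟩ := exists_mem_ordGE f
    refine ⟨min (m - k) 0, fun n hn => ?_⟩
    by_contra h
    refine hn (hm _ ?_)
    have h1 : n < 0 := by omega
    have hs : (1 : ℤ) ≤ (s : ℕ) := by exact_mod_cast s.pos
    nlinarith [min_le_left (m - k) 0])
  map_add' f g := by ext; rfl
  map_smul' c f := by ext; rfl

@[simp] theorem component_coeff (s : ℕ+) (k : ℕ) (f : LaurentSeries ℂ) (n : ℤ) :
    (component s k f).coeff n = f.coeff ((s : ℕ) * n + k) := rfl

theorem eq_mul_add_of_int (s : ℕ+) (j : ℤ) :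
    ∃ k : Fin s, ∃ n : ℤ, j = (s : ℕ) * n + (k : ℕ) := by
  have hs : (0 : ℤ) < (s : ℕ) := by exact_mod_cast s.pos
  have h1 := Int.emod_nonneg j hs.ne'
  have h2 := Int.emod_lt_of_pos j hs
  refine ⟨⟨(j % (s : ℕ)).toNat, by omega⟩, j / (s : ℕ), ?_⟩
  have h3 := Int.mul_ediv_add_emod j (s : ℕ)
  simp only
  omega

theorem ext_component {s : ℕ+} {f g : LaurentSeries ℂ}
    (h : ∀ k : Fin s, component s k f = component s k g) : f = g := by
  ext j
  obtain ⟨k, n, rfl⟩ := eq_mul_add_of_int s j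
  rw [← component_coeff, h, component_coeff]

theorem exists_component_eq (s : ℕ+) (u : Fin s → LaurentSeries ℂ) :
    ∃ f, ∀ k : Fin s, component s k f = u k := by
  have hs : (0 : ℤ) < (s : ℕ) := by exact_mod_cast s.pos
  obtain ⟨m, hm⟩ := exists_forall_mem_ordGE u
  have hlt : ∀ j : ℤ, (j % (s : ℕ)).toNat < (s : ℕ) := fun j => by
    have h1 := Int.emod_nonneg j hs.ne'
    have h2 := Int.emod_lt_of_pos j hs
    omega
  refine ⟨laurentOfCoeff ((s : ℕ) * m) fun j =>
    (u ⟨(j % (s : ℕ)).toNat, hlt j⟩).coeff (j / (s : ℕ)), fun k => ?_⟩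
  ext n
  have hk : ((k : ℕ) : ℤ) < (s : ℕ) := by exact_mod_cast k.2
  rw [component_coeff, laurentOfCoeff_coeff]
  split_ifs with h
  · refine (hm k n ?_).symm
    by_contra hn
    nlinarith [not_lt.mp hn]
  · have e1 : ((s : ℕ) * n + (k : ℕ) : ℤ) / (s : ℕ) = n := by
      rw [Int.mul_add_ediv_left _ _ hs.ne', Int.ediv_eq_zero_of_lt (by omega) hk, add_zero]
    have e2 : ((s : ℕ) * n + (k : ℕ) : ℤ) % (s : ℕ) = (k : ℕ) := by
      rw [Int.mul_add_emod_self_left, Int.emod_eq_of_lt (by omega) hk]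
    simp only [e1, e2, Int.toNat_natCast]

theorem mem_ordGE_zero_iff_component {s : ℕ+} {f : LaurentSeries ℂ} :
    f ∈ ordGE 0 ↔ ∀ k : Fin s, component s k f ∈ ordGE 0 := by
  have hs : (0 : ℤ) < (s : ℕ) := by exact_mod_cast s.pos
  constructor
  · intro h k n hn
    have hk : ((k : ℕ) : ℤ) < (s : ℕ) := by exact_mod_cast k.2
    exact h _ (by nlinarith)
  · intro h j hj
    obtain ⟨k, n, rfl⟩ := eq_mul_add_of_int s j
    refine h k n ?_
    by_contra hn
    have : 0 ≤ ((s : ℕ) : ℤ) * n := mul_nonneg hs.le (not_lt.mp hn)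
    omega

/-- The exponents of g(t^s) are divisible by s, so multiplication by it does not mix residues modulo
s: taking components is ℂ((z))-linear. -/
theorem component_dilate_mul (s : ℕ+) (k : ℕ) (g f : LaurentSeries ℂ) :
    component s k (dilate s g * f) = g * component s k f := by
  have hs : (0 : ℤ) < (s : ℕ) := by exact_mod_cast s.pos
  obtain ⟨m, hm⟩ := exists_mem_ordGE f
  obtain ⟨m', hm'⟩ := exists_mem_ordGE (component s k f)
  ext n
  have hsub : (dilate s g).support ⊆ (fun j : ℤ => ((s : ℕ) : ℤ) * j) '' g.support := by
    intro j hj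
    by_cases h : ((s : ℕ) : ℤ) ∣ j
    · obtain ⟨i, rfl⟩ := h
      exact ⟨i, by rwa [HahnSeries.mem_support, dilate_coeff] at hj, rfl⟩
    · exact absurd (dilate_coeff_of_not_dvd s g h) hj
  rw [component_coeff, HahnSeries.coeff_mul, HahnSeries.coeff_mul]
  symm
  refine Finset.sum_bij_ne_zero
    (fun p _ _ => (((s : ℕ) : ℤ) * p.1, ((s : ℕ) : ℤ) * p.2 + k)) ?_ ?_ ?_ ?_
  · intro p hp hne
    obtain ⟨h1, h2, h3⟩ := Finset.mem_antidiagonal.mp hp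
    refine Finset.mem_antidiagonal.mpr ⟨?_, h2, ?_⟩
    · rw [HahnSeries.mem_support, dilate_coeff]; exact h1
    · simp only; rw [← h3]; ring
  · rintro ⟨a, b⟩ _ _ ⟨a', b'⟩ _ _ h
    simp only [Prod.mk.injEq] at h
    refine Prod.ext (mul_left_cancel₀ hs.ne' h.1) (mul_left_cancel₀ hs.ne' ?_)
    linarith [h.2]
  · rintro ⟨a, b⟩ hp hne
    obtain ⟨h1, h2, h3⟩ := Finset.mem_antidiagonal.mp hp
    obtain ⟨i, hi, rfl⟩ := hsub h1
    simp only at h3 h2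
    have hb : b = (s : ℕ) * (n - i) + k := by linarith
    refine ⟨(i, n - i), Finset.mem_antidiagonal.mpr ⟨hi, ?_, by simp⟩, ?_, ?_⟩
    · rw [HahnSeries.mem_support, component_coeff, ← hb]; exact h2
    · rw [component_coeff, ← hb, ← dilate_coeff s]; exact hne
    · rw [hb]
  · intro p _ _
    rw [component_coeff, dilate_coeff]

theorem component_zero_dilate (s : ℕ+) (f : LaurentSeries ℂ) : component s 0 (dilate s f) = f := by
  ext n
  rw [component_coeff, Nat.cast_zero, add_zero, dilate_coeff]

/-- The eigenvalues of `z d/dz + l` on the powers of `t`, where `z = t ^ s`. -/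
noncomputable def thetaCoeff (s : ℕ+) (l : ℂ) (j : ℤ) : ℂ := (j : ℂ) / (s : ℕ) + l

/-- Since t^(sn+k) = z^(n+k/s), on the component k the derivation z d/dz acquires the constant k/s.
-/
theorem component_coeffMul (s : ℕ+) (l : ℂ) (k : ℕ) (f : LaurentSeries ℂ) :
    component s k (coeffMul (thetaCoeff s l) f) =
      coeffMul (thetaCoeff 1 (k / (s : ℕ) + l)) (component s k f) := by
  have hs : ((s : ℕ) : ℂ) ≠ 0 := by exact_mod_cast s.ne_zero
  ext n
  simp only [component_coeff, coeffMul_coeff, thetaCoeff]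
  congr 1
  push_cast
  field_simp
  ring

theorem dilate_coeffMul (s : ℕ+) (l : ℂ) (f : LaurentSeries ℂ) :
    dilate s (coeffMul (thetaCoeff 1 l) f) = coeffMul (thetaCoeff s l) (dilate s f) := by
  have hs : ((s : ℕ) : ℂ) ≠ 0 := by exact_mod_cast s.ne_zero
  ext j
  rw [coeffMul_coeff]
  by_cases h : ((s : ℕ) : ℤ) ∣ j
  · obtain ⟨n, rfl⟩ := h
    rw [dilate_coeff, dilate_coeff, coeffMul_coeff]
    congr 1
    simp only [thetaCoeff]
    push_cast
    field_simp
  · rw [dilate_coeff_of_not_dvd s _ h, dilate_coeff_of_not_dvd s _ h, mul_zero]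

end Dilation


/-! ### Formal differential systems -/

section Formal

variable {ι : Type*}

/-- The vectors of Laurent series whose `i`-th entry has order at least `m i`. -/
noncomputable def ordGEPi (m : ι → ℤ) : Submodule ℂ (ι → LaurentSeries ℂ) :=
  Submodule.pi Set.univ fun i => ordGE (m i)

theorem mem_ordGEPi {m : ι → ℤ} {v : ι → LaurentSeries ℂ} :
    v ∈ ordGEPi m ↔ ∀ i, v i ∈ ordGE (m i) := by simp [ordGEPi, Submodule.mem_pi]

/-- Multiplication by `z ^ e`. -/
noncomputable def shift (e : ℤ) : (ι → LaurentSeries ℂ) →ₗ[ℂ] (ι → LaurentSeries ℂ) :=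
  LinearMap.pi fun i => (LinearMap.mulLeft ℂ (HahnSeries.single e 1)).comp (LinearMap.proj i)

@[simp] theorem shift_apply (e : ℤ) (v : ι → LaurentSeries ℂ) (i : ι) :
    shift e v i = HahnSeries.single e 1 * v i := rfl

theorem shift_shift (e e' : ℤ) (v : ι → LaurentSeries ℂ) :
    shift e (shift e' v) = shift (e + e') v := by
  funext i
  rw [shift_apply, shift_apply, shift_apply, ← mul_assoc, HahnSeries.single_mul_single, one_mul]

theorem shift_zero (v : ι → LaurentSeries ℂ) : shift 0 v = v := by
  funext i
  rw [shift_apply, HahnSeries.single_zero_one, one_mul]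

theorem shift_bijective (e : ℤ) :
    Function.Bijective (shift e : (ι → LaurentSeries ℂ) →ₗ[ℂ] (ι → LaurentSeries ℂ)) := by
  refine Function.bijective_iff_has_inverse.mpr ⟨shift (-e), fun v => ?_, fun v => ?_⟩
  · rw [shift_shift, neg_add_cancel, shift_zero]
  · rw [shift_shift, add_neg_cancel, shift_zero]

theorem shift_mem_ordGEPi {e : ℤ} {m : ι → ℤ} {v : ι → LaurentSeries ℂ} :
    shift e v ∈ ordGEPi (fun i => e + m i) ↔ v ∈ ordGEPi m := by
  simp only [mem_ordGEPi, shift_apply]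
  exact forall_congr' fun i => mul_mem_ordGE_iff (HahnSeries.orderTop_single one_ne_zero)

variable [Fintype ι]

theorem relLength_ordGEPi (m : ι → ℤ) (d : ι → ℕ) :
    relLength (ordGEPi m) (ordGEPi fun i => m i + d i) = ((∑ i, d i : ℕ) : ℕ∞) := by
  rw [ordGEPi, ordGEPi, relLength_pi]
  simp only [relLength_ordGE]
  push_cast
  rfl

/-- The operator `v ↦ c · v - H v`, where `c` acts coefficientwise. -/
noncomputable def systemOp (c : ℤ → ℂ) (H : Matrix ι ι (LaurentSeries ℂ)) :
    (ι → LaurentSeries ℂ) →ₗ[ℂ] (ι → LaurentSeries ℂ) :=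
  LinearMap.pi fun i => (coeffMul c).comp (LinearMap.proj i) -
    ∑ j, (LinearMap.mulLeft ℂ (H i j)).comp (LinearMap.proj j)

theorem systemOp_apply (c : ℤ → ℂ) (H : Matrix ι ι (LaurentSeries ℂ)) (v : ι → LaurentSeries ℂ)
    (i : ι) : systemOp c H v i = coeffMul c (v i) - H.mulVec v i := by
  simp [systemOp, Matrix.mulVec, dotProduct]

theorem mulVec_mem_ordGEPi {A : Matrix ι ι (LaurentSeries ℂ)} {a m : ℤ}
    (hA : ∀ i j, A i j ∈ ordGE a) {v : ι → LaurentSeries ℂ} (hv : v ∈ ordGEPi fun _ => m) :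
    A.mulVec v ∈ ordGEPi fun _ => a + m :=
  mem_ordGEPi.mpr fun i => Submodule.sum_mem _ fun j _ =>
    mul_mem_ordGE (hA i j) (mem_ordGEPi.mp hv j)

theorem shift_systemOp_mem (c : ℤ → ℂ) {H : Matrix ι ι (LaurentSeries ℂ)} {e : ℕ}
    (hH : ∀ i j, H i j ∈ ordGE (-e)) :
    (ordGEPi fun _ => 0).map ((shift e).comp (systemOp c H)) ≤ ordGEPi fun _ => 0 := by
  rintro _ ⟨v, hv, rfl⟩
  have h := shift_mem_ordGEPi (e := e) (m := fun _ : ι => -(e : ℤ)) (v := systemOp c H v)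
  simp only [add_neg_cancel] at h
  rw [LinearMap.comp_apply, h, mem_ordGEPi]
  intro i
  rw [systemOp_apply]
  refine sub_mem (ordGE_anti (by omega) (coeffMul_mem (mem_ordGEPi.mp hv i))) ?_
  have := mem_ordGEPi.mp (mulVec_mem_ordGEPi hH hv) i
  rwa [add_zero] at this

theorem dilate_systemOp (s : ℕ+) (l : ℂ) (H : Matrix ι ι (LaurentSeries ℂ))
    (v : ι → LaurentSeries ℂ) :
    (fun i => dilate s (systemOp (thetaCoeff 1 l) H v i)) =
      systemOp (thetaCoeff s l) (H.map (dilate s)) (fun i => dilate s (v i)) := by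
  funext i
  simp only [systemOp_apply, map_sub, dilate_coeffMul, Matrix.mulVec, dotProduct, map_sum, map_mul,
    Matrix.map_apply]

/-- A system pulled back from z to t is the direct sum of its s twists by the constants k/s. -/
theorem component_systemOp (s : ℕ+) (l : ℂ) (k : ℕ) (H : Matrix ι ι (LaurentSeries ℂ))
    (y : ι → LaurentSeries ℂ) :
    (fun i => component s k (systemOp (thetaCoeff s l) (H.map (dilate s)) y i)) =
      systemOp (thetaCoeff 1 (k / (s : ℕ) + l)) H (fun i => component s k (y i)) := by
  funext i
  simp only [systemOp_apply, map_sub, component_coeffMul, Matrix.mulVec, dotProduct, map_sum,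
    Matrix.map_apply, component_dilate_mul]

/-- The diagonalization over `ℂ((t))`, `z = t ^ s`, of the system with matrix `H`:
`diag(a) X = X H + (z d/dz) X`, where `aᵢ` has `t`-order `-pᵢ < 0`. -/
structure IsDiagonalization [DecidableEq ι] (s : ℕ+) (H X Y : Matrix ι ι (LaurentSeries ℂ))
    (a : ι → LaurentSeries ℂ) (p : ι → ℕ) : Prop where
  mul_eq_one : X * Y = 1
  eq : Matrix.diagonal a * X = X * H.map (dilate s) + X.map (coeffMul (thetaCoeff s 0))
  pos : ∀ i, 0 < p i
  order : ∀ i, (a i).orderTop = ((-(p i : ℤ) : ℤ) : WithTop ℤ)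

variable [DecidableEq ι] {s : ℕ+} {H X Y : Matrix ι ι (LaurentSeries ℂ)}
  {a : ι → LaurentSeries ℂ} {p : ι → ℕ}

namespace IsDiagonalization

theorem mul_eq_one' (h : IsDiagonalization s H X Y a p) : Y * X = 1 :=
  mul_eq_one_comm.mp h.mul_eq_one

/-- The gauge transformation X is compatible with every twist l, because in the Leibniz rule l falls
on y only. -/
theorem mulVec_systemOp (h : IsDiagonalization s H X Y a p) (l : ℂ) (y : ι → LaurentSeries ℂ) :
    X.mulVec (systemOp (thetaCoeff s l) (H.map (dilate s)) y) =
      systemOp (thetaCoeff s l) (Matrix.diagonal a) (X.mulVec y) := by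
  have hc : ∀ i j : ℤ, thetaCoeff s l (i + j) = thetaCoeff s 0 i + thetaCoeff s l j := by
    intro i j
    simp only [thetaCoeff]
    push_cast
    ring
  have h1 : systemOp (thetaCoeff s l) (H.map (dilate s)) y =
      (fun i => coeffMul (thetaCoeff s l) (y i)) - (H.map (dilate s)).mulVec y := by
    funext i
    rw [systemOp_apply]; rfl
  have h2 : systemOp (thetaCoeff s l) (Matrix.diagonal a) (X.mulVec y) =
      (fun i => coeffMul (thetaCoeff s l) (X.mulVec y i)) -
        (Matrix.diagonal a).mulVec (X.mulVec y) := by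
    funext i
    rw [systemOp_apply]; rfl
  have h3 : (fun i => coeffMul (thetaCoeff s l) (X.mulVec y i)) =
      (X.map (coeffMul (thetaCoeff s 0))).mulVec y +
        X.mulVec (fun i => coeffMul (thetaCoeff s l) (y i)) := by
    funext i
    simp only [Matrix.mulVec, dotProduct, map_sum, coeffMul_mul hc, Finset.sum_add_distrib,
      Pi.add_apply, Matrix.map_apply]
  rw [h1, h2, h3, Matrix.mulVec_sub, Matrix.mulVec_mulVec, Matrix.mulVec_mulVec, h.eq,
    Matrix.add_mulVec]
  abel

theorem diagonal_mem_iff (h : IsDiagonalization s H X Y a p) (c : ℤ → ℂ)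
    {y : ι → LaurentSeries ℂ} {m : ℤ} :
    systemOp c (Matrix.diagonal a) y ∈ ordGEPi (fun i => m - p i) ↔ y ∈ ordGEPi fun _ => m := by
  simp only [mem_ordGEPi, systemOp_apply, Matrix.mulVec_diagonal]
  exact forall_congr' fun i =>
    coeffMul_sub_mul_mem_iff c (by exact_mod_cast h.pos i) (h.order i)

theorem diagonal_surjective (h : IsDiagonalization s H X Y a p) (c : ℤ → ℂ) :
    Function.Surjective (systemOp c (Matrix.diagonal a)) := fun b => by
  choose y hy using fun i =>
    coeffMul_sub_mul_surjective c (by exact_mod_cast h.pos i) (h.order i) (b i)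
  exact ⟨y, funext fun i => by rw [systemOp_apply, Matrix.mulVec_diagonal, hy]⟩

theorem diagonal_injective (h : IsDiagonalization s H X Y a p) (c : ℤ → ℂ) :
    Function.Injective (systemOp c (Matrix.diagonal a)) := by
  rw [injective_iff_map_eq_zero]
  intro y hy
  funext i
  refine eq_zero_of_forall_mem_ordGE 0 fun n => ?_
  have := (h.diagonal_mem_iff c (m := 0 + n) (y := y)).mp (by rw [hy]; exact zero_mem _)
  exact mem_ordGEPi.mp this i

theorem mulVec_bijective (h : IsDiagonalization s H X Y a p) : Function.Bijective X.mulVec := by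
  refine Function.bijective_iff_has_inverse.mpr ⟨Y.mulVec, fun v => ?_, fun v => ?_⟩
  · rw [Matrix.mulVec_mulVec, h.mul_eq_one', Matrix.one_mulVec]
  · rw [Matrix.mulVec_mulVec, h.mul_eq_one, Matrix.one_mulVec]

theorem ramified_bijective (h : IsDiagonalization s H X Y a p) (l : ℂ) :
    Function.Bijective (systemOp (thetaCoeff s l) (H.map (dilate s))) := by
  have hcomp : X.mulVec ∘ systemOp (thetaCoeff s l) (H.map (dilate s)) =
      systemOp (thetaCoeff s l) (Matrix.diagonal a) ∘ X.mulVec := funext (h.mulVec_systemOp l)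
  have hb : Function.Bijective (X.mulVec ∘ systemOp (thetaCoeff s l) (H.map (dilate s))) := by
    rw [hcomp]
    exact Function.Bijective.comp ⟨h.diagonal_injective _, h.diagonal_surjective _⟩
      h.mulVec_bijective
  exact (Function.Bijective.of_comp_iff' h.mulVec_bijective _).mp hb

end IsDiagonalization

/-- Descent from t to z: injectivity passes through the embedding `dilate`. A solution in t of an
equation with right-hand side in z has a component 0 that solves it in z. -/
theorem IsDiagonalization.bijective (h : IsDiagonalization s H X Y a p) (l : ℂ) :
    Function.Bijective (systemOp (thetaCoeff 1 l) H) := by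
  constructor
  · intro v w hvw
    have h1 := congrArg (fun u i => dilate s (u i)) hvw
    simp only [dilate_systemOp] at h1
    have h2 := (h.ramified_bijective l).1 h1
    exact funext fun i => dilate_injective s (congrFun h2 i)
  · intro b
    obtain ⟨y, hy⟩ := (h.ramified_bijective l).2 (fun i => dilate s (b i))
    refine ⟨fun i => component s 0 (y i), ?_⟩
    have h1 := component_systemOp s l 0 H y
    rw [hy] at h1
    simpa [component_zero_dilate] using h1.symm

end Formal


/-! ### The formal index -/

section FormalIndex

variable {ι : Type*}

/-- `v ↦ v(t ^ s)` as a `ℂ`-linear map. -/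
noncomputable def dilateC (s : ℕ+) : (ι → LaurentSeries ℂ) →ₗ[ℂ] (ι → LaurentSeries ℂ) where
  toFun v := fun i => dilate s (v i)
  map_add' v w := by funext i; simp
  map_smul' c v := by
    funext i
    have : dilate s (HahnSeries.C c) = HahnSeries.C c := by
      rw [HahnSeries.C_apply, dilate_single, mul_zero]
    simp only [Pi.smul_apply, ← HahnSeries.C_mul_eq_smul, map_mul, this, RingHom.id_apply]

theorem dilateC_apply (s : ℕ+) (v : ι → LaurentSeries ℂ) (i : ι) :
    dilateC s v i = dilate s (v i) := rfl

theorem dilateC_shift (s : ℕ+) (e : ℤ) (v : ι → LaurentSeries ℂ) :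
    dilateC s (shift e v) = shift ((s : ℕ) * e) (dilateC s v) := by
  funext i
  simp only [dilateC_apply, shift_apply, map_mul, dilate_single]

variable [Fintype ι]

/-- `v ↦ X v` as a `ℂ`-linear map. -/
noncomputable def mulVecC (X : Matrix ι ι (LaurentSeries ℂ)) :
    (ι → LaurentSeries ℂ) →ₗ[ℂ] (ι → LaurentSeries ℂ) where
  toFun := X.mulVec
  map_add' := X.mulVec_add
  map_smul' c v := by
    funext i
    simp only [Matrix.mulVec, dotProduct, Pi.smul_apply, RingHom.id_apply, Finset.smul_sum,
      ← HahnSeries.C_mul_eq_smul, mul_left_comm]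

@[simp] theorem mulVecC_apply (X : Matrix ι ι (LaurentSeries ℂ)) (v : ι → LaurentSeries ℂ) :
    mulVecC X v = X.mulVec v := rfl

theorem mulVec_shift (X : Matrix ι ι (LaurentSeries ℂ)) (e : ℤ) (v : ι → LaurentSeries ℂ) :
    X.mulVec (shift e v) = shift e (X.mulVec v) := by
  have h : ∀ w : ι → LaurentSeries ℂ,
    shift e w = (HahnSeries.single e 1 : LaurentSeries ℂ) • w := fun w => rfl
  rw [h, h, Matrix.mulVec_smul]

theorem relLength_ordGEPi_ne_top {B : Submodule ℂ (ι → LaurentSeries ℂ)} {m : ℤ} (n : ℕ)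
    (h : (ordGEPi fun _ => m + n) ≤ B) (hB : B ≤ ordGEPi fun _ => m) :
    relLength (ordGEPi fun _ => m) B ≠ ⊤ := by
  refine ne_top_of_le_ne_top ?_ (relLength_mono_right h hB)
  rw [relLength_ordGEPi (fun _ : ι => m) (fun _ => n)]
  exact ENat.natCast_ne_top _

/-- The operator `z ^ e (z d/dz + l - H)` in the ramified variable `t`, `z = t ^ s`. -/
noncomputable def latticeOp (s : ℕ+) (e : ℤ) (l : ℂ) (H : Matrix ι ι (LaurentSeries ℂ)) :
    (ι → LaurentSeries ℂ) →ₗ[ℂ] (ι → LaurentSeries ℂ) :=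
  (shift e).comp (systemOp (thetaCoeff s l) H)

/-- The lattice of power series in t splits as the sum of t^k times the lattice in z, k < s, and the
operator acts on the summand k as its twist by k/s. The shift is by s e because z^e = t^(se). -/
theorem relLength_latticeOp_ramified (s : ℕ+) (e : ℤ) (l : ℂ) (H : Matrix ι ι (LaurentSeries ℂ)) :
    relLength (ordGEPi fun _ => 0)
      ((ordGEPi fun _ => 0).map (latticeOp s ((s : ℕ) * e) l (H.map (dilate s)))) =
    ∑ k : Fin s, relLength (ordGEPi fun _ => 0)
      ((ordGEPi fun _ => 0).map (latticeOp 1 e ((k : ℕ) / (s : ℕ) + l) H)) := by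
  let F : (ι → LaurentSeries ℂ) →ₗ[ℂ] (Fin s → ι → LaurentSeries ℂ) :=
    LinearMap.pi fun k => LinearMap.pi fun i => (component s k).comp (LinearMap.proj i)
  have hF : ∀ y k i, F y k i = component s k (y i) := fun _ _ _ => rfl
  have hinj : Function.Injective F := fun y y' h => funext fun i => ext_component fun k =>
    congrFun (congrFun h k) i
  have hsurj : Function.Surjective F := fun u => by
    choose y hy using fun i => exists_component_eq s fun k => u k i
    exact ⟨y, funext fun k => funext fun i => hy i k⟩
  have hT : ∀ y k, F (latticeOp s ((s : ℕ) * e) l (H.map (dilate s)) y) k =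
      latticeOp 1 e ((k : ℕ) / (s : ℕ) + l) H (F y k) := by
    intro y k
    have h1 := component_systemOp s l k H y
    funext i
    rw [hF, latticeOp, latticeOp, LinearMap.comp_apply, LinearMap.comp_apply, shift_apply,
      shift_apply, ← dilate_single, component_dilate_mul]
    exact congrArg _ (congrFun h1 i)
  have hmem : ∀ y, F y ∈ Submodule.pi Set.univ
      (fun _ : Fin s => (ordGEPi fun _ : ι => 0)) ↔ y ∈ ordGEPi fun _ : ι => 0 := by
    intro y
    simp only [Submodule.mem_pi, Set.mem_univ, true_imp_iff, mem_ordGEPi, hF]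
    rw [forall_comm]
    exact forall_congr' fun i => mem_ordGE_zero_iff_component.symm
  rw [← relLength_pi, ← relLength_map hinj, map_eq_of_forall_mem_iff hsurj hmem]
  congr 1
  ext w
  simp only [Submodule.mem_map, Submodule.mem_pi, Set.mem_univ, true_imp_iff]
  constructor
  · rintro ⟨_, ⟨y, hy, rfl⟩, rfl⟩ k
    exact ⟨F y k, by simpa [Submodule.mem_pi] using (Submodule.mem_pi.mp ((hmem y).mpr hy)) k,
      (hT y k).symm⟩
  · intro h
    choose u hu hu' using h
    obtain ⟨y, rfl⟩ := hsurj u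
    exact ⟨_, ⟨y, (hmem y).mp fun k _ => hu k, rfl⟩, funext fun k => by rw [hT, hu']⟩

variable [DecidableEq ι] {s : ℕ+} {H X Y : Matrix ι ι (LaurentSeries ℂ)}
  {a : ι → LaurentSeries ℂ} {p : ι → ℕ}

namespace IsDiagonalization

theorem latticeOp_bijective (h : IsDiagonalization s H X Y a p) (e : ℤ) (l : ℂ) :
    Function.Bijective (latticeOp 1 e l H) :=
  (shift_bijective e).comp (h.bijective l)

theorem latticeOp_ramified_bijective (h : IsDiagonalization s H X Y a p) (e : ℤ) (l : ℂ) :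
    Function.Bijective (latticeOp s e l (H.map (dilate s))) :=
  (shift_bijective e).comp (h.ramified_bijective l)

theorem mulVec_latticeOp_mem (h : IsDiagonalization s H X Y a p) (e : ℤ) (l : ℂ)
    {y : ι → LaurentSeries ℂ} {m : ℤ} :
    X.mulVec (latticeOp s e l (H.map (dilate s)) y) ∈ ordGEPi (fun i => e + (m - p i)) ↔
      X.mulVec y ∈ ordGEPi fun _ => m := by
  rw [latticeOp, LinearMap.comp_apply, mulVec_shift, shift_mem_ordGEPi, h.mulVec_systemOp,
    h.diagonal_mem_iff]

/-- Some `m` with `{y | X y ∈ ordGE m}` contained in the standard lattice. -/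
theorem exists_mulVec_le (h : IsDiagonalization s H X Y a p) :
    ∃ m : ℤ, ∃ n : ℕ, (∀ y, X.mulVec y ∈ (ordGEPi fun _ => m) → y ∈ ordGEPi fun _ => 0) ∧
      ∀ y ∈ (ordGEPi fun _ => (n : ℤ)), X.mulVec y ∈ ordGEPi fun _ => m := by
  obtain ⟨mX, hX⟩ := exists_forall_mem_ordGE fun q : ι × ι => X q.1 q.2
  obtain ⟨mY, hY⟩ := exists_forall_mem_ordGE fun q : ι × ι => Y q.1 q.2
  -- As y = Y (X y) and the entries of Y have order at least mY, order -mY for X y suffices. The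
  -- number n compensates in the same way for the entries of X.
  refine ⟨-mY, (-mY - mX).toNat, fun y hy => ?_, fun y hy => ?_⟩
  · have := mulVec_mem_ordGEPi (A := Y) (fun i j => hY (i, j)) hy
    rw [Matrix.mulVec_mulVec, h.mul_eq_one', Matrix.one_mulVec] at this
    simpa using this
  · rw [mem_ordGEPi]
    exact fun i => ordGE_anti (by omega)
      (mem_ordGEPi.mp (mulVec_mem_ordGEPi (A := X) (fun i j => hX (i, j)) hy) i)

/-- The standard lattice may be replaced by the commensurable one {y | X y ∈ t^m ℂ[[t]]^n}. There
the operator is diagonal in the coordinates X y and raises the order of the i-th one by exactly s e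
- p i; the assumption on p makes this nonnegative, so the lattice is stable. -/
theorem relLength_ramified (h : IsDiagonalization s H X Y a p) {e : ℕ}
    (hH : ∀ i j, H i j ∈ ordGE (-e)) (hp : ∀ i, p i ≤ s * e) (l : ℂ) :
    relLength (ordGEPi fun _ => 0)
      ((ordGEPi fun _ => 0).map (latticeOp s ((s : ℕ) * (e : ℤ)) l (H.map (dilate s)))) =
    ((∑ i, (s * e - p i) : ℕ) : ℕ∞) := by
  set T := latticeOp s ((s : ℕ) * (e : ℤ)) l (H.map (dilate s)) with hTdef
  have hT := h.latticeOp_ramified_bijective ((s : ℕ) * (e : ℤ)) l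
  have hX : Function.Bijective (mulVecC X) := h.mulVec_bijective
  obtain ⟨m, n, h1, h2⟩ := h.exists_mulVec_le
  have hmap : ((ordGEPi fun _ => m).comap (mulVecC X)).map T =
      (ordGEPi fun i => m + ((s * e - p i : ℕ) : ℤ)).comap (mulVecC X) := by
    refine map_eq_of_forall_mem_iff hT.2 fun v => ?_
    rw [Submodule.mem_comap, Submodule.mem_comap, mulVecC_apply, mulVecC_apply,
      ← h.mulVec_latticeOp_mem ((s : ℕ) * (e : ℤ)) l]
    have : (fun i => m + ((s * e - p i : ℕ) : ℤ)) =
        fun i => ((s : ℕ) : ℤ) * (e : ℤ) + (m - p i) := by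
      funext i
      rw [Nat.cast_sub (hp i)]
      push_cast
      ring
    rw [this]
  have hle : (ordGEPi fun _ => m).comap (mulVecC X) ≤ ordGEPi fun _ => 0 := h1
  have hmm : ((ordGEPi fun _ => m).comap (mulVecC X)).map T ≤
      (ordGEPi fun _ => m).comap (mulVecC X) := by
    rw [hmap]
    refine Submodule.comap_mono fun v hv => ?_
    rw [mem_ordGEPi] at hv ⊢
    exact fun i => ordGE_anti (by omega) (hv i)
  have hA : (ordGEPi fun _ => 0).map T ≤ ordGEPi fun _ => 0 := by
    have := shift_systemOp_mem (e := s * e) (thetaCoeff s l) (H := H.map (dilate s))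
      (fun i j => by
        have := dilate_mem_ordGE s (hH i j)
        rw [mul_neg] at this
        push_cast
        exact this)
    push_cast at this
    exact this
  rw [relLength_map_eq_of_le hT.1 hA hmm hle, hmap, relLength_comap hX, relLength_ordGEPi]
  refine relLength_ordGEPi_ne_top (m := 0) n ?_ hle
  intro y hy
  rw [zero_add] at hy
  exact h2 y hy

/-- On the commensurable lattice {v | X v(t^s) ∈ t^m ℂ[[t]]^n} the image of the operator is cut out
by order conditions alone, in which l does not occur. -/
theorem relLength_twist (h : IsDiagonalization s H X Y a p) {e : ℕ}
    (hH : ∀ i j, H i j ∈ ordGE (-e)) (hp : ∀ i, p i ≤ s * e) (l l' : ℂ) :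
    relLength (ordGEPi fun _ => 0) ((ordGEPi fun _ => 0).map (latticeOp 1 e l H)) =
      relLength (ordGEPi fun _ => 0) ((ordGEPi fun _ => 0).map (latticeOp 1 e l' H)) := by
  obtain ⟨m, n, h1, h2⟩ := h.exists_mulVec_le
  have hmap : ∀ l, ((ordGEPi fun _ => m).comap ((mulVecC X).comp (dilateC s))).map
      (latticeOp 1 e l H) = (ordGEPi fun i => (s : ℕ) * (e : ℤ) + (m - p i)).comap
        ((mulVecC X).comp (dilateC s)) := by
    intro l
    refine map_eq_of_forall_mem_iff (h.latticeOp_bijective e l).2 fun v => ?_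
    rw [Submodule.mem_comap, Submodule.mem_comap, LinearMap.comp_apply, LinearMap.comp_apply,
      mulVecC_apply, mulVecC_apply, ← h.mulVec_latticeOp_mem ((s : ℕ) * (e : ℤ)) l]
    have h3 : dilateC s (latticeOp 1 e l H v) =
        latticeOp s ((s : ℕ) * (e : ℤ)) l (H.map (dilate s)) (dilateC s v) := by
      rw [latticeOp, LinearMap.comp_apply, dilateC_shift]
      exact congrArg _ (dilate_systemOp s l H v)
    rw [h3]
  have hle : (ordGEPi fun _ => m).comap ((mulVecC X).comp (dilateC s)) ≤ ordGEPi fun _ => 0 := by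
    intro v hv
    rw [mem_ordGEPi]
    exact fun i => mem_ordGE_zero_of_dilate s (mem_ordGEPi.mp (h1 _ hv) i)
  have hmm : ∀ l, ((ordGEPi fun _ => m).comap ((mulVecC X).comp (dilateC s))).map
      (latticeOp 1 e l H) ≤ (ordGEPi fun _ => m).comap ((mulVecC X).comp (dilateC s)) := by
    intro l
    rw [hmap]
    refine Submodule.comap_mono fun v hv => ?_
    rw [mem_ordGEPi] at hv ⊢
    exact fun i => ordGE_anti (by have := hp i; zify at this; omega) (hv i)
  have hfin : relLength (ordGEPi fun _ => 0)
      ((ordGEPi fun _ => m).comap ((mulVecC X).comp (dilateC s))) ≠ ⊤ := by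
    refine relLength_ordGEPi_ne_top (m := 0) n ?_ hle
    intro v hv
    rw [zero_add, mem_ordGEPi] at hv
    refine h2 _ (mem_ordGEPi.mpr fun i => ordGE_anti ?_ (dilate_mem_ordGE s (hv i)))
    have hs : (1 : ℤ) ≤ (s : ℕ) := by exact_mod_cast s.pos
    nlinarith
  have key : ∀ l, relLength (ordGEPi fun _ => 0)
      ((ordGEPi fun _ => 0).map (latticeOp 1 e l H)) = _ := fun l =>
    relLength_map_eq_of_le (h.latticeOp_bijective e l).1
      (shift_systemOp_mem (thetaCoeff 1 l) hH) (hmm l) hle hfin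
  rw [key, key, hmap, hmap]

/-- The diagonalization exists only over ℂ((t)), so the colength over z is found by averaging: the
ramified colength is a sum over s twists, all of which contribute equally. -/
theorem mul_relLength_latticeOp (h : IsDiagonalization s H X Y a p) {e : ℕ}
    (hH : ∀ i j, H i j ∈ ordGE (-e)) (hp : ∀ i, p i ≤ s * e) :
    ((s : ℕ) : ℕ∞) * relLength (ordGEPi fun _ => 0)
      ((ordGEPi fun _ => 0).map (latticeOp 1 e 0 H)) = ((∑ i, (s * e - p i) : ℕ) : ℕ∞) := by
  rw [← h.relLength_ramified hH hp 0, relLength_latticeOp_ramified,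
    Finset.sum_congr rfl fun k _ => h.relLength_twist hH hp _ 0]
  simp

end IsDiagonalization

end FormalIndex


/-! ### The convergent index -/

section ConvergentIndex

open scoped ENNReal

variable {ι : Type*}

/-- The vectors of power series with `‖aₖ‖ ρ ^ k` bounded. -/
def boundedPS (ι : Type*) (ρ : ℝ) : Submodule ℂ (ι → PowerSeries ℂ) where
  -- With |ρ| the weights are nonnegative without any hypothesis on ρ.
  carrier := {u | ∃ C : ℝ, ∀ i k, ‖PowerSeries.coeff k (u i)‖ * |ρ| ^ k ≤ C}
  add_mem' := by
    rintro u v ⟨C, hC⟩ ⟨C', hC'⟩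
    refine ⟨C + C', fun i k => ?_⟩
    rw [Pi.add_apply, map_add]
    calc _ ≤ (‖PowerSeries.coeff k (u i)‖ + ‖PowerSeries.coeff k (v i)‖) * |ρ| ^ k := by
          gcongr; exact norm_add_le _ _
      _ ≤ _ := by rw [add_mul]; exact add_le_add (hC i k) (hC' i k)
  zero_mem' := ⟨0, by simp⟩
  smul_mem' := by
    rintro c u ⟨C, hC⟩
    refine ⟨‖c‖ * C, fun i k => ?_⟩
    rw [Pi.smul_apply, map_smul, norm_smul, mul_assoc]
    exact mul_le_mul_of_nonneg_left (hC i k) (norm_nonneg _)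

theorem mem_boundedPS {ρ : ℝ} (hρ : 0 < ρ) {u : ι → PowerSeries ℂ} : u ∈ boundedPS ι ρ ↔
    ∃ C : ℝ, ∀ i k, ‖PowerSeries.coeff k (u i)‖ * ρ ^ k ≤ C := by
  change (∃ C : ℝ, ∀ i k, ‖PowerSeries.coeff k (u i)‖ * |ρ| ^ k ≤ C) ↔ _
  rw [abs_of_pos hρ]

theorem boundedPS_anti {ρ ρ' : ℝ} (h : 0 < ρ) (h' : ρ ≤ ρ') : boundedPS ι ρ' ≤ boundedPS ι ρ := by
  intro u hu
  rw [mem_boundedPS h]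
  obtain ⟨C, hC⟩ := (mem_boundedPS (h.trans_le h')).mp hu
  exact ⟨C, fun i k => (mul_le_mul_of_nonneg_left (pow_le_pow_left₀ h.le h' _)
    (norm_nonneg _)).trans (hC i k)⟩

/-- The vectors of power series of order at least `K`. -/
def orderPS (ι : Type*) (K : ℕ) : Submodule ℂ (ι → PowerSeries ℂ) where
  carrier := {u | ∀ i, ∀ k < K, PowerSeries.coeff k (u i) = 0}
  add_mem' := fun hu hv i k hk => by rw [Pi.add_apply, map_add, hu i k hk, hv i k hk, add_zero]
  zero_mem' := fun i k _ => by simp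
  smul_mem' := fun c u hu i k hk => by
    rw [Pi.smul_apply, map_smul, hu i k hk, smul_zero]

/-- The vectors of polynomials of degree less than `K`. -/
def polyPS (ι : Type*) (K : ℕ) : Submodule ℂ (ι → PowerSeries ℂ) where
  carrier := {u | ∀ i, ∀ k, K ≤ k → PowerSeries.coeff k (u i) = 0}
  add_mem' := fun hu hv i k hk => by rw [Pi.add_apply, map_add, hu i k hk, hv i k hk, add_zero]
  zero_mem' := fun i k _ => by simp
  smul_mem' := fun c u hu i k hk => by
    rw [Pi.smul_apply, map_smul, hu i k hk, smul_zero]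

/-- The Euler derivation `z d/dz`. -/
noncomputable def eulerPS : PowerSeries ℂ →ₗ[ℂ] PowerSeries ℂ where
  toFun f := PowerSeries.mk fun k => (k : ℂ) * PowerSeries.coeff k f
  map_add' f g := by ext; simp [mul_add]
  map_smul' c f := by ext; simp [mul_left_comm]

@[simp] theorem coeff_eulerPS (f : PowerSeries ℂ) (k : ℕ) :
    PowerSeries.coeff k (eulerPS f) = k * PowerSeries.coeff k f := by simp [eulerPS]

/-- The operator `u ↦ z ^ e (z u')`. -/
noncomputable def topPS (e : ℕ) : (ι → PowerSeries ℂ) →ₗ[ℂ] (ι → PowerSeries ℂ) :=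
  LinearMap.pi fun i =>
    (LinearMap.mulLeft ℂ (PowerSeries.X ^ e)).comp (eulerPS.comp (LinearMap.proj i))

theorem coeff_topPS (e : ℕ) (u : ι → PowerSeries ℂ) (i : ι) (m : ℕ) :
    PowerSeries.coeff m (topPS e u i) =
      if e ≤ m then ((m - e : ℕ) : ℂ) * PowerSeries.coeff (m - e) (u i) else 0 := by
  simp [topPS, PowerSeries.coeff_X_pow_mul']

/-- The right inverse `z ^ (k + e) ↦ z ^ k / k` of `z ^ e (z d/dz)`, cut off below degree `K`. -/
noncomputable def invTopPS (e K : ℕ) : (ι → PowerSeries ℂ) →ₗ[ℂ] (ι → PowerSeries ℂ) where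
  toFun u i := PowerSeries.mk fun b =>
    if K ≤ b then PowerSeries.coeff (b + e) (u i) / (b : ℂ) else 0
  map_add' u v := by
    funext i; ext b
    simp only [Pi.add_apply, map_add, PowerSeries.coeff_mk]
    split_ifs
    · rw [add_div]
    · rw [add_zero]
  map_smul' c u := by
    funext i; ext b
    simp only [Pi.smul_apply, map_smul, PowerSeries.coeff_mk, smul_eq_mul, RingHom.id_apply]
    split_ifs
    · rw [mul_div_assoc]
    · rw [mul_zero]

theorem coeff_invTopPS (e K : ℕ) (u : ι → PowerSeries ℂ) (i : ι) (b : ℕ) :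
    PowerSeries.coeff b (invTopPS e K u i) =
      if K ≤ b then PowerSeries.coeff (b + e) (u i) / (b : ℂ) else 0 := by
  simp [invTopPS]

/-- The division by b ≥ K gains the factor 1/K, and the shift of degree by e costs ρ^(-e). A high
cut-off thus makes the right inverse arbitrarily small. -/
theorem norm_coeff_invTopPS_le {e K : ℕ} (hK : 0 < K) {ρ C : ℝ} (hρ : 0 < ρ) (hC : 0 ≤ C)
    {u : ι → PowerSeries ℂ} (hu : ∀ i k, ‖PowerSeries.coeff k (u i)‖ * ρ ^ k ≤ C) (i : ι) (b : ℕ) :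
    ‖PowerSeries.coeff b (invTopPS e K u i)‖ * ρ ^ b ≤ C / (ρ ^ e * K) := by
  rw [coeff_invTopPS]
  have hK' : (0 : ℝ) < K := by exact_mod_cast hK
  split_ifs with h
  · have hb : (K : ℝ) ≤ b := by exact_mod_cast h
    have hb0 : (0 : ℝ) < b := hK'.trans_le hb
    rw [le_div_iff₀ (by positivity), norm_div, Complex.norm_natCast]
    have h1 := hu i (b + e)
    rw [pow_add] at h1
    calc _ = (‖PowerSeries.coeff (b + e) (u i)‖ * (ρ ^ b * ρ ^ e)) * (K / b) := by
          field_simp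
      _ ≤ (‖PowerSeries.coeff (b + e) (u i)‖ * (ρ ^ b * ρ ^ e)) * 1 :=
          mul_le_mul_of_nonneg_left ((div_le_one hb0).mpr hb) (by positivity)
      _ ≤ C := by rw [mul_one]; exact h1
  · rw [norm_zero, zero_mul]
    positivity

/-- The isomorphism of `ℓ^∞` with `boundedPS`. -/
noncomputable def ofLp (ι : Type*) {ρ : ℝ} (_hρ : 0 < ρ) :
    lp (fun _ : ι × ℕ => ℂ) ∞ →ₗ[ℂ] (ι → PowerSeries ℂ) where
  toFun w i := PowerSeries.mk fun k => w (i, k) / (ρ : ℂ) ^ k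
  map_add' u v := by
    funext i; ext b
    simp [add_div]
  map_smul' c u := by
    funext i; ext b
    simp [mul_div_assoc]

theorem coeff_ofLp {ρ : ℝ} (hρ : 0 < ρ) (w : lp (fun _ : ι × ℕ => ℂ) ∞) (i : ι) (k : ℕ) :
    PowerSeries.coeff k (ofLp ι hρ w i) = w (i, k) / (ρ : ℂ) ^ k := by
  simp [ofLp]

theorem norm_coeff_ofLp_le {ρ : ℝ} (hρ : 0 < ρ) (w : lp (fun _ : ι × ℕ => ℂ) ∞) (i : ι) (k : ℕ) :
    ‖PowerSeries.coeff k (ofLp ι hρ w i)‖ * ρ ^ k ≤ ‖w‖ := by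
  rw [coeff_ofLp, norm_div, norm_pow, Complex.norm_real, Real.norm_of_nonneg hρ.le,
    div_mul_cancel₀ _ (pow_pos hρ k).ne']
  exact lp.norm_apply_le_norm ENNReal.top_ne_zero w (i, k)

theorem ofLp_injective {ρ : ℝ} (hρ : 0 < ρ) : Function.Injective (ofLp ι hρ) := by
  intro w w' h
  ext ⟨i, k⟩
  have h1 := congrArg (PowerSeries.coeff k) (congrFun h i)
  have : (ρ : ℂ) ^ k ≠ 0 := pow_ne_zero _ (by exact_mod_cast hρ.ne')
  rw [coeff_ofLp, coeff_ofLp] at h1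
  exact (div_left_inj' this).mp h1

/-- The element of `ℓ^∞` with given power series. -/
noncomputable def toLp {ρ : ℝ} (hρ : 0 < ρ) (u : ι → PowerSeries ℂ) (C : ℝ)
    (hC : ∀ i k, ‖PowerSeries.coeff k (u i)‖ * ρ ^ k ≤ C) : lp (fun _ : ι × ℕ => ℂ) ∞ :=
  ⟨fun q => PowerSeries.coeff q.2 (u q.1) * (ρ : ℂ) ^ q.2, memℓp_infty ⟨C, by
    rintro _ ⟨⟨i, k⟩, rfl⟩
    have := hC i k
    simpa [norm_mul, norm_pow, abs_of_pos hρ] using this⟩⟩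

theorem toLp_apply {ρ : ℝ} (hρ : 0 < ρ) (u : ι → PowerSeries ℂ) (C : ℝ)
    (hC : ∀ i k, ‖PowerSeries.coeff k (u i)‖ * ρ ^ k ≤ C) (q : ι × ℕ) :
    toLp hρ u C hC q = PowerSeries.coeff q.2 (u q.1) * (ρ : ℂ) ^ q.2 := rfl

theorem ofLp_toLp {ρ : ℝ} (hρ : 0 < ρ) (u : ι → PowerSeries ℂ) (C : ℝ)
    (hC : ∀ i k, ‖PowerSeries.coeff k (u i)‖ * ρ ^ k ≤ C) : ofLp ι hρ (toLp hρ u C hC) = u := by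
  funext i
  ext k
  have : (ρ : ℂ) ^ k ≠ 0 := pow_ne_zero _ (by exact_mod_cast hρ.ne')
  rw [coeff_ofLp, toLp_apply, mul_div_cancel_right₀ _ this]

theorem map_ofLp_top {ρ : ℝ} (hρ : 0 < ρ) :
    (⊤ : Submodule ℂ (lp (fun _ : ι × ℕ => ℂ) ∞)).map (ofLp ι hρ) = boundedPS ι ρ := by
  ext u
  rw [mem_boundedPS hρ]
  constructor
  · rintro ⟨w, -, rfl⟩
    exact ⟨‖w‖, norm_coeff_ofLp_le hρ w⟩
  · rintro ⟨C, hC⟩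
    exact ⟨toLp hρ u C hC, trivial, ofLp_toLp hρ u C hC⟩

variable [Fintype ι]

theorem polyPS_le_boundedPS (K : ℕ) (ρ : ℝ) : polyPS ι K ≤ boundedPS ι ρ := by
  intro u hu
  refine ⟨∑ i, ∑ k ∈ Finset.range K, ‖PowerSeries.coeff k (u i)‖ * |ρ| ^ k, fun i k => ?_⟩
  have h0 : ∀ i, 0 ≤ ∑ k ∈ Finset.range K, ‖PowerSeries.coeff k (u i)‖ * |ρ| ^ k :=
    fun i => Finset.sum_nonneg fun _ _ => by positivity
  by_cases hk : k < K
  · refine le_trans ?_ (Finset.single_le_sum (fun i _ => h0 i) (Finset.mem_univ i))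
    exact Finset.single_le_sum (f := fun k => ‖PowerSeries.coeff k (u i)‖ * |ρ| ^ k)
      (fun _ _ => by positivity) (Finset.mem_range.mpr hk)
  · rw [hu i k (not_lt.mp hk), norm_zero, zero_mul]
    exact Finset.sum_nonneg fun i _ => h0 i

/-- `u ↦ A u`. -/
noncomputable def matPS (A : Matrix ι ι (PowerSeries ℂ)) :
    (ι → PowerSeries ℂ) →ₗ[ℂ] (ι → PowerSeries ℂ) :=
  (Matrix.mulVecLin A).restrictScalars ℂ

/-- The operator `z ^ e (z d/dz) - A` on vectors of power series. -/
noncomputable def psOp (e : ℕ) (A : Matrix ι ι (PowerSeries ℂ)) :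
    (ι → PowerSeries ℂ) →ₗ[ℂ] (ι → PowerSeries ℂ) := topPS e - matPS A

/-- Convolution of a weighted ℓ¹ sequence, an entry of A, with a weighted ℓ^∞ sequence, an entry of
u. -/
theorem norm_coeff_matPS_le {A : Matrix ι ι (PowerSeries ℂ)} {ρ a C : ℝ} (hρ : 0 < ρ) (hC : 0 ≤ C)
    (hs : ∀ i j, Summable fun n => ‖PowerSeries.coeff n (A i j)‖ * ρ ^ n)
    (ha : ∀ i j, ∑' n, ‖PowerSeries.coeff n (A i j)‖ * ρ ^ n ≤ a) {u : ι → PowerSeries ℂ}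
    (hu : ∀ i k, ‖PowerSeries.coeff k (u i)‖ * ρ ^ k ≤ C) (i : ι) (m : ℕ) :
    ‖PowerSeries.coeff m (matPS A u i)‖ * ρ ^ m ≤ Fintype.card ι * (a * C) := by
  have h1 : ∀ j, ‖PowerSeries.coeff m (A i j * u j)‖ * ρ ^ m ≤ a * C := by
    intro j
    rw [PowerSeries.coeff_mul]
    calc _ ≤ (∑ p ∈ Finset.HasAntidiagonal.antidiagonal m, ‖PowerSeries.coeff p.1 (A i j) *
            PowerSeries.coeff p.2 (u j)‖) * ρ ^ m :=
          mul_le_mul_of_nonneg_right (norm_sum_le _ _) (by positivity)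
      _ = ∑ p ∈ Finset.HasAntidiagonal.antidiagonal m, (‖PowerSeries.coeff p.1 (A i j)‖ * ρ ^ p.1) *
            (‖PowerSeries.coeff p.2 (u j)‖ * ρ ^ p.2) := by
          rw [Finset.sum_mul]
          refine Finset.sum_congr rfl fun p hp => ?_
          rw [← Finset.HasAntidiagonal.mem_antidiagonal.mp hp, pow_add, norm_mul]
          ring
      _ ≤ ∑ p ∈ Finset.HasAntidiagonal.antidiagonal m,
            (‖PowerSeries.coeff p.1 (A i j)‖ * ρ ^ p.1) * C :=
          Finset.sum_le_sum fun p _ => mul_le_mul_of_nonneg_left (hu j p.2) (by positivity)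
      _ = (∑ n ∈ Finset.range (m + 1), ‖PowerSeries.coeff n (A i j)‖ * ρ ^ n) * C := by
          rw [← Finset.sum_mul, Finset.Nat.sum_antidiagonal_eq_sum_range_succ_mk]
      _ ≤ a * C := by
          refine mul_le_mul_of_nonneg_right (le_trans ?_ (ha i j)) hC
          exact (hs i j).sum_le_tsum _ fun n _ => by positivity
  have h2 : matPS A u i = ∑ j, A i j * u j := rfl
  rw [h2, map_sum]
  calc _ ≤ (∑ j, ‖PowerSeries.coeff m (A i j * u j)‖) * ρ ^ m :=
        mul_le_mul_of_nonneg_right (norm_sum_le _ _) (by positivity)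
    _ = ∑ j, ‖PowerSeries.coeff m (A i j * u j)‖ * ρ ^ m := Finset.sum_mul _ _ _
    _ ≤ ∑ _j : ι, a * C := Finset.sum_le_sum fun j _ => h1 j
    _ = _ := by simp

theorem matPS_mem_boundedPS {A : Matrix ι ι (PowerSeries ℂ)} {ρ : ℝ} (hρ : 0 < ρ)
    (hs : ∀ i j, Summable fun n => ‖PowerSeries.coeff n (A i j)‖ * ρ ^ n)
    {u : ι → PowerSeries ℂ} (hu : u ∈ boundedPS ι ρ) : matPS A u ∈ boundedPS ι ρ := by
  obtain ⟨C, hC⟩ := (mem_boundedPS hρ).mp hu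
  refine (mem_boundedPS hρ).mpr ⟨_, norm_coeff_matPS_le (C := max C 0)
    (a := ∑ i, ∑ j, ∑' n, ‖PowerSeries.coeff n (A i j)‖ * ρ ^ n) hρ (le_max_right _ _) hs ?_
    fun i k => (hC i k).trans (le_max_left _ _)⟩
  intro i j
  have h0 : ∀ i j, 0 ≤ ∑' n, ‖PowerSeries.coeff n (A i j)‖ * ρ ^ n :=
    fun i j => tsum_nonneg fun _ => by positivity
  refine (Finset.single_le_sum (f := fun j => ∑' n, ‖PowerSeries.coeff n (A i j)‖ * ρ ^ n)
    (fun j _ => h0 i j) (Finset.mem_univ j)).trans ?_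
  exact Finset.single_le_sum (f := fun i => ∑ j, ∑' n, ‖PowerSeries.coeff n (A i j)‖ * ρ ^ n)
    (fun i _ => Finset.sum_nonneg fun j _ => h0 i j) (Finset.mem_univ i)

/-- The composite of A with the cut-off right inverse has norm O(1/K). It is transported to ℓ^∞ in
order to use completeness there. -/
theorem exists_contraction {A : Matrix ι ι (PowerSeries ℂ)} {ρ : ℝ} (hρ : 0 < ρ)
    (hs : ∀ i j, Summable fun n => ‖PowerSeries.coeff n (A i j)‖ * ρ ^ n) (e : ℕ) :
    ∃ K : ℕ, 0 < K ∧ ∃ Q : lp (fun _ : ι × ℕ => ℂ) ∞ →L[ℂ] lp (fun _ : ι × ℕ => ℂ) ∞,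
      ‖Q‖ < 1 ∧ ∀ w, ofLp ι hρ (Q w) = matPS A (invTopPS e K (ofLp ι hρ w)) := by
  have h0 : ∀ i j, 0 ≤ ∑' n, ‖PowerSeries.coeff n (A i j)‖ * ρ ^ n :=
    fun i j => tsum_nonneg fun _ => by positivity
  set a := ∑ i, ∑ j, ∑' n, ‖PowerSeries.coeff n (A i j)‖ * ρ ^ n with ha
  have ha0 : 0 ≤ a := Finset.sum_nonneg fun i _ => Finset.sum_nonneg fun j _ => h0 i j
  have haij : ∀ i j, ∑' n, ‖PowerSeries.coeff n (A i j)‖ * ρ ^ n ≤ a := by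
    intro i j
    refine (Finset.single_le_sum (f := fun j => ∑' n, ‖PowerSeries.coeff n (A i j)‖ * ρ ^ n)
      (fun j _ => h0 i j) (Finset.mem_univ j)).trans ?_
    exact Finset.single_le_sum (f := fun i => ∑ j, ∑' n, ‖PowerSeries.coeff n (A i j)‖ * ρ ^ n)
      (fun i _ => Finset.sum_nonneg fun j _ => h0 i j) (Finset.mem_univ i)
  -- The factor 2 yields operator norm at most 1/2.
  obtain ⟨K, hK⟩ := exists_nat_gt (2 * (Fintype.card ι * a / ρ ^ e))
  have hK0 : (0 : ℝ) < K := lt_of_le_of_lt (by positivity) hK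
  have hKn : 0 < K := by exact_mod_cast hK0
  have hb : ∀ (w : lp (fun _ : ι × ℕ => ℂ) ∞) i k,
      ‖PowerSeries.coeff k (matPS A (invTopPS e K (ofLp ι hρ w)) i)‖ * ρ ^ k ≤ 1 / 2 * ‖w‖ := by
    intro w i k
    refine (norm_coeff_matPS_le hρ (C := ‖w‖ / (ρ ^ e * K)) (by positivity) hs haij
      (norm_coeff_invTopPS_le hKn hρ (norm_nonneg w) (norm_coeff_ofLp_le hρ w)) i k).trans ?_
    have : Fintype.card ι * (a * (‖w‖ / (ρ ^ e * K))) =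
        (Fintype.card ι * a / ρ ^ e) / K * ‖w‖ := by field_simp
    rw [this]
    refine mul_le_mul_of_nonneg_right ?_ (norm_nonneg _)
    rw [div_le_iff₀ hK0]
    linarith
  let Q₀ : lp (fun _ : ι × ℕ => ℂ) ∞ →ₗ[ℂ] lp (fun _ : ι × ℕ => ℂ) ∞ :=
    { toFun := fun w => toLp hρ _ _ (hb w)
      map_add' := fun v w => ofLp_injective hρ ((ofLp_toLp hρ _ _ (hb (v + w))).trans (by
        rw [map_add (ofLp ι hρ) (toLp _ _ _ _), ofLp_toLp, ofLp_toLp]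
        simp only [map_add]))
      map_smul' := fun c w => ofLp_injective hρ ((ofLp_toLp hρ _ _ (hb (c • w))).trans (by
        rw [map_smul (ofLp ι hρ) _ (toLp _ _ _ _), ofLp_toLp]
        simp only [map_smul, RingHom.id_apply])) }
  refine ⟨K, hKn, Q₀.mkContinuous (1 / 2) fun w => ?_, ?_, fun w => ofLp_toLp hρ _ _ (hb w)⟩
  · refine lp.norm_le_of_forall_le (by positivity) fun q => ?_
    have := hb w q.1 q.2
    change ‖toLp hρ _ _ (hb w) q‖ ≤ _
    rw [toLp_apply]
    simpa [norm_mul, norm_pow, abs_of_pos hρ] using this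
  · exact (LinearMap.mkContinuous_norm_le _ (by norm_num) _).trans_lt (by norm_num)

/-- The elements of `boundedPS` with image in `boundedPS`. -/
noncomputable def domainPS (e : ℕ) (A : Matrix ι ι (PowerSeries ℂ)) (ρ : ℝ) :
    Submodule ℂ (ι → PowerSeries ℂ) := boundedPS ι ρ ⊓ (boundedPS ι ρ).comap (psOp e A)

theorem map_domainPS_le (e : ℕ) (A : Matrix ι ι (PowerSeries ℂ)) (ρ : ℝ) :
    (domainPS e A ρ).map (psOp e A) ≤ boundedPS ι ρ := by
  rintro _ ⟨u, hu, rfl⟩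
  exact hu.2

end ConvergentIndex


/-! ### The cokernel on a fixed disc, and the limit over shrinking discs. -/

section ConvergentIndexLimit

open scoped ENNReal

variable {ι : Type*}

/-- Truncation below degree `K`. -/
noncomputable def truncPS (ι : Type*) (K : ℕ) :
    (ι → PowerSeries ℂ) →ₗ[ℂ] (ι × Fin K → ℂ) where
  toFun u q := PowerSeries.coeff q.2 (u q.1)
  map_add' u v := by ext; simp
  map_smul' c u := by ext; simp

theorem ker_truncPS (K : ℕ) : LinearMap.ker (truncPS ι K) = orderPS ι K := by
  ext u
  rw [LinearMap.mem_ker, funext_iff]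
  exact ⟨fun h i k hk => h (i, ⟨k, hk⟩), fun h q => h q.1 q.2 q.2.2⟩

theorem map_truncPS_polyPS (K : ℕ) : (polyPS ι K).map (truncPS ι K) = ⊤ := by
  refine eq_top_iff.mpr fun y _ => ⟨fun i => PowerSeries.mk fun k =>
    if h : k < K then y (i, ⟨k, h⟩) else 0, fun i k hk => ?_, ?_⟩
  · simp [not_lt.mpr hk]
  · ext q
    simp [truncPS]

/-- The right inverse is exact in degrees at least K + e, so its error is a polynomial; K > 0 avoids
a division by zero. -/
theorem sub_topPS_invTopPS_mem (e : ℕ) {K : ℕ} (hK : 0 < K) (u : ι → PowerSeries ℂ) :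
    u - topPS e (invTopPS e K u) ∈ polyPS ι (K + e) := by
  intro i m hm
  rw [Pi.sub_apply, map_sub, coeff_topPS, if_pos (by omega), coeff_invTopPS,
    if_pos (by omega), Nat.sub_add_cancel (by omega), mul_div_cancel₀, sub_self]
  exact_mod_cast (by omega : m - e ≠ 0)

theorem topPS_invTopPS {e K : ℕ} (hK : 0 < K) {u : ι → PowerSeries ℂ}
    (hu : u ∈ orderPS ι (K + e)) : topPS e (invTopPS e K u) = u := by
  funext i
  ext m
  by_cases hm : m < K + e
  · rw [hu i m hm, coeff_topPS]
    split_ifs with h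
    · rw [coeff_invTopPS, if_neg (by omega), mul_zero]
    · rfl
  · have := sub_topPS_invTopPS_mem e hK u i m (not_lt.mp hm)
    rw [Pi.sub_apply, map_sub, sub_eq_zero] at this
    exact this.symm

theorem topPS_mem_orderPS (e : ℕ) {K : ℕ} {v : ι → PowerSeries ℂ} (hv : v ∈ orderPS ι K) :
    topPS e v ∈ orderPS ι (K + e) := fun i k hk => by
  rw [coeff_topPS]
  split_ifs with h
  · rw [hv i _ (by omega), mul_zero]
  · rfl

theorem invTopPS_topPS (e : ℕ) {K : ℕ} (hK : 0 < K) {v : ι → PowerSeries ℂ}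
    (hv : v ∈ orderPS ι K) : invTopPS e K (topPS e v) = v := by
  funext i
  ext b
  rw [coeff_invTopPS]
  split_ifs with h
  · rw [coeff_topPS, if_pos (by omega), Nat.add_sub_cancel, mul_div_cancel_left₀]
    exact_mod_cast (by omega : b ≠ 0)
  · rw [hv i b (by omega)]

theorem invTopPS_mem_orderPS (e K : ℕ) (u : ι → PowerSeries ℂ) :
    invTopPS e K u ∈ orderPS ι K := fun i k hk => by
  rw [coeff_invTopPS, if_neg (not_le.mpr hk)]

/-- The vectors of convergent power series. -/
noncomputable def convVec (ι : Type*) : Submodule ℂ (ι → PowerSeries ℂ) :=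
  Submodule.pi Set.univ fun _ => Subalgebra.toSubmodule convPowerSeries

theorem boundedPS_le_convVec {ρ : ℝ} (hρ : 0 < ρ) : boundedPS ι ρ ≤ convVec ι := by
  intro u hu i _
  obtain ⟨C, hC⟩ := (mem_boundedPS hρ).mp hu
  refine ⟨ρ / 2, by positivity, ?_⟩
  refine ((summable_geometric_two).mul_left C).of_nonneg_of_le (fun _ => by positivity) fun k => ?_
  rw [div_pow, one_div, inv_pow, ← div_eq_mul_inv, ← mul_div_assoc]
  exact div_le_div_of_nonneg_right (hC i k) (by positivity)

theorem ofLp_mem_boundedPS {ρ : ℝ} (hρ : 0 < ρ) (w : lp (fun _ : ι × ℕ => ℂ) ∞) :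
    ofLp ι hρ w ∈ boundedPS ι ρ := (mem_boundedPS hρ).mpr ⟨‖w‖, norm_coeff_ofLp_le hρ w⟩

variable [Fintype ι]

/-- The first K coefficients of each entry may be prescribed freely as soon as D contains the
polynomials of degree below K. -/
theorem relLength_inf_orderPS {D : Submodule ℂ (ι → PowerSeries ℂ)} {K : ℕ}
    (hD : polyPS ι K ≤ D) :
    relLength D (D ⊓ orderPS ι K) = ((Fintype.card ι * K : ℕ) : ℕ∞) := by
  rw [← ker_truncPS, relLength_inf_ker
    (eq_top_iff.mpr ((map_truncPS_polyPS K).ge.trans (Submodule.map_mono hD))),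
    Module.length_eq_finrank]
  simp

theorem polyPS_le_domainPS {A : Matrix ι ι (PowerSeries ℂ)} {ρ : ℝ} (hρ : 0 < ρ)
    (hs : ∀ i j, Summable fun n => ‖PowerSeries.coeff n (A i j)‖ * ρ ^ n) (e K : ℕ) :
    polyPS ι K ≤ domainPS e A ρ := by
  intro u hu
  have hb := polyPS_le_boundedPS K ρ hu
  refine ⟨hb, sub_mem (polyPS_le_boundedPS (K + e) ρ fun i k hk => ?_)
    (matPS_mem_boundedPS hρ hs hb)⟩
  rw [coeff_topPS]
  split_ifs with h
  · rw [hu i _ (by omega), mul_zero]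
  · rfl

theorem invTopPS_mem_domainPS {A : Matrix ι ι (PowerSeries ℂ)} {ρ : ℝ} (hρ : 0 < ρ)
    (hs : ∀ i j, Summable fun n => ‖PowerSeries.coeff n (A i j)‖ * ρ ^ n) (e : ℕ) {K : ℕ}
    (hK : 0 < K) {u : ι → PowerSeries ℂ} (hu : u ∈ boundedPS ι ρ) :
    invTopPS e K u ∈ domainPS e A ρ := by
  obtain ⟨C, hC⟩ := (mem_boundedPS hρ).mp hu
  have h1 : invTopPS e K u ∈ boundedPS ι ρ := (mem_boundedPS hρ).mpr
    ⟨_, norm_coeff_invTopPS_le (C := max C 0) hK hρ (le_max_right _ _)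
      fun i k => (hC i k).trans (le_max_left _ _)⟩
  refine ⟨h1, sub_mem ?_ (matPS_mem_boundedPS hρ hs h1)⟩
  have := sub_mem hu (polyPS_le_boundedPS _ ρ (sub_topPS_invTopPS_mem e hK u))
  rwa [sub_sub_cancel] at this

/-- An injective map from `ℓ^∞` onto `boundedPS` which is the operator up to polynomials. -/
theorem exists_parametrization {A : Matrix ι ι (PowerSeries ℂ)} {ρ : ℝ} (hρ : 0 < ρ)
    (hs : ∀ i j, Summable fun n => ‖PowerSeries.coeff n (A i j)‖ * ρ ^ n) (e : ℕ) :
    ∃ K, 0 < K ∧ ∃ g : lp (fun _ : ι × ℕ => ℂ) ∞ →ₗ[ℂ] (ι → PowerSeries ℂ),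
      Function.Injective g ∧ (⊤ : Submodule ℂ _).map g = boundedPS ι ρ ∧
      ∀ w, g w = (ofLp ι hρ w - topPS e (invTopPS e K (ofLp ι hρ w))) +
        psOp e A (invTopPS e K (ofLp ι hρ w)) := by
  obtain ⟨K, hK, Q, hQ, hQA⟩ := exists_contraction hρ hs e
  -- Neumann series. With S the cut-off right inverse, g is u ↦ u - A S u, read on ℓ^∞. It equals (u
  -- - z^e θ S u) + (z^e θ - A) S u with θ = z d/dz, where the first term is a polynomial.
  have hbij : Function.Bijective
      (1 - Q : lp (fun _ : ι × ℕ => ℂ) ∞ →L[ℂ] lp (fun _ : ι × ℕ => ℂ) ∞) :=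
    ContinuousLinearMap.isUnit_iff_bijective.mp (isUnit_one_sub_of_norm_lt_one hQ)
  refine ⟨K, hK, (ofLp ι hρ).comp (1 - Q : _ →L[ℂ] _).toLinearMap,
    (ofLp_injective hρ).comp hbij.1, ?_, fun w => ?_⟩
  · rw [Submodule.map_comp, Submodule.map_top, LinearMap.range_eq_top.mpr hbij.2, map_ofLp_top]
  · have h : ((ofLp ι hρ).comp (1 - Q : _ →L[ℂ] _).toLinearMap) w =
        ofLp ι hρ w - ofLp ι hρ (Q w) := by rw [← map_sub]; rfl
    rw [h, hQA, psOp, LinearMap.sub_apply]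
    abel

/-- On series of order at least K + e the polynomial error vanishes, and the right inverse
identifies them with the part of the domain of order at least K. There the parametrization and the
operator have the same image. -/
theorem map_comap_orderPS {A : Matrix ι ι (PowerSeries ℂ)} {ρ : ℝ} (hρ : 0 < ρ)
    (hs : ∀ i j, Summable fun n => ‖PowerSeries.coeff n (A i j)‖ * ρ ^ n) {e K : ℕ} (hK : 0 < K)
    {g : lp (fun _ : ι × ℕ => ℂ) ∞ →ₗ[ℂ] (ι → PowerSeries ℂ)}
    (hg : ∀ w, g w = (ofLp ι hρ w - topPS e (invTopPS e K (ofLp ι hρ w))) +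
        psOp e A (invTopPS e K (ofLp ι hρ w))) :
    ((orderPS ι (K + e)).comap (ofLp ι hρ)).map g =
      (domainPS e A ρ ⊓ orderPS ι K).map (psOp e A) := by
  ext f
  rw [Submodule.mem_map, Submodule.mem_map]
  constructor
  · rintro ⟨w, hw, rfl⟩
    refine ⟨invTopPS e K (ofLp ι hρ w), Submodule.mem_inf.mpr
      ⟨invTopPS_mem_domainPS hρ hs e hK (ofLp_mem_boundedPS hρ w), invTopPS_mem_orderPS e K _⟩, ?_⟩
    rw [hg, topPS_invTopPS hK (Submodule.mem_comap.mp hw), sub_self, zero_add]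
  · rintro ⟨v, hv, rfl⟩
    obtain ⟨hv, hvK⟩ := Submodule.mem_inf.mp hv
    have h1 : topPS e v ∈ boundedPS ι ρ := by
      have := add_mem (Submodule.mem_comap.mp hv.2) (matPS_mem_boundedPS hρ hs hv.1)
      rwa [psOp, LinearMap.sub_apply, sub_add_cancel] at this
    rw [← map_ofLp_top hρ] at h1
    obtain ⟨w, -, hw⟩ := Submodule.mem_map.mp h1
    refine ⟨w, Submodule.mem_comap.mpr ?_, ?_⟩
    · rw [hw]
      exact topPS_mem_orderPS e hvK
    · rw [hg, hw, invTopPS_topPS e hK hvK, sub_self, zero_add]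

/-- The cokernel of `z ^ e (z d/dz) - A` on vectors converging on a fixed disc has dimension `n e`
and is spanned by polynomials. -/
theorem relLength_boundedPS {A : Matrix ι ι (PowerSeries ℂ)} {ρ : ℝ} (hρ : 0 < ρ)
    (hs : ∀ i j, Summable fun n => ‖PowerSeries.coeff n (A i j)‖ * ρ ^ n) {e : ℕ}
    (hinj : Function.Injective (psOp e A)) :
    relLength (boundedPS ι ρ) ((domainPS e A ρ).map (psOp e A)) =
      ((Fintype.card ι * e : ℕ) : ℕ∞) ∧
    ∃ M, boundedPS ι ρ ≤ polyPS ι M ⊔ (domainPS e A ρ).map (psOp e A) := by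
  obtain ⟨K, hK, g, hginj, hgtop, hg⟩ := exists_parametrization hρ hs e
  refine ⟨?_, K + e, ?_⟩
  · have h0 : relLength ⊤ ((orderPS ι (K + e)).comap (ofLp ι hρ)) =
        ((Fintype.card ι * (K + e) : ℕ) : ℕ∞) := by
      rw [← relLength_map (ofLp_injective hρ), Submodule.map_comap_eq, map_ofLp_top,
        ← Submodule.map_top, map_ofLp_top]
      exact relLength_inf_orderPS (polyPS_le_boundedPS _ _)
    have h1 : relLength (boundedPS ι ρ) ((domainPS e A ρ ⊓ orderPS ι K).map (psOp e A)) =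
        ((Fintype.card ι * (K + e) : ℕ) : ℕ∞) := by
      rw [← map_comap_orderPS hρ hs hK hg, ← hgtop, relLength_map hginj, h0]
    have h2 := relLength_inf_orderPS (polyPS_le_domainPS hρ hs e K)
    rw [← relLength_map hinj] at h2
    rw [relLength_add (map_domainPS_le e A ρ) (Submodule.map_mono inf_le_left), h2, mul_add,
      Nat.cast_add] at h1
    exact ENat.add_right_injective_of_ne_top (ENat.natCast_ne_top _) h1
  · rw [← hgtop]
    rintro f hf
    obtain ⟨w, -, rfl⟩ := Submodule.mem_map.mp hf
    rw [hg]
    exact Submodule.add_mem_sup (sub_topPS_invTopPS_mem e hK _) (Submodule.mem_map_of_mem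
      (invTopPS_mem_domainPS hρ hs e hK (ofLp_mem_boundedPS hρ w)))

theorem exists_mem_boundedPS {u : ι → PowerSeries ℂ} (hu : u ∈ convVec ι) {ρ₀ : ℝ} (h0 : 0 < ρ₀) :
    ∃ ρ, 0 < ρ ∧ ρ ≤ ρ₀ ∧ u ∈ boundedPS ι ρ := by
  choose r hr hs using fun i => hu i (Set.mem_univ i)
  obtain ⟨ρ, hρ, hle⟩ : ∃ ρ, 0 < ρ ∧ ρ ≤ ρ₀ ∧ ∀ i, ρ ≤ r i := by
    refine ⟨(insert ρ₀ (Finset.univ.image r)).min' (by simp), ?_, ?_, fun i => ?_⟩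
    · rw [Finset.lt_min'_iff]
      simp [h0, hr]
    · exact Finset.min'_le _ _ (by simp)
    · exact Finset.min'_le _ _ (by simp)
  refine ⟨ρ, hρ, hle.1, (mem_boundedPS hρ).mpr
    ⟨∑ i, ∑' k, ‖PowerSeries.coeff k (u i)‖ * r i ^ k, fun i k => ?_⟩⟩
  have hri := hr i
  calc _ ≤ ‖PowerSeries.coeff k (u i)‖ * r i ^ k :=
        mul_le_mul_of_nonneg_left (pow_le_pow_left₀ hρ.le (hle.2 i) _) (norm_nonneg _)
    _ ≤ ∑' k, ‖PowerSeries.coeff k (u i)‖ * r i ^ k :=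
        (hs i).le_tsum k fun _ _ => by positivity
    _ ≤ _ := Finset.single_le_sum (f := fun i => ∑' k, ‖PowerSeries.coeff k (u i)‖ * r i ^ k)
        (fun i _ => tsum_nonneg fun k => by have := hr i; positivity) (Finset.mem_univ i)

/-- The cokernel of an injective operator `z ^ e (z d/dz) - A` on `ℂ{z} ^ n` has
dimension `n e`. -/
theorem relLength_convVec {A : Matrix ι ι (PowerSeries ℂ)} (hA : ∀ i j, A i j ∈ convPowerSeries)
    {e : ℕ} (hinj : Function.Injective (psOp e A)) :
    relLength (convVec ι) ((convVec ι).map (psOp e A)) = ((Fintype.card ι * e : ℕ) : ℕ∞) := by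
  obtain ⟨ρ₁, h1, -, hb⟩ := exists_mem_boundedPS (ι := ι × ι) (u := fun q => A q.1 q.2)
    (fun q _ => hA q.1 q.2) one_pos
  -- Halving the radius turns bounded weighted coefficients into summable ones.
  set ρ₀ := ρ₁ / 2 with hρ₀
  have h0 : 0 < ρ₀ := by positivity
  have hs : ∀ ρ, 0 < ρ → ρ ≤ ρ₀ →
      ∀ i j, Summable fun n => ‖PowerSeries.coeff n (A i j)‖ * ρ ^ n := by
    intro ρ hρ hle i j
    obtain ⟨C, hC⟩ := (mem_boundedPS h1).mp hb
    refine ((summable_geometric_two).mul_left C).of_nonneg_of_le (fun _ => by positivity)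
      fun k => ?_
    calc _ ≤ ‖PowerSeries.coeff k (A i j)‖ * ρ₀ ^ k :=
          mul_le_mul_of_nonneg_left (pow_le_pow_left₀ hρ.le hle _) (norm_nonneg _)
      _ ≤ _ := by
        rw [hρ₀, div_pow, one_div, inv_pow, ← div_eq_mul_inv, ← mul_div_assoc]
        exact div_le_div_of_nonneg_right (hC (i, j) k) (by positivity)
  set T := psOp e A
  have hmap : (convVec ι).map T ≤ convVec ι := by
    rintro _ ⟨u, hu, rfl⟩ i _
    have hX : (PowerSeries.X : PowerSeries ℂ) ∈ convPowerSeries :=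
      ⟨1, one_pos, summable_of_ne_finset_zero (s := {1}) fun n hn => by
        have : n ≠ 1 := by simpa using hn
        simp [PowerSeries.coeff_X, this]⟩
    have hu' : ∀ j, u j ∈ convPowerSeries := fun j => hu j (Set.mem_univ j)
    have hth : eulerPS (u i) ∈ convPowerSeries := by
      obtain ⟨ρ, hρ, hsum⟩ := hu' i
      refine ⟨ρ / 2, by positivity, hsum.of_nonneg_of_le (fun _ => by positivity) fun k => ?_⟩
      rw [coeff_eulerPS, norm_mul, Complex.norm_natCast, div_pow]
      have h2 : (k : ℝ) ≤ 2 ^ k := by exact_mod_cast Nat.lt_two_pow_self.le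
      calc _ ≤ 2 ^ k * ‖PowerSeries.coeff k (u i)‖ * (ρ ^ k / 2 ^ k) := by gcongr
        _ = _ := by field_simp
    have h : PowerSeries.X ^ e * eulerPS (u i) - ∑ j, A i j * u j ∈ convPowerSeries :=
      sub_mem (mul_mem (pow_mem hX e) hth) (sum_mem fun j _ => mul_mem (hA i j) (hu' j))
    exact h
  obtain ⟨hl0, -⟩ := relLength_boundedPS h0 (hs ρ₀ h0 le_rfl) hinj
  -- On the smaller disc the cokernel is spanned by polynomials, and these already belong to the
  -- space for the larger disc.
  have hsup : ∀ ρ, 0 < ρ → ρ ≤ ρ₀ →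
      boundedPS ι ρ ≤ boundedPS ι ρ₀ ⊔ (domainPS e A ρ).map T := by
    intro ρ hρ hle
    obtain ⟨M, hM⟩ := (relLength_boundedPS hρ (hs ρ hρ hle) hinj).2
    exact hM.trans (sup_le_sup_right (polyPS_le_boundedPS M ρ₀) _)
  have hdom : ∀ ρ, 0 < ρ → (domainPS e A ρ).map T ≤ (convVec ι).map T := fun ρ hρ =>
    Submodule.map_mono (inf_le_left.trans (boundedPS_le_convVec hρ))
  have e1 : boundedPS ι ρ₀ ⊔ (convVec ι).map T = convVec ι := by
    refine le_antisymm (sup_le (boundedPS_le_convVec h0) hmap) fun u hu => ?_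
    obtain ⟨ρ, hρ, hle, hu'⟩ := exists_mem_boundedPS hu h0
    exact sup_le_sup_left (hdom ρ hρ) _ (hsup ρ hρ hle hu')
  have hanti : ∀ ρ, 0 < ρ → ρ ≤ ρ₀ → (domainPS e A ρ₀).map T ≤ (domainPS e A ρ).map T :=
    fun ρ hρ hle => Submodule.map_mono (inf_le_inf (boundedPS_anti hρ hle)
      (Submodule.comap_mono (boundedPS_anti hρ hle)))
  -- The cokernel for ρ₀ maps onto that for ρ. Both have the finite dimension n e, so the map is
  -- injective: if T u is bounded for ρ₀ and u only for ρ, then T u is the image of some element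
  -- bounded for ρ₀.
  have e2 : boundedPS ι ρ₀ ⊓ (convVec ι).map T = (domainPS e A ρ₀).map T := by
    refine le_antisymm ?_ (le_inf (map_domainPS_le e A ρ₀) (hdom ρ₀ h0))
    rintro _ ⟨hf, u, hu, rfl⟩
    obtain ⟨ρ, hρ, hle, hu'⟩ := exists_mem_boundedPS hu h0
    have hT : T u ∈ (domainPS e A ρ).map T := ⟨u, ⟨hu', boundedPS_anti hρ hle hf⟩, rfl⟩
    have hl : relLength (boundedPS ι ρ₀) (boundedPS ι ρ₀ ⊓ (domainPS e A ρ).map T) =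
        ((Fintype.card ι * e : ℕ) : ℕ∞) := by
      rw [← relLength_sup, le_antisymm (sup_le (boundedPS_anti hρ hle) (map_domainPS_le e A ρ))
        (hsup ρ hρ hle), (relLength_boundedPS hρ (hs ρ hρ hle) hinj).1]
    have hl' := relLength_add (inf_le_left : boundedPS ι ρ₀ ⊓ (domainPS e A ρ).map T ≤ _)
      (le_inf (map_domainPS_le e A ρ₀) (hanti ρ hρ hle))
    rw [hl0, hl] at hl'
    have h3 := ENat.add_left_injective_of_ne_top (ENat.natCast_ne_top (Fintype.card ι * e))
      ((zero_add _).trans hl')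
    exact le_of_relLength_eq_zero h3.symm (Submodule.mem_inf.mpr ⟨hf, hT⟩)
  rw [← hl0, ← e2, ← relLength_sup, e1]

end ConvergentIndexLimit


/-! ### The irregularity -/

section Irregularity

theorem ofPowerSeries_mem_ordGE (g : PowerSeries ℂ) : HahnSeries.ofPowerSeries ℤ ℂ g ∈ ordGE 0 := by
  intro j hj
  rw [HahnSeries.ofPowerSeries_apply]
  refine HahnSeries.embDomain_of_notMem_range ?_
  rintro ⟨a, ha⟩
  simp at ha
  omega

theorem exists_ofPowerSeries_eq {f : LaurentSeries ℂ} (hf : f ∈ ordGE 0) :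
    ∃ g, HahnSeries.ofPowerSeries ℤ ℂ g = f := by
  refine ⟨PowerSeries.mk fun n => f.coeff n, ?_⟩
  ext j
  by_cases hj : j < 0
  · rw [hf j hj, ofPowerSeries_mem_ordGE _ j hj]
  · obtain ⟨n, rfl⟩ := Int.eq_ofNat_of_zero_le (not_lt.mp hj)
    exact (HahnSeries.ofPowerSeries_apply_coeff _ n).trans (PowerSeries.coeff_mk _ _)

theorem ofPowerSeries_mem_convLaurent {g : PowerSeries ℂ} (hg : g ∈ convPowerSeries) :
    HahnSeries.ofPowerSeries ℤ ℂ g ∈ convLaurent :=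
  ⟨0, g, hg, by simp⟩

theorem convPowerSeries_of_ofPowerSeries {g : PowerSeries ℂ}
    (hg : HahnSeries.ofPowerSeries ℤ ℂ g ∈ convLaurent) : g ∈ convPowerSeries := by
  obtain ⟨N, h, ⟨ρ, hρ, hs⟩, e⟩ := hg
  refine ⟨ρ, hρ, ?_⟩
  have hc : ∀ n, PowerSeries.coeff n g = PowerSeries.coeff (n + N) h := by
    intro n
    have := congrArg (fun f => HahnSeries.coeff f (n : ℤ)) e
    simp only [HahnSeries.coeff_single_mul, one_mul, sub_neg_eq_add] at this
    have h1 := HahnSeries.ofPowerSeries_apply_coeff (Γ := ℤ) g n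
    have h2 := HahnSeries.ofPowerSeries_apply_coeff (Γ := ℤ) h (n + N)
    push_cast at h2
    exact (h1.symm.trans this).trans h2
  have h3 := ((summable_nat_add_iff N).mpr hs).mul_right ((ρ ^ N)⁻¹)
  refine h3.congr fun n => ?_
  rw [hc, pow_add]
  field_simp

theorem single_mem_convLaurent (n : ℤ) (c : ℂ) :
    (HahnSeries.single n c : LaurentSeries ℂ) ∈ convLaurent := by
  have hX : (PowerSeries.X : PowerSeries ℂ) ∈ convPowerSeries :=
    ⟨1, one_pos, summable_of_ne_finset_zero (s := {1}) fun n hn => by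
      have : n ≠ 1 := by simpa using hn
      simp [PowerSeries.coeff_X, this]⟩
  refine ⟨(-n).toNat, PowerSeries.C c * PowerSeries.X ^ n.toNat,
    mul_mem (convPowerSeries.algebraMap_mem c) (pow_mem hX _), ?_⟩
  rw [map_mul, HahnSeries.ofPowerSeries_C, HahnSeries.ofPowerSeries_X_pow, HahnSeries.C_apply,
    HahnSeries.single_mul_single, HahnSeries.single_mul_single,
    show -((-n).toNat : ℤ) + (0 + (n.toNat : ℤ)) = n by omega, one_mul, mul_one]

theorem exists_sub_mem_ordGE (f : LaurentSeries ℂ) : ∃ g ∈ convLaurent, f - g ∈ ordGE 0 := by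
  obtain ⟨m, hm⟩ := exists_mem_ordGE f
  refine ⟨∑ j ∈ Finset.Ico m 0, HahnSeries.single j (f.coeff j),
    sum_mem fun j _ => single_mem_convLaurent j _, fun j hj => ?_⟩
  rw [HahnSeries.coeff_sub, HahnSeries.coeff_sum, sub_eq_zero, Finset.sum_eq_single j]
  · rw [HahnSeries.coeff_single_same]
  · exact fun b _ hb => HahnSeries.coeff_single_of_ne hb.symm
  · intro h
    rw [Finset.mem_Ico, not_and] at h
    rw [HahnSeries.coeff_single_same, hm j (not_le.mp fun hmj => h hmj hj)]

variable {ι : Type*}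

/-- The vectors of convergent Laurent series. -/
noncomputable def convLaurentVec (ι : Type*) : Submodule ℂ (ι → LaurentSeries ℂ) :=
  Submodule.pi Set.univ fun _ => Subalgebra.toSubmodule convLaurent

theorem mem_convLaurentVec {v : ι → LaurentSeries ℂ} :
    v ∈ convLaurentVec ι ↔ ∀ i, v i ∈ convLaurent := by
  simp [convLaurentVec, Submodule.mem_pi]

/-- A formal Laurent series has a finite, hence convergent, principal part. -/
theorem convLaurentVec_sup : convLaurentVec ι ⊔ ordGEPi (fun _ => 0) = ⊤ := by
  refine eq_top_iff.mpr fun v _ => ?_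
  choose g hg hg' using fun i => exists_sub_mem_ordGE (v i)
  have : v = g + (v - g) := by abel
  rw [this]
  exact Submodule.add_mem_sup (mem_convLaurentVec.mpr hg) (mem_ordGEPi.mpr hg')

/-- The inclusion of power series in Laurent series. -/
noncomputable def ofPowerSeriesVec (ι : Type*) :
    (ι → PowerSeries ℂ) →ₗ[ℂ] (ι → LaurentSeries ℂ) where
  toFun u i := HahnSeries.ofPowerSeries ℤ ℂ (u i)
  map_add' u v := by funext i; simp
  map_smul' c u := by
    funext i
    simp only [Pi.smul_apply, PowerSeries.smul_eq_C_mul, map_mul, HahnSeries.ofPowerSeries_C,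
      HahnSeries.C_mul_eq_smul, RingHom.id_apply]

theorem ofPowerSeriesVec_apply (u : ι → PowerSeries ℂ) (i : ι) :
    ofPowerSeriesVec ι u i = HahnSeries.ofPowerSeries ℤ ℂ (u i) := rfl

theorem ofPowerSeriesVec_injective : Function.Injective (ofPowerSeriesVec ι) := fun _ _ h =>
  funext fun i => HahnSeries.ofPowerSeries_injective (congrFun h i)

theorem map_convVec : (convVec ι).map (ofPowerSeriesVec ι) =
    convLaurentVec ι ⊓ ordGEPi (fun _ => 0) := by
  ext v
  rw [Submodule.mem_map, Submodule.mem_inf, mem_convLaurentVec, mem_ordGEPi]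
  constructor
  · rintro ⟨u, hu, rfl⟩
    exact ⟨fun i => ofPowerSeries_mem_convLaurent (hu i (Set.mem_univ i)),
      fun i => ofPowerSeries_mem_ordGE _⟩
  · rintro ⟨h1, h2⟩
    choose u hu using fun i => exists_ofPowerSeries_eq (h2 i)
    exact ⟨u, fun i _ => convPowerSeries_of_ofPowerSeries ((hu i).symm ▸ h1 i), funext hu⟩

/-- The inclusion of convergent in formal vectors. -/
noncomputable def convIncl (ι : Type*) : (ι → convLaurent) →ₗ[ℂ] (ι → LaurentSeries ℂ) where
  toFun v i := v i
  map_add' _ _ := rfl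
  map_smul' _ _ := rfl

theorem convIncl_injective : Function.Injective (convIncl ι) := fun _ _ h =>
  funext fun i => Subtype.ext (congrFun h i)

theorem map_convIncl_top : (⊤ : Submodule ℂ (ι → convLaurent)).map (convIncl ι) =
    convLaurentVec ι := by
  ext v
  rw [mem_convLaurentVec]
  exact ⟨fun ⟨u, _, h⟩ i => h ▸ (u i).2, fun h => ⟨fun i => ⟨v i, h i⟩, trivial, rfl⟩⟩

theorem shift_mem_convLaurentVec (e : ℤ) (v : ι → LaurentSeries ℂ) :
    shift e v ∈ convLaurentVec ι ↔ v ∈ convLaurentVec ι := by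
  have h : ∀ e (v : ι → LaurentSeries ℂ), v ∈ convLaurentVec ι → shift e v ∈ convLaurentVec ι :=
    fun e v hv => mem_convLaurentVec.mpr fun i =>
      mul_mem (single_mem_convLaurent e 1) (mem_convLaurentVec.mp hv i)
  refine ⟨fun hv => ?_, h e v⟩
  have := h (-e) _ hv
  rwa [shift_shift, neg_add_cancel, shift_zero] at this

variable [Fintype ι]

/-- Links the analytic and the formal operator: z^e (z d/dz - H) has the power series matrix A = z^e
H. -/
theorem ofPowerSeriesVec_psOp {e : ℕ} {H : Matrix ι ι (LaurentSeries ℂ)}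
    {A : Matrix ι ι (PowerSeries ℂ)}
    (hA : ∀ i j, HahnSeries.ofPowerSeries ℤ ℂ (A i j) = HahnSeries.single (e : ℤ) 1 * H i j)
    (u : ι → PowerSeries ℂ) :
    ofPowerSeriesVec ι (psOp e A u) = latticeOp 1 e 0 H (ofPowerSeriesVec ι u) := by
  have h1 : ∀ f, HahnSeries.ofPowerSeries ℤ ℂ (eulerPS f) =
      coeffMul (thetaCoeff 1 0) (HahnSeries.ofPowerSeries ℤ ℂ f) := by
    intro f
    ext j
    rw [coeffMul_coeff]
    by_cases hj : j < 0
    · rw [ofPowerSeries_mem_ordGE _ j hj, ofPowerSeries_mem_ordGE _ j hj, mul_zero]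
    · obtain ⟨n, rfl⟩ := Int.eq_ofNat_of_zero_le (not_lt.mp hj)
      have h2 := HahnSeries.ofPowerSeries_apply_coeff (Γ := ℤ) f n
      have h3 := HahnSeries.ofPowerSeries_apply_coeff (Γ := ℤ) (eulerPS f) n
      rw [coeff_eulerPS] at h3
      refine h3.trans ?_
      rw [← h2]
      simp [thetaCoeff]
  funext i
  have e1 : psOp e A u i = PowerSeries.X ^ e * eulerPS (u i) - ∑ j, A i j * u j := rfl
  rw [ofPowerSeriesVec_apply, e1, map_sub, map_mul, HahnSeries.ofPowerSeries_X_pow, h1, map_sum,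
    latticeOp, LinearMap.comp_apply, shift_apply, systemOp_apply, mul_sub, Matrix.mulVec,
    dotProduct, Finset.mul_sum]
  congr 1
  refine Finset.sum_congr rfl fun j _ => ?_
  rw [map_mul, hA, mul_assoc]
  rfl

theorem thetaCoeff_one_zero (f : LaurentSeries ℂ) :
    coeffMul (thetaCoeff 1 0) f = HahnSeries.single 1 1 * ddz f := by
  ext j
  rw [coeffMul_coeff, HahnSeries.coeff_single_mul, one_mul, LaurentSeries.derivative_apply,
    LaurentSeries.hasseDeriv_coeff, Ring.choose_one_right]
  simp [thetaCoeff]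

/-- The matrix `z G`. -/
noncomputable def thetaMatrix (G : Matrix ι ι convLaurent) : Matrix ι ι (LaurentSeries ℂ) :=
  G.map fun f => HahnSeries.single 1 1 * (f : LaurentSeries ℂ)

theorem shift_nablaFormal (G : Matrix ι ι convLaurent) (v : ι → LaurentSeries ℂ) :
    shift 1 (nablaFormal G v) = systemOp (thetaCoeff 1 0) (thetaMatrix G) v := by
  funext i
  have e1 : nablaFormal G v i = ddz (v i) - ∑ j, (G i j : LaurentSeries ℂ) * v j := rfl
  rw [shift_apply, systemOp_apply, e1, mul_sub, thetaCoeff_one_zero, Finset.mul_sum]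
  congr 1
  exact Finset.sum_congr rfl fun j _ => (mul_assoc _ _ _).symm

theorem convIncl_nablaConv (G : Matrix ι ι convLaurent) (v : ι → convLaurent) :
    convIncl ι (nablaConv G v) = nablaFormal G (convIncl ι v) := by
  funext i
  have e1 : nablaFormal G (convIncl ι v) i =
    ddz (v i) - ∑ j, (G i j : LaurentSeries ℂ) * (v j : LaurentSeries ℂ) := rfl
  have e2 : nablaConv G v i = ddzConv (v i) - ∑ j, G i j * v j := rfl
  have e3 : convIncl ι (nablaConv G v) i =
    ((nablaConv G v i : convLaurent) : LaurentSeries ℂ) := rfl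
  rw [e1, e3, e2]
  push_cast
  rfl

theorem map_nablaFormal (G : Matrix ι ι convLaurent) :
    (convLaurentVec ι).map (nablaFormal G) =
      (LinearMap.range (nablaConv G)).map (convIncl ι) := by
  rw [← map_convIncl_top, ← Submodule.map_top (nablaConv G), ← Submodule.map_comp,
    ← Submodule.map_comp]
  exact congrArg (fun f => Submodule.map f ⊤)
    (LinearMap.ext fun v => (convIncl_nablaConv G v).symm)

theorem relLength_range_nablaConv (G : Matrix ι ι convLaurent) :
    relLength (W := ι → convLaurent) ⊤ (LinearMap.range (nablaConv G)) =
      relLength (convLaurentVec ι) ((convLaurentVec ι).map (nablaFormal G)) := by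
  have h := relLength_map (W := ι → convLaurent) (convIncl_injective (ι := ι)) ⊤
    (LinearMap.range (nablaConv G))
  rw [map_convIncl_top, ← map_nablaFormal] at h
  exact h.symm

theorem finite_of_length_eq {M : Type*} [AddCommGroup M] [Module ℂ M] {d : ℕ}
    (h : Module.length ℂ M = d) : Module.Finite ℂ M ∧ Module.finrank ℂ M = d := by
  have h1 : IsFiniteLength ℂ M :=
    Module.length_ne_top_iff.mp (h ▸ ENat.natCast_ne_top d)
  have : IsNoetherian ℂ M := (isFiniteLength_iff_isNoetherian_isArtinian.mp h1).1
  have hf : Module.Finite ℂ M := inferInstance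
  exact ⟨hf, by exact_mod_cast (Module.length_eq_finrank ℂ M).symm.trans h⟩

theorem hasIndex_of_injective {W : Type*} [AddCommGroup W] [Module ℂ W] {T : W →ₗ[ℂ] W}
    (hT : Function.Injective T) {d : ℕ} (h : relLength ⊤ (LinearMap.range T) = d) :
    HasIndex T ∧ index T = -(d : ℤ) := by
  rw [relLength_top_left] at h
  obtain ⟨hf, hd⟩ := finite_of_length_eq h
  have hk : Subsingleton (LinearMap.ker T) := by
    rw [LinearMap.ker_eq_bot.mpr hT]
    infer_instance
  refine ⟨⟨inferInstance, hf⟩, ?_⟩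
  rw [index, Module.finrank_zero_of_subsingleton, hd]
  simp

variable [DecidableEq ι] {s : ℕ+} {X Y : Matrix ι ι (LaurentSeries ℂ)}
  {a : ι → LaurentSeries ℂ} {p : ι → ℕ}

/-- The irregularity of a module all of whose exponential factors are ramified of positive
`t`-degree `pᵢ`, `z = t ^ s`, is `∑ pᵢ / s`. -/
theorem IsDiagonalization.irregularity {G : Matrix ι ι convLaurent}
    (h : IsDiagonalization s (thetaMatrix G) X Y a p) :
    HasIrregularity G ∧ (s : ℕ) * HTL.irregularity G = ((∑ i, p i : ℕ) : ℤ) := by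
  obtain ⟨m, hm⟩ := exists_forall_mem_ordGE fun q : ι × ι => thetaMatrix G q.1 q.2
  -- The first summand makes z^e times the matrix holomorphic; the second ensures p i ≤ s e for all
  -- i.
  obtain ⟨e, he⟩ : ∃ e : ℕ, e = (-m).toNat + ∑ i, p i := ⟨_, rfl⟩
  have hH : ∀ i j, thetaMatrix G i j ∈ ordGE (-e) := fun i j =>
    ordGE_anti (by omega) (hm (i, j))
  have hp : ∀ i, p i ≤ s * e := fun i => by
    have h1 : p i ≤ ∑ i, p i := Finset.single_le_sum (fun _ _ => Nat.zero_le _) (Finset.mem_univ i)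
    exact (h1.trans (by omega)).trans (Nat.le_mul_of_pos_left e s.pos)
  set T := latticeOp 1 e 0 (thetaMatrix G) with hTdef
  have hT : Function.Bijective T := h.latticeOp_bijective e 0
  have hTn : ∀ v, T v = shift (e + 1) (nablaFormal G v) := fun v => by
    rw [← shift_shift, shift_nablaFormal]; rfl
  -- T is z^(e+1) times the derivation, which is thus bijective on formal vectors; the formal index
  -- is 0.
  have hnabla : Function.Bijective (nablaFormal G) := by
    have h1 : Function.Bijective (shift (ι := ι) (e + 1) ∘ nablaFormal G) := by
      rwa [show shift (ι := ι) (e + 1) ∘ nablaFormal G = T from funext fun v => (hTn v).symm]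
    exact (Function.Bijective.of_comp_iff' (shift_bijective _) _).mp h1
  have hconvinj : Function.Injective (nablaConv G) := fun v w hvw => by
    refine convIncl_injective (hnabla.1 ?_)
    rw [← convIncl_nablaConv, ← convIncl_nablaConv, hvw]
  -- comparison of the cokernel with that of `T`
  have hVnabla : (convLaurentVec ι).map (nablaFormal G) ≤ convLaurentVec ι := by
    rw [map_nablaFormal, ← map_convIncl_top]
    exact Submodule.map_mono le_top
  have hVT : (convLaurentVec ι).map T =
      ((convLaurentVec ι).map (nablaFormal G)).map (shift (e + 1)) := by
    rw [← Submodule.map_comp]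
    exact congrArg (fun f => Submodule.map f _) (LinearMap.ext hTn)
  have hVs : (convLaurentVec ι).map (shift (e + 1)) = convLaurentVec ι :=
    map_eq_of_forall_mem_iff (shift_bijective _).2 (shift_mem_convLaurentVec _)
  have hcoker : relLength (convLaurentVec ι) ((convLaurentVec ι).map T) =
      relLength (W := ι → convLaurent) ⊤ (LinearMap.range (nablaConv G)) := by
    rw [relLength_range_nablaConv, hVT, ← relLength_map (shift_bijective (ι := ι) (e + 1)).1
      (convLaurentVec ι) ((convLaurentVec ι).map (nablaFormal G)), hVs]
  -- the convergent lattice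
  have hHc : ∀ i j, HahnSeries.single (e : ℤ) 1 * thetaMatrix G i j ∈ convLaurent := fun i j =>
    mul_mem (single_mem_convLaurent _ _) (mul_mem (single_mem_convLaurent _ _) (G i j).2)
  have hHo : ∀ i j, HahnSeries.single (e : ℤ) 1 * thetaMatrix G i j ∈ ordGE 0 := fun i j => by
    have := (mul_mem_ordGE_iff
      (HahnSeries.orderTop_single (one_ne_zero (α := ℂ)) (a := (e : ℤ)))).mpr
      (hH i j)
    rwa [add_neg_cancel] at this
  choose A hA using fun i j => exists_ofPowerSeries_eq (hHo i j)
  have hTA := ofPowerSeriesVec_psOp (A := Matrix.of A) hA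
  have hps : Function.Injective (psOp e (Matrix.of A)) := fun u v huv => by
    refine ofPowerSeriesVec_injective (hT.1 ?_)
    rw [hTdef, ← hTA, ← hTA, huv]
  have hL : relLength (convLaurentVec ι ⊓ ordGEPi fun _ => 0)
      ((convLaurentVec ι ⊓ ordGEPi fun _ => 0).map T) = ((Fintype.card ι * e : ℕ) : ℕ∞) := by
    rw [← relLength_convVec (A := Matrix.of A)
      (fun i j => convPowerSeries_of_ofPowerSeries (by
        rw [Matrix.of_apply, hA]; exact hHc i j)) hps,
      ← relLength_map ofPowerSeriesVec_injective, ← Submodule.map_comp, map_convVec,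
      show (ofPowerSeriesVec ι).comp (psOp e (Matrix.of A)) = T.comp (ofPowerSeriesVec ι) from
        LinearMap.ext hTA, Submodule.map_comp, map_convVec]
  have hVle : (convLaurentVec ι).map T ≤ convLaurentVec ι := by
    rw [hVT]
    conv_rhs => rw [← hVs]
    exact Submodule.map_mono hVnabla
  -- The colength n e on ℂ{z}^n is the colength d on convergent Laurent vectors plus the colength d'
  -- on formal power series vectors. Finiteness of d and d' follows as well.
  have hsum := relLength_inf_map hT hVle (shift_systemOp_mem (thetaCoeff 1 0) hH)
    convLaurentVec_sup
  have hform := h.mul_relLength_latticeOp hH hp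
  change _ = _ + relLength (ordGEPi fun _ => 0) ((ordGEPi fun _ => 0).map T) at hsum
  rw [hL] at hsum
  obtain ⟨d, hd⟩ := ENat.ne_top_iff_exists.mp
    (ne_top_of_le_ne_top (ENat.natCast_ne_top _) (le_self_add.trans hsum.ge))
  obtain ⟨d', hd'⟩ := ENat.ne_top_iff_exists.mp
    (ne_top_of_le_ne_top (ENat.natCast_ne_top _) (le_add_self.trans hsum.ge))
  rw [← hd, ← hd'] at hsum
  rw [← hTdef, ← hd'] at hform
  have hsum' : Fintype.card ι * e = d + d' := by exact_mod_cast hsum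
  have hform' : (s : ℕ) * d' = ∑ i, (s * e - p i) := by exact_mod_cast hform
  obtain ⟨hi1, hi2⟩ := hasIndex_of_injective (W := ι → convLaurent) hconvinj
    (hcoker.symm.trans hd.symm)
  obtain ⟨hi3, hi4⟩ := hasIndex_of_injective hnabla.1 (d := 0) (by
    rw [LinearMap.range_eq_top.mpr hnabla.2, Nat.cast_zero, relLength_self])
  refine ⟨⟨hi3, hi1⟩, ?_⟩
  rw [HTL.irregularity, hi2, hi4]
  -- Hence s d' + ∑ p i = s (d + d'), and s d' cancels.
  have h5 : ∑ i, (s * e - p i) + ∑ i, p i = s * (Fintype.card ι * e) := by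
    rw [← Finset.sum_add_distrib, Finset.sum_congr rfl fun i _ => Nat.sub_add_cancel (hp i)]
    simp
    ring
  rw [← hform', hsum'] at h5
  have h6 : ((s : ℕ) : ℤ) * d' + ((∑ i, p i : ℕ) : ℤ) = (s : ℕ) * (d + d') := by exact_mod_cast h5
  simp only [Nat.cast_zero, neg_zero]
  linarith

end Irregularity


/-! ### From Puiseux series to Laurent series in `t = z ^ (1 / s)` -/

section Descent

open scoped Kronecker

theorem coeff_ramify_eq_iff {s : ℕ+} {f g : HahnSeries ℚ ℂ}
    (hf : ∀ e, f.coeff e ≠ 0 → ∃ n : ℤ, e = (n : ℚ) / (s : ℕ))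
    (hg : ∀ e, g.coeff e ≠ 0 → ∃ n : ℤ, e = (n : ℚ) / (s : ℕ))
    (h : ∀ n : ℤ, f.coeff ((n : ℚ) / (s : ℕ)) = g.coeff ((n : ℚ) / (s : ℕ))) : f = g := by
  ext e
  by_cases hn : ∃ n : ℤ, e = (n : ℚ) / (s : ℕ)
  · obtain ⟨n, rfl⟩ := hn
    exact h n
  · rw [not_not.mp (mt (hf e) hn), not_not.mp (mt (hg e) hn)]

theorem ramify_injective (s : ℕ+) : Function.Injective (ramify s) := fun f g h => by
  ext n
  rw [← ramify_coeff s, h, ramify_coeff]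

theorem ramify_mul_dilate (s u : ℕ+) (f : LaurentSeries ℂ) :
    ramify (s * u) (dilate u f) = ramify s f := by
  have hs : ((s : ℕ) : ℚ) ≠ 0 := by exact_mod_cast s.ne_zero
  have hu : ((u : ℕ) : ℚ) ≠ 0 := by exact_mod_cast u.ne_zero
  refine coeff_ramify_eq_iff (s := s * u) (fun _ => exists_of_ramify_coeff_ne_zero _ _) ?_ ?_
  · intro e he
    obtain ⟨n, rfl⟩ := exists_of_ramify_coeff_ne_zero _ _ he
    exact ⟨n * (u : ℕ), by push_cast; field_simp⟩
  · intro n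
    rw [ramify_coeff]
    by_cases h : ((u : ℕ) : ℤ) ∣ n
    · obtain ⟨k, rfl⟩ := h
      rw [dilate_coeff, ← ramify_coeff s]
      congr 1
      push_cast
      field_simp
    · rw [dilate_coeff_of_not_dvd _ _ h]
      by_contra hne
      obtain ⟨k, hk⟩ := exists_of_ramify_coeff_ne_zero s f (Ne.symm hne)
      refine h ⟨k, ?_⟩
      push_cast at hk
      field_simp at hk
      exact_mod_cast hk

theorem exists_ramify_eq {s : ℕ+} {f : HahnSeries ℚ ℂ}
    (hf : ∀ e, f.coeff e ≠ 0 → ∃ n : ℤ, e = (n : ℚ) / (s : ℕ)) : ∃ g, ramify s g = f := by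
  have hs : (0 : ℚ) < ((s : ℕ) : ℚ) := by exact_mod_cast s.pos
  let g : LaurentSeries ℂ := HahnSeries.ofSuppBddBelow (fun n => f.coeff ((n : ℚ) / (s : ℕ)))
    ⟨⌊f.order * (s : ℕ)⌋, fun n hn => by
      have h := HahnSeries.order_le_of_coeff_ne_zero hn
      rw [le_div_iff₀ hs] at h
      exact_mod_cast (Int.floor_le _).trans h⟩
  refine ⟨g, coeff_ramify_eq_iff (fun _ => exists_of_ramify_coeff_ne_zero _ _) hf fun n => ?_⟩
  rw [ramify_coeff]
  rfl

theorem exists_ramify_eq_of_dvd {s s' : ℕ+} (h : s ∣ s') (g : LaurentSeries ℂ) :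
    ∃ g', ramify s' g' = ramify s g := by
  obtain ⟨u, rfl⟩ := h
  exact ⟨_, ramify_mul_dilate s u g⟩

theorem exists_common_ramify {α : Type*} [Finite α] (f : α → Puiseux) :
    ∃ s : ℕ+, ∀ s', s ∣ s' → ∀ a, ∃ g, ramify s' g = (f a : HahnSeries ℚ ℂ) := by
  have := Fintype.ofFinite α
  choose s hs using fun a => (f a).2
  refine ⟨∏ a, s a, fun s' hs' a => ?_⟩
  obtain ⟨g, hg⟩ := exists_ramify_eq (hs a)
  rw [← hg]
  exact exists_ramify_eq_of_dvd ((Finset.dvd_prod_of_mem s (Finset.mem_univ a)).trans hs') g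

theorem ramify_single (s : ℕ+) (n : ℤ) (c : ℂ) :
    ramify s (HahnSeries.single n c) = HahnSeries.single ((n : ℚ) / (s : ℕ)) c := by
  exact HahnSeries.embDomain_single (f := ⟨⟨fun n : ℤ => (n : ℚ) / (s : ℕ), _⟩, _⟩)

theorem toPuiseux_coe (s : ℕ+) (f : LaurentSeries ℂ) :
    (toPuiseux f : HahnSeries ℚ ℂ) = ramify s (dilate s f) := by
  have := ramify_mul_dilate 1 s f
  rw [one_mul] at this
  exact this.symm

/-- The monodromy `t ↦ e ^ (2πi / s) t`. -/
noncomputable def rotate (s : ℕ+) : LaurentSeries ℂ →ₗ[ℂ] LaurentSeries ℂ :=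
  coeffMul fun n => Complex.exp (2 * Real.pi * Complex.I * ((n / (s : ℕ) : ℚ) : ℂ))

theorem xi_ramify (s : ℕ+) (f : LaurentSeries ℂ) : xi (ramify s f) = ramify s (rotate s f) := by
  refine coeff_ramify_eq_iff (s := s) (fun e he => ?_)
    (fun _ => exists_of_ramify_coeff_ne_zero _ _) fun n => ?_
  · exact exists_of_ramify_coeff_ne_zero s f (right_ne_zero_of_mul he)
  · rw [ramify_coeff]
    change _ * (ramify s f).coeff _ = _
    rw [ramify_coeff]
    rfl

theorem iterate_xi_ramify (s : ℕ+) (f : LaurentSeries ℂ) (k : ℕ) :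
    xi^[k] (ramify s f) = ramify s ((rotate s)^[k] f) := by
  induction k with
  | zero => rfl
  | succ k ih => rw [Function.iterate_succ_apply', Function.iterate_succ_apply', ih, xi_ramify]

theorem coe_iterate_xiP (q : Puiseux) (k : ℕ) :
    ((xiP^[k] q : Puiseux) : HahnSeries ℚ ℂ) = xi^[k] (q : HahnSeries ℚ ℂ) := by
  induction k with
  | zero => rfl
  | succ k ih => rw [Function.iterate_succ_apply', Function.iterate_succ_apply', ← ih]; rfl

/-- The factor z turns d/dz into the Euler derivation, which acts on t^n by n/s and preserves the
exponents. -/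
theorem coe_ddzP {s : ℕ+} {x : Puiseux} {f : LaurentSeries ℂ} (h : ramify s f = x) :
    zpow 1 * (ddzP x : HahnSeries ℚ ℂ) = ramify s (coeffMul (thetaCoeff s 0) f) := by
  have e1 : zpow 1 * (ddzP x : HahnSeries ℚ ℂ) = zpow 1 * (zpow (-1) *
      { coeff := fun e => (e : ℂ) * (x : HahnSeries ℚ ℂ).coeff e
        isPWO_support' := (x : HahnSeries ℚ ℂ).isPWO_support.mono fun e he h => he (by
          simp only [h, mul_zero]) }) := rfl
  rw [e1, ← mul_assoc, zpow, zpow, HahnSeries.single_mul_single, add_neg_cancel, one_mul,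
    HahnSeries.single_zero_one, one_mul]
  refine coeff_ramify_eq_iff (s := s) (fun e he => ?_)
    (fun _ => exists_of_ramify_coeff_ne_zero _ _) fun n => ?_
  · rw [← h] at he
    exact exists_of_ramify_coeff_ne_zero s f (right_ne_zero_of_mul he)
  · rw [ramify_coeff, coeffMul_coeff]
    simp only
    rw [← h, ramify_coeff]
    simp [thetaCoeff]

theorem map_coeffMul_mul {ι : Type*} [Fintype ι] {s : ℕ+} (X Y : Matrix ι ι (LaurentSeries ℂ)) :
    (X * Y).map (coeffMul (thetaCoeff s 0)) =
      X.map (coeffMul (thetaCoeff s 0)) * Y + X * Y.map (coeffMul (thetaCoeff s 0)) := by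
  have hc : ∀ i j : ℤ, thetaCoeff s 0 (i + j) = thetaCoeff s 0 i + thetaCoeff s 0 j := by
    intro i j
    simp only [thetaCoeff]
    push_cast
    ring
  ext1 i j
  simp only [Matrix.map_apply, Matrix.mul_apply, map_sum, coeffMul_mul hc, Matrix.add_apply,
    Finset.sum_add_distrib]

variable {ι κ : Type*} [Fintype ι] [DecidableEq ι] [Fintype κ] [DecidableEq κ]

/-- `X` transforms the system with matrix `H`, pulled back to `t = z ^ (1 / s)`, to diagonal
form. -/
structure Diagonalizes (s : ℕ+) (H X Y : Matrix ι ι (LaurentSeries ℂ))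
    (a : ι → LaurentSeries ℂ) : Prop where
  mul_eq_one : X * Y = 1
  eq : Matrix.diagonal a * X = X * H.map (dilate s) + X.map (coeffMul (thetaCoeff s 0))

/-- The entries of X and X⁻¹ have a common denominator of exponents, and the gauge equation
multiplied by z becomes an equation over ℂ((t)). Allowing every multiple of s₀ lets two modules
share one s. -/
theorem exists_diagonalizes {G : Matrix ι ι convLaurent} {E : ι → Puiseux}
    (h : IsPuiseuxMatrixOf G (Matrix.diagonal fun k => E k * ⟨zpow (-1), zpow_mem (-1)⟩)) :
    ∃ s₀ : ℕ+, ∀ s, s₀ ∣ s → ∀ a : ι → LaurentSeries ℂ, (∀ k, ramify s (a k) = E k) →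
      ∃ X Y, Diagonalizes s (thetaMatrix G) X Y a := by
  obtain ⟨X, hX⟩ := h
  obtain ⟨s₁, h1⟩ := exists_common_ramify fun q : ι × ι => X.1 q.1 q.2
  obtain ⟨s₂, h2⟩ := exists_common_ramify fun q : ι × ι => X⁻¹.1 q.1 q.2
  refine ⟨s₁ * s₂, fun s hs a ha => ?_⟩
  choose Xt hXt using h1 s ((Dvd.intro _ rfl).trans hs)
  choose Yt hYt using h2 s ((Dvd.intro_left _ rfl).trans hs)
  refine ⟨Matrix.of fun i j => Xt (i, j), Matrix.of fun i j => Yt (i, j), ?_, ?_⟩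
  · have e1 : X.1 * X⁻¹.1 = 1 := X.mul_inv
    ext1 i j
    refine ramify_injective s ?_
    have e2 := congrFun (congrFun e1 i) j
    rw [Matrix.mul_apply] at e2
    replace e2 := congrArg (fun x : Puiseux => (x : HahnSeries ℚ ℂ)) e2
    simp only [Matrix.mul_apply, Matrix.of_apply, map_sum, map_mul, hXt, hYt]
    push_cast at e2
    rw [e2]
    by_cases hij : i = j
    · subst hij
      rw [Matrix.one_apply_eq, Matrix.one_apply_eq, map_one]
      rfl
    · rw [Matrix.one_apply_ne hij, Matrix.one_apply_ne hij, map_zero]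
      rfl
  · have e1 : Matrix.diagonal (fun k => E k * ⟨zpow (-1), zpow_mem (-1)⟩) * X.1 =
        X.1 * (G.map fun f => toPuiseux (f : LaurentSeries ℂ)) + X.1.map ddzP := by
      have e0 : X⁻¹.1 * X.1 = 1 := X.inv_mul
      rw [hX, add_mul, Matrix.mul_assoc _ _ X.1, Matrix.mul_assoc _ _ X.1, e0, Matrix.mul_one,
        Matrix.mul_one]
    ext1 i j
    refine ramify_injective s ?_
    have e2 := congrFun (congrFun e1 i) j
    rw [Matrix.diagonal_mul, Matrix.add_apply, Matrix.mul_apply] at e2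
    replace e2 := congrArg (fun x : Puiseux => zpow 1 * (x : HahnSeries ℚ ℂ)) e2
    simp only [Matrix.map_apply, mul_add, AddMemClass.coe_add] at e2
    push_cast at e2
    rw [coe_ddzP (hXt (i, j))] at e2
    rw [Matrix.diagonal_mul, Matrix.add_apply, Matrix.mul_apply]
    simp only [Matrix.map_apply, Matrix.of_apply, map_add, map_sum, map_mul, hXt, ha, thetaMatrix,
      dilate_single, ramify_single]
    have hz : zpow 1 * zpow (-1) = 1 := by
      rw [zpow, zpow, HahnSeries.single_mul_single, add_neg_cancel, one_mul,
        HahnSeries.single_zero_one]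
    have e3 : zpow 1 * ((E i : HahnSeries ℚ ℂ) * zpow (-1) * (X.1 i j : HahnSeries ℚ ℂ)) =
        E i * X.1 i j := by
      linear_combination ((E i : HahnSeries ℚ ℂ) * X.1 i j) * hz
    rw [← e3, e2, Finset.mul_sum]
    congr 1
    refine Finset.sum_congr rfl fun k _ => ?_
    rw [toPuiseux_coe s, mul_one, Int.cast_natCast, div_self (by exact_mod_cast s.ne_zero)]
    change zpow 1 * _ = _ * (zpow 1 * _)
    ring

/-- Obtained by differentiating X Y = 1. -/
theorem Diagonalizes.map_inv {s : ℕ+} {H X Y : Matrix ι ι (LaurentSeries ℂ)}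
    {a : ι → LaurentSeries ℂ} (h : Diagonalizes s H X Y a) :
    Y.map (coeffMul (thetaCoeff s 0)) = H.map (dilate s) * Y - Y * Matrix.diagonal a := by
  have hYX : Y * X = 1 := mul_eq_one_comm.mp h.mul_eq_one
  have h1 : (1 : Matrix ι ι (LaurentSeries ℂ)).map (coeffMul (thetaCoeff s 0)) = 0 := by
    ext1 i j
    by_cases hij : i = j
    · subst hij
      ext n
      by_cases hn : n = 0
      · simp [hn, thetaCoeff]
      · simp [HahnSeries.coeff_one, hn]
    · simp [Matrix.one_apply_ne hij]
  have h2 := map_coeffMul_mul (s := s) X Y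
  rw [h.mul_eq_one, h1] at h2
  have h3 : X.map (coeffMul (thetaCoeff s 0)) =
      Matrix.diagonal a * X - X * H.map (dilate s) := by
    rw [h.eq]; abel
  have h4 : X * Y.map (coeffMul (thetaCoeff s 0)) =
      X * H.map (dilate s) * Y - Matrix.diagonal a := by
    have := eq_neg_of_add_eq_zero_right h2.symm
    rw [this, h3, sub_mul, Matrix.mul_assoc (Matrix.diagonal a), h.mul_eq_one, Matrix.mul_one]
    abel
  calc _ = Y * (X * Y.map (coeffMul (thetaCoeff s 0))) := by
        rw [← Matrix.mul_assoc, hYX, Matrix.one_mul]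
    _ = _ := by
        rw [h4, Matrix.mul_sub, ← Matrix.mul_assoc, ← Matrix.mul_assoc, hYX, Matrix.one_mul]

/-- In the new bases a homomorphism φ becomes X' φ Y, that is, X' ⊗ Yᵀ applied to φ. The source
contributes through the dual, so its exponents enter with a minus sign. -/
theorem Diagonalizes.hom {s : ℕ+} {G : Matrix ι ι convLaurent} {G' : Matrix κ κ convLaurent}
    {X Y : Matrix ι ι (LaurentSeries ℂ)} {X' Y' : Matrix κ κ (LaurentSeries ℂ)}
    {a : ι → LaurentSeries ℂ} {a' : κ → LaurentSeries ℂ}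
    (h : Diagonalizes s (thetaMatrix G) X Y a) (h' : Diagonalizes s (thetaMatrix G') X' Y' a') :
    Diagonalizes s (thetaMatrix (homMatrix G G')) (X' ⊗ₖ Y.transpose) (Y' ⊗ₖ X.transpose)
      (fun c => a' c.1 - a c.2) := by
  have hc : ∀ i j : ℤ, thetaCoeff s 0 (i + j) = thetaCoeff s 0 i + thetaCoeff s 0 j := by
    intro i j
    simp only [thetaCoeff]
    push_cast
    ring
  have hYX : Y.transpose * X.transpose = 1 := by
    rw [← Matrix.transpose_mul, h.mul_eq_one, Matrix.transpose_one]
  constructor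
  · rw [← Matrix.mul_kronecker_mul, h'.mul_eq_one, hYX, Matrix.one_kronecker_one]
  · have e1 : (thetaMatrix (homMatrix G G')).map (dilate s) =
        (thetaMatrix G').map (dilate s) ⊗ₖ 1 - 1 ⊗ₖ ((thetaMatrix G).map (dilate s)).transpose := by
      ext1 ⟨i, i'⟩ ⟨j, j'⟩
      simp only [thetaMatrix, homMatrix, Matrix.map_apply, Matrix.add_apply, Matrix.sub_apply,
        Matrix.kronecker_apply, Matrix.one_apply, Matrix.neg_apply, Matrix.transpose_apply]
      split_ifs <;> simp [sub_eq_add_neg, mul_add] <;> ring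
    have e2 : Matrix.diagonal (fun c : κ × ι => a' c.1 - a c.2) =
        Matrix.diagonal a' ⊗ₖ (1 : Matrix ι ι (LaurentSeries ℂ)) - 1 ⊗ₖ Matrix.diagonal a := by
      ext1 ⟨i, i'⟩ ⟨j, j'⟩
      by_cases h1 : i = j <;> by_cases h2 : i' = j' <;> simp [h1, h2]
    have e3 : (X' ⊗ₖ Y.transpose).map (coeffMul (thetaCoeff s 0)) =
        X'.map (coeffMul (thetaCoeff s 0)) ⊗ₖ Y.transpose +
          X' ⊗ₖ (Y.map (coeffMul (thetaCoeff s 0))).transpose := by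
      ext1 ⟨i, i'⟩ ⟨j, j'⟩
      simp [coeffMul_mul hc]
    have e4 : X'.map (coeffMul (thetaCoeff s 0)) =
        Matrix.diagonal a' * X' - X' * (thetaMatrix G').map (dilate s) := by
      rw [h'.eq]; abel
    rw [e1, e2, e3, e4, h.map_inv, sub_mul, mul_sub, ← Matrix.mul_kronecker_mul,
      ← Matrix.mul_kronecker_mul, ← Matrix.mul_kronecker_mul, ← Matrix.mul_kronecker_mul,
      Matrix.one_mul, Matrix.one_mul, Matrix.mul_one, Matrix.mul_one, Matrix.transpose_sub,
      Matrix.transpose_mul, Matrix.transpose_mul, Matrix.diagonal_transpose]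
    ext1 ⟨i, i'⟩ ⟨j, j'⟩
    simp only [Matrix.sub_apply, Matrix.add_apply, Matrix.kronecker_apply]
    ring

end Descent


/-! ### Colength of ideals generated by two elements -/

section Colength

variable (k : Type*) {A : Type*} [CommRing k] [CommRing A] [Algebra k A]

/-- The length over `k` of `A / (u, v)`. -/
noncomputable def pairLength (u v : A) : ℕ∞ := Module.length k (A ⧸ Ideal.span {u, v})

theorem pairLength_comm (u v : A) : pairLength k u v = pairLength k v u := by
  rw [pairLength, pairLength, Set.pair_comm]

theorem pairLength_eq_relLength (u v : A) :
    pairLength k u v = relLength ⊤ ((Ideal.span {u, v}).restrictScalars k) := by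
  rw [relLength_top_left]
  exact (LinearEquiv.length_eq (Submodule.Quotient.restrictScalarsEquiv k _)).symm

theorem pairLength_congr {u u' v v' : A} (h : Ideal.span {u, v} = Ideal.span {u', v'}) :
    pairLength k u v = pairLength k u' v' := by rw [pairLength, pairLength, h]

theorem pairLength_eq_zero {u v : A} (hv : IsUnit v) : pairLength k u v = 0 := by
  have : Ideal.span {u, v} = ⊤ :=
    Ideal.eq_top_of_isUnit_mem _ (Ideal.subset_span (Set.mem_insert_of_mem _ rfl)) hv
  rw [pairLength, Module.length_eq_zero_iff, this]
  exact Submodule.Quotient.subsingleton_iff.mpr rfl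

variable [IsDomain A]

/-- The sequence 0 → A/(u,w) → A/(u,vw) → A/(u,v) → 0, whose first map is multiplication by v. It is
injective because u is a nonzerodivisor modulo v. -/
theorem pairLength_mul {u v w : A} (hv0 : v ≠ 0) (hv : ∀ c, v ∣ u * c → v ∣ c) :
    pairLength k u (v * w) = pairLength k u v + pairLength k u w := by
  have h1 : Ideal.span {u, v * w} ≤ Ideal.span {u, v} := by
    rw [Ideal.span_le]
    rintro x (rfl | rfl)
    · exact Ideal.subset_span (Set.mem_insert _ _)
    · exact Ideal.mul_mem_right _ _ (Ideal.subset_span (Set.mem_insert_of_mem _ rfl))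
  have h2 := relLength_add (R := k) (le_top (a := (Ideal.span {u, v}).restrictScalars k))
    (C := (Ideal.span {u, v * w}).restrictScalars k) h1
  rw [← pairLength_eq_relLength, ← pairLength_eq_relLength] at h2
  have hinj : Function.Injective (LinearMap.mulLeft k v) := fun _ _ h => mul_left_cancel₀ hv0 h
  have e1 : (Ideal.span {u, v}).restrictScalars k =
      (⊤ : Submodule k A).map (LinearMap.mulLeft k v) ⊔
        (Ideal.span {u, v * w}).restrictScalars k := by
    refine le_antisymm (fun x hx => ?_) (sup_le ?_ h1)
    · obtain ⟨a, b, rfl⟩ := Ideal.mem_span_pair.mp hx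
      rw [add_comm]
      refine Submodule.add_mem_sup ⟨b, trivial, mul_comm _ _⟩ ?_
      exact Ideal.mul_mem_left _ _ (Ideal.subset_span (Set.mem_insert _ _))
    · rintro _ ⟨b, -, rfl⟩
      exact Ideal.mul_mem_right _ _ (Ideal.subset_span (Set.mem_insert_of_mem _ rfl))
  have e2 : (⊤ : Submodule k A).map (LinearMap.mulLeft k v) ⊓
      (Ideal.span {u, v * w}).restrictScalars k =
      ((Ideal.span {u, w}).restrictScalars k).map (LinearMap.mulLeft k v) := by
    ext x
    constructor
    · rintro ⟨⟨y, -, rfl⟩, hy⟩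
      obtain ⟨a, b, hab⟩ := Ideal.mem_span_pair.mp hy
      rw [LinearMap.mulLeft_apply] at hab
      obtain ⟨a', rfl⟩ := hv a ⟨y - b * w, by linear_combination hab⟩
      refine ⟨y, Ideal.mem_span_pair.mpr ⟨a', b, mul_left_cancel₀ hv0 ?_⟩, rfl⟩
      linear_combination hab
    · rintro ⟨y, hy, rfl⟩
      refine ⟨⟨y, trivial, rfl⟩, ?_⟩
      obtain ⟨a, b, rfl⟩ := Ideal.mem_span_pair.mp hy
      exact Ideal.mem_span_pair.mpr ⟨v * a, b, by rw [LinearMap.mulLeft_apply]; ring⟩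
  rw [h2, e1, relLength_sup, e2, relLength_map hinj, ← pairLength_eq_relLength, add_comm]

theorem pairLength_prod {α : Type*} (s : Finset α) {u : A} {v : α → A} (hv0 : ∀ l ∈ s, v l ≠ 0)
    (hv : ∀ l ∈ s, ∀ c, v l ∣ u * c → v l ∣ c) :
    pairLength k u (∏ l ∈ s, v l) = ∑ l ∈ s, pairLength k u (v l) := by
  classical
  induction s using Finset.induction_on with
  | empty => rw [Finset.prod_empty, Finset.sum_empty, pairLength_eq_zero k isUnit_one]
  | insert a s ha ih =>
    rw [Finset.prod_insert ha, Finset.sum_insert ha, pairLength_mul k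
      (hv0 a (Finset.mem_insert_self _ _)) (hv a (Finset.mem_insert_self _ _)),
      ih (fun l hl => hv0 l (Finset.mem_insert_of_mem hl))
        (fun l hl => hv l (Finset.mem_insert_of_mem hl))]

theorem pairLength_pow {u t : A} (ht0 : t ≠ 0) (ht : ∀ c, t ∣ u * c → t ∣ c) (e : ℕ) :
    pairLength k u (t ^ e) = e * pairLength k u t := by
  have := pairLength_prod k (Finset.range e) (u := u) (v := fun _ => t) (fun _ _ => ht0)
    (fun _ _ => ht)
  simpa using this

/-- Exchange in a regular sequence: if v is a nonzerodivisor modulo t, then t and its powers are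
nonzerodivisors modulo v. -/
theorem dvd_of_dvd_pow_mul {v t : A} (ht0 : t ≠ 0) (ht : ∀ c, t ∣ v * c → t ∣ c) (e : ℕ) {c : A}
    (h : v ∣ t ^ e * c) : v ∣ c := by
  induction e with
  | zero => simpa using h
  | succ e ih =>
    obtain ⟨d, hd⟩ := h
    obtain ⟨d', rfl⟩ := ht d ⟨t ^ e * c, by rw [← hd]; ring⟩
    exact ih ⟨d', mul_left_cancel₀ ht0 (by linear_combination hd)⟩

/-- For one pair of factors the ideal is (u, t^e), as the difference is t^e times a unit, and its
length is e. Additivity in both products reduces to this case. The coprimality it needs holds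
because a common multiple condition can only fail through powers of t, which are regular modulo each
factor. -/
theorem pairLength_prod_prod {α β : Type*} (S : Finset α) (S' : Finset β) {t : A} (ht0 : t ≠ 0)
    {u : α → A} {v : β → A} (hu0 : ∀ a ∈ S, u a ≠ 0) (hv0 : ∀ b ∈ S', v b ≠ 0)
    (hu : ∀ a ∈ S, ∀ c, t ∣ u a * c → t ∣ c) (hv : ∀ b ∈ S', ∀ c, t ∣ v b * c → t ∣ c)
    (hl : ∀ a ∈ S, pairLength k (u a) t = 1) {e : α → β → ℕ}
    (h : ∀ a ∈ S, ∀ b ∈ S', ∃ w, IsUnit w ∧ u a - v b = t ^ e a b * w) :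
    pairLength k (∏ a ∈ S, u a) (∏ b ∈ S', v b) = ∑ a ∈ S, ∑ b ∈ S', (e a b : ℕ∞) := by
  have h1 : ∀ a ∈ S, ∀ b ∈ S', pairLength k (u a) (v b) = e a b := by
    intro a ha b hb
    obtain ⟨w, ⟨w, rfl⟩, hw⟩ := h a ha b hb
    have e1 : Ideal.span {u a, v b} = Ideal.span {u a, t ^ e a b} := by
      refine le_antisymm ?_ ?_ <;> rw [Ideal.span_le] <;> rintro x (rfl | rfl)
      · exact Ideal.subset_span (Set.mem_insert _ _)
      · exact Ideal.mem_span_pair.mpr ⟨1, -w, by linear_combination hw⟩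
      · exact Ideal.subset_span (Set.mem_insert _ _)
      · refine Ideal.mem_span_pair.mpr ⟨↑w⁻¹, -↑w⁻¹, ?_⟩
        linear_combination (w⁻¹ : Aˣ) * hw + t ^ e a b * w.inv_mul
    rw [pairLength_congr k e1, pairLength_pow k ht0 (hu a ha), hl a ha, mul_one]
  have h2 : ∀ a ∈ S, ∀ b ∈ S', ∀ c, v b ∣ u a * c → v b ∣ c := by
    intro a ha b hb c hc
    obtain ⟨w, hw, he⟩ := h a ha b hb
    have h3 : v b ∣ t ^ e a b * (c * w) := by
      have : t ^ e a b * (c * w) = u a * c - v b * c := by linear_combination -c * he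
      rw [this]
      exact dvd_sub hc (dvd_mul_right _ _)
    exact hw.dvd_mul_right.mp (dvd_of_dvd_pow_mul ht0 (hv b hb) _ h3)
  have h2' : ∀ a ∈ S, ∀ b ∈ S', ∀ c, u a ∣ v b * c → u a ∣ c := by
    intro a ha b hb c hc
    obtain ⟨w, hw, he⟩ := h a ha b hb
    have h3 : u a ∣ t ^ e a b * (c * w) := by
      have : t ^ e a b * (c * w) = u a * c - v b * c := by linear_combination -c * he
      rw [this]
      exact dvd_sub (dvd_mul_right _ _) hc
    exact hw.dvd_mul_right.mp (dvd_of_dvd_pow_mul ht0 (hu a ha) _ h3)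
  have h4 : ∀ a ∈ S, ∀ S'' ⊆ S', ∀ c, u a ∣ (∏ b ∈ S'', v b) * c → u a ∣ c := by
    classical
    intro a ha S''
    induction S'' using Finset.induction_on with
    | empty => simp
    | insert b S'' hb ih =>
      intro hs c hc
      rw [Finset.prod_insert hb, mul_assoc] at hc
      exact ih ((Finset.subset_insert _ _).trans hs) c
        (h2' a ha b (hs (Finset.mem_insert_self _ _)) _ hc)
  rw [pairLength_comm, pairLength_prod k S hu0 fun a ha => h4 a ha S' subset_rfl]
  refine Finset.sum_congr rfl fun a ha => ?_
  rw [pairLength_comm, pairLength_prod k S' hv0 fun b hb => h2 a ha b hb]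
  exact Finset.sum_congr rfl fun b hb => h1 a ha b hb

end Colength


/-! ### Convergent power series in two variables -/

section TwoVariables

/-- The exponent of `z ^ a * ζ ^ b`. -/
noncomputable def biexp (a b : ℕ) : Fin 2 →₀ ℕ := Finsupp.single 0 a + Finsupp.single 1 b

@[simp] theorem biexp_zero (a b : ℕ) : biexp a b 0 = a := by simp [biexp]

@[simp] theorem biexp_one (a b : ℕ) : biexp a b 1 = b := by simp [biexp]

theorem biexp_eta (d : Fin 2 →₀ ℕ) : biexp (d 0) (d 1) = d := by
  ext i
  fin_cases i
  · exact biexp_zero _ _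
  · exact biexp_one _ _

theorem ext_biexp {d d' : Fin 2 →₀ ℕ} (h0 : d 0 = d' 0) (h1 : d 1 = d' 1) : d = d' := by
  rw [← biexp_eta d, ← biexp_eta d', h0, h1]

theorem X_mem_convPowerSeries₂ (i : Fin 2) :
    (MvPowerSeries.X i : MvPowerSeries (Fin 2) ℂ) ∈ convPowerSeries₂ := by
  classical
  refine ⟨1, one_pos, summable_of_ne_finset_zero (s := {Finsupp.single i 1}) fun n hn => ?_⟩
  have : n ≠ Finsupp.single i 1 := by simpa using hn
  simp [MvPowerSeries.coeff_X, this]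

/-- The variables of `ℂ{z, ζ}`. -/
noncomputable def convVar (i : Fin 2) : convPowerSeries₂ :=
  ⟨MvPowerSeries.X i, X_mem_convPowerSeries₂ i⟩

instance : IsDomain convPowerSeries₂ :=
  have : IsDomain (MvPowerSeries (Fin 2) ℂ) := NoZeroDivisors.to_isDomain _
  Function.Injective.isDomain convPowerSeries₂.val.toRingHom Subtype.val_injective

theorem convVar_ne_zero (i : Fin 2) : convVar i ≠ 0 := fun h => by
  have h1 := congrArg (fun x : convPowerSeries₂ =>
    MvPowerSeries.coeff (Finsupp.single i 1) (x : MvPowerSeries (Fin 2) ℂ)) h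
  change MvPowerSeries.coeff _ (MvPowerSeries.X i : MvPowerSeries (Fin 2) ℂ) = 0 at h1
  rw [MvPowerSeries.coeff_index_single_self_X] at h1
  exact one_ne_zero h1

theorem exists_shift (i : Fin 2) (x : convPowerSeries₂) : ∃ y : convPowerSeries₂, ∀ d,
    MvPowerSeries.coeff d (y : MvPowerSeries (Fin 2) ℂ) =
      MvPowerSeries.coeff (d + Finsupp.single i 1) (x : MvPowerSeries (Fin 2) ℂ) := by
  obtain ⟨ρ, hρ, hs⟩ := x.2
  refine ⟨⟨fun d => MvPowerSeries.coeff (d + Finsupp.single i 1) (x : MvPowerSeries (Fin 2) ℂ),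
    ρ, hρ, ?_⟩, fun d => rfl⟩
  refine ((hs.comp_injective (add_left_injective (Finsupp.single i 1))).mul_left ρ⁻¹).congr
    fun (d : Fin 2 →₀ ℕ) => ?_
  have h1 : (d + Finsupp.single i 1 : Fin 2 →₀ ℕ) 0 + (d + Finsupp.single i 1 : Fin 2 →₀ ℕ) 1 =
      d 0 + d 1 + 1 := by
    fin_cases i <;> simp <;> omega
  have h2 : MvPowerSeries.coeff d (fun d => MvPowerSeries.coeff (d + Finsupp.single i 1)
    (x : MvPowerSeries (Fin 2) ℂ)) = MvPowerSeries.coeff (d + Finsupp.single i 1)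
    (x : MvPowerSeries (Fin 2) ℂ) := rfl
  rw [Function.comp_apply, h1, h2, pow_succ]
  field_simp

/-- The formal quotient by a variable is a shift of coefficients, and it converges when x does. -/
theorem convVar_dvd_iff {i : Fin 2} {x : convPowerSeries₂} : convVar i ∣ x ↔
    ∀ d, d i = 0 → MvPowerSeries.coeff d (x : MvPowerSeries (Fin 2) ℂ) = 0 := by
  constructor
  · rintro ⟨y, rfl⟩
    exact MvPowerSeries.X_dvd_iff.mp ⟨y, rfl⟩
  · intro h
    obtain ⟨y, hy⟩ := exists_shift i x
    refine ⟨y, Subtype.ext ?_⟩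
    obtain ⟨w, hw⟩ := MvPowerSeries.X_dvd_iff.mpr h
    have : (y : MvPowerSeries (Fin 2) ℂ) = w := by
      ext d
      rw [hy, hw, add_comm, MvPowerSeries.X, MvPowerSeries.coeff_add_monomial_mul, one_mul]
    change _ = MvPowerSeries.X i * _
    rw [hw, this]

theorem mem_span_convVar_iff {x : convPowerSeries₂} :
    x ∈ Ideal.span {convVar 1, convVar 0} ↔
      MvPowerSeries.constantCoeff (x : MvPowerSeries (Fin 2) ℂ) = 0 := by
  constructor
  · intro h
    obtain ⟨a, b, rfl⟩ := Ideal.mem_span_pair.mp h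
    change MvPowerSeries.constantCoeff ((a : MvPowerSeries (Fin 2) ℂ) * MvPowerSeries.X 1 +
      (b : MvPowerSeries (Fin 2) ℂ) * MvPowerSeries.X 0) = 0
    simp
  · intro h
    obtain ⟨y, hy⟩ := exists_shift 0 x
    have h1 : convVar 1 ∣ x - convVar 0 * y := by
      refine convVar_dvd_iff.mpr fun d hd => ?_
      change MvPowerSeries.coeff d ((x : MvPowerSeries (Fin 2) ℂ) - MvPowerSeries.X 0 *
        (y : MvPowerSeries (Fin 2) ℂ)) = 0
      rw [map_sub, sub_eq_zero]
      by_cases h0 : d 0 = 0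
      · have : d = 0 := ext_biexp h0 hd
        subst this
        rw [MvPowerSeries.coeff_zero_eq_constantCoeff, h]
        simp
      · have : d = Finsupp.single 0 1 + biexp (d 0 - 1) 0 := by
          refine ext_biexp ?_ ?_
          · simp; omega
          · simp [hd]
        rw [this, MvPowerSeries.X, MvPowerSeries.coeff_add_monomial_mul, one_mul, hy, add_comm]
    obtain ⟨w, hw⟩ := h1
    exact Ideal.mem_span_pair.mpr ⟨w, y, by linear_combination -hw⟩

theorem pairLength_convVar : pairLength ℂ (convVar 1) (convVar 0) = 1 := by
  let f : convPowerSeries₂ →ₗ[ℂ] ℂ :=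
    { toFun := fun x => MvPowerSeries.constantCoeff (x : MvPowerSeries (Fin 2) ℂ)
      map_add' := fun x y => map_add _ _ _
      map_smul' := fun c x => MvPowerSeries.constantCoeff_smul _ _ }
  have hf : (⊤ : Submodule ℂ convPowerSeries₂).map f = ⊤ := by
    refine eq_top_iff.mpr fun c _ => ⟨algebraMap ℂ _ c, trivial, ?_⟩
    change MvPowerSeries.constantCoeff (algebraMap ℂ (MvPowerSeries (Fin 2) ℂ) c) = c
    simp [MvPowerSeries.algebraMap_apply]
  have e : (Ideal.span {convVar 1, convVar 0}).restrictScalars ℂ = ⊤ ⊓ LinearMap.ker f := by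
    ext x
    rw [top_inf_eq]
    exact mem_span_convVar_iff
  rw [pairLength_eq_relLength, e, relLength_inf_ker hf, Module.length_eq_finrank]
  simp

/-- The inclusion `ℂ[[z]] ⊆ ℂ[[z, ζ]]`. -/
noncomputable def constSeries : PowerSeries ℂ →ₐ[ℂ] MvPowerSeries (Fin 2) ℂ :=
  MvPowerSeries.rename (⟨fun _ : Unit => (0 : Fin 2), fun _ _ _ => rfl⟩ : Unit ↪ Fin 2)

theorem coeff_constSeries (f : PowerSeries ℂ) (d : Fin 2 →₀ ℕ) :
    MvPowerSeries.coeff d (constSeries f) =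
      if d 1 = 0 then PowerSeries.coeff (d 0) f else 0 := by
  split_ifs with h
  · have : d = Finsupp.embDomain (⟨fun _ : Unit => (0 : Fin 2), fun _ _ _ => rfl⟩ : Unit ↪ Fin 2)
        (Finsupp.single () (d 0)) := by
      rw [Finsupp.embDomain_single]
      refine ext_biexp ?_ ?_
      · exact (Finsupp.single_eq_same (a := (0 : Fin 2))).symm
      · rw [h]
        exact (Finsupp.single_eq_of_ne (a := (0 : Fin 2)) one_ne_zero).symm
    conv_lhs => rw [this]
    exact MvPowerSeries.coeff_embDomain_rename _ _ _
  · refine MvPowerSeries.coeff_rename_eq_zero _ _ ?_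
    rintro ⟨x, rfl⟩
    refine h ?_
    refine Finsupp.mapDomain_of_notMem_range _ _ ?_
    rintro ⟨_, h0⟩
    exact zero_ne_one h0

theorem constSeries_mem {f : PowerSeries ℂ} (hf : f ∈ convPowerSeries) :
    constSeries f ∈ convPowerSeries₂ := by
  obtain ⟨ρ, hρ, hs⟩ := hf
  refine ⟨ρ, hρ, ?_⟩
  have hinj : Function.Injective fun n : ℕ => biexp n 0 := fun a b h => by
    simpa using congrArg (fun d : Fin 2 →₀ ℕ => d 0) h
  refine (hinj.summable_iff fun d hd => ?_).mp (hs.congr fun n => ?_)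
  · rw [coeff_constSeries, if_neg, norm_zero, zero_mul]
    intro h
    exact hd ⟨d 0, ext_biexp (by simp) (by simp [h])⟩
  · simp [coeff_constSeries]

/-- The inclusion `ℂ{z} ⊆ ℂ{z, ζ}`. -/
noncomputable def convConst : convPowerSeries →ₐ[ℂ] convPowerSeries₂ :=
  (constSeries.comp convPowerSeries.val).codRestrict convPowerSeries₂ fun f => constSeries_mem f.2

theorem coeff_convConst (f : convPowerSeries) (d : Fin 2 →₀ ℕ) :
    MvPowerSeries.coeff d (convConst f : MvPowerSeries (Fin 2) ℂ) =
      if d 1 = 0 then PowerSeries.coeff (d 0) (f : PowerSeries ℂ) else 0 :=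
  coeff_constSeries _ _

theorem convVar_zero_dvd_convConst {f : convPowerSeries}
    (hf : PowerSeries.constantCoeff (f : PowerSeries ℂ) = 0) : convVar 0 ∣ convConst f := by
  refine convVar_dvd_iff.mpr fun d hd => ?_
  rw [coeff_convConst, hd, PowerSeries.coeff_zero_eq_constantCoeff, hf, ite_self]

/-- Modulo the first variable ζ - f is ζ, which is a nonzerodivisor there. -/
theorem convVar_zero_dvd_of_dvd_sub_mul {f : convPowerSeries}
    (hf : PowerSeries.constantCoeff (f : PowerSeries ℂ) = 0) {c : convPowerSeries₂}
    (h : convVar 0 ∣ (convVar 1 - convConst f) * c) : convVar 0 ∣ c := by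
  have h1 : convVar 0 ∣ convVar 1 * c := by
    have : convVar 1 * c = (convVar 1 - convConst f) * c + convConst f * c := by ring
    rw [this]
    exact dvd_add h ((convVar_zero_dvd_convConst hf).mul_right c)
  refine convVar_dvd_iff.mpr fun d hd => ?_
  have h2 := convVar_dvd_iff.mp h1 (Finsupp.single 1 1 + d) (by simp [hd])
  change MvPowerSeries.coeff _ (MvPowerSeries.X 1 * (c : MvPowerSeries (Fin 2) ℂ)) = 0 at h2
  rwa [MvPowerSeries.X, MvPowerSeries.coeff_add_monomial_mul, one_mul] at h2

theorem convVar_sub_convConst_ne_zero (f : convPowerSeries) : convVar 1 - convConst f ≠ 0 := by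
  intro h
  have h1 := congrArg (fun x : convPowerSeries₂ =>
    MvPowerSeries.coeff (Finsupp.single 1 1) (x : MvPowerSeries (Fin 2) ℂ)) h
  change MvPowerSeries.coeff _ ((MvPowerSeries.X 1 : MvPowerSeries (Fin 2) ℂ) -
    (convConst f : MvPowerSeries (Fin 2) ℂ)) = 0
    at h1
  rw [map_sub, coeff_convConst, MvPowerSeries.coeff_index_single_self_X] at h1
  simp at h1

/-- As f is divisible by the first variable, the ideal is the maximal ideal. -/
theorem pairLength_convVar_sub_convConst {f : convPowerSeries}
    (hf : PowerSeries.constantCoeff (f : PowerSeries ℂ) = 0) :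
    pairLength ℂ (convVar 1 - convConst f) (convVar 0) = 1 := by
  obtain ⟨w, hw⟩ := convVar_zero_dvd_convConst hf
  rw [← pairLength_convVar]
  refine pairLength_congr ℂ (le_antisymm ?_ ?_) <;> rw [Ideal.span_le] <;> rintro x (rfl | rfl)
  · exact Ideal.mem_span_pair.mpr ⟨1, -w, by linear_combination hw⟩
  · exact Ideal.subset_span (Set.mem_insert_of_mem _ rfl)
  · exact Ideal.mem_span_pair.mpr ⟨1, w, by linear_combination -hw⟩
  · exact Ideal.subset_span (Set.mem_insert_of_mem _ rfl)

/-- Two smooth branches ζ = α and ζ = β meet with multiplicity ord(α - β); over unions of branches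
the multiplicities add up. -/
theorem pairLength_prod_branches {r r' : ℕ} {α β : ℕ → convPowerSeries} {e : ℕ → ℕ → ℕ}
    (hα : ∀ k, PowerSeries.constantCoeff (α k : PowerSeries ℂ) = 0)
    (hβ : ∀ k, PowerSeries.constantCoeff (β k : PowerSeries ℂ) = 0)
    (h : ∀ k < r, ∀ l < r', ∃ w : convPowerSeries, IsUnit w ∧
      ((α k - β l : convPowerSeries) : PowerSeries ℂ) =
        PowerSeries.X ^ e k l * (w : PowerSeries ℂ)) :
    pairLength ℂ (∏ k ∈ Finset.range r, (convVar 1 - convConst (α k)))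
      (∏ l ∈ Finset.range r', (convVar 1 - convConst (β l))) =
      ((∑ k ∈ Finset.range r, ∑ l ∈ Finset.range r', e k l : ℕ) : ℕ∞) := by
  push_cast
  refine pairLength_prod_prod ℂ _ _ (convVar_ne_zero 0) (e := e)
    (fun _ _ => convVar_sub_convConst_ne_zero _) (fun _ _ => convVar_sub_convConst_ne_zero _)
    (fun k _ c => convVar_zero_dvd_of_dvd_sub_mul (hα k))
    (fun k _ c => convVar_zero_dvd_of_dvd_sub_mul (hβ k))
    (fun k _ => pairLength_convVar_sub_convConst (hα k)) fun k hk l hl => ?_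
  obtain ⟨w, hw, he⟩ := h k (Finset.mem_range.mp hk) l (Finset.mem_range.mp hl)
  -- The sign arises from (ζ - α) - (ζ - β) = -(α - β).
  refine ⟨-convConst w, (hw.map convConst).neg, Subtype.ext ?_⟩
  have h1 := congrArg constSeries he
  have hX : constSeries PowerSeries.X = MvPowerSeries.X 0 := MvPowerSeries.rename_X _ _
  rw [map_mul, map_pow, hX, AddSubgroupClass.coe_sub, map_sub] at h1
  change MvPowerSeries.X 1 - constSeries (α k) - (MvPowerSeries.X 1 - constSeries (β l)) =
    MvPowerSeries.X 0 ^ e k l * -constSeries w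
  linear_combination -h1

end TwoVariables


/-! ### The substitution `z = t ^ s` in convergent power series in two variables -/

section Dilation₂

theorem exists_summable_le_one (x : convPowerSeries₂) : ∃ ρ : ℝ, 0 < ρ ∧ ρ ≤ 1 ∧
    Summable fun d : Fin 2 →₀ ℕ =>
      ‖MvPowerSeries.coeff d (x : MvPowerSeries (Fin 2) ℂ)‖ * ρ ^ (d 0 + d 1) := by
  obtain ⟨ρ, hρ, hs⟩ := x.2
  exact ⟨min ρ 1, lt_min hρ one_pos, min_le_right _ _,
    summable_shrink (fun d : Fin 2 →₀ ℕ => d 0 + d 1) (lt_min hρ one_pos) (min_le_left _ _) hs⟩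

theorem component₂_mem (s : ℕ+) (k : ℕ) (x : convPowerSeries₂) :
    (fun d => MvPowerSeries.coeff (biexp (s * d 0 + k) (d 1)) (x : MvPowerSeries (Fin 2) ℂ) :
      MvPowerSeries (Fin 2) ℂ) ∈ convPowerSeries₂ := by
  obtain ⟨ρ, hρ, hρ1, hs⟩ := exists_summable_le_one x
  -- The monomial z^a ζ^b comes from t^(sa+k) ζ^b, so z needs the radius ρ^s; for ζ this radius is
  -- only smaller, since ρ ≤ 1.
  refine ⟨ρ ^ (s : ℕ), pow_pos hρ _, ?_⟩
  have hinj : Function.Injective fun d : Fin 2 →₀ ℕ => biexp (s * d 0 + k) (d 1) := by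
    intro d d' h
    have h0 : (s : ℕ) * d 0 + k = s * d' 0 + k := by
      simpa using congrArg (fun d : Fin 2 →₀ ℕ => d 0) h
    refine ext_biexp (Nat.eq_of_mul_eq_mul_left s.pos (Nat.add_right_cancel h0)) ?_
    simpa using congrArg (fun d : Fin 2 →₀ ℕ => d 1) h
  refine ((hs.comp_injective hinj).mul_left (ρ ^ k)⁻¹).of_nonneg_of_le
    (fun _ => by positivity) fun (d : Fin 2 →₀ ℕ) => ?_
  simp only [Function.comp_apply, biexp_zero, biexp_one]
  have h1 : (ρ ^ (s : ℕ)) ^ (d 0 + d 1) ≤ (ρ ^ k)⁻¹ * ρ ^ (s * d 0 + k + d 1) := by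
    rw [← pow_mul, show (s : ℕ) * d 0 + k + d 1 = k + (s * d 0 + d 1) by ring, pow_add ρ k,
      inv_mul_cancel_left₀ (pow_pos hρ k).ne']
    refine pow_le_pow_of_le_one hρ.le hρ1 ?_
    rw [mul_add]
    exact Nat.add_le_add_left (Nat.le_mul_of_pos_left _ s.pos) _
  calc _ ≤ ‖MvPowerSeries.coeff (biexp (s * d 0 + k) (d 1)) (x : MvPowerSeries (Fin 2) ℂ)‖ *
        ((ρ ^ k)⁻¹ * ρ ^ (s * d 0 + k + d 1)) := mul_le_mul_of_nonneg_left h1 (norm_nonneg _)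
    _ = _ := by ring

/-- The component `∑ x_{sa+k, b} z ^ a ζ ^ b` of `∑ x_{a, b} t ^ a ζ ^ b`. -/
noncomputable def component₂ (s : ℕ+) (k : ℕ) : convPowerSeries₂ →ₗ[ℂ] convPowerSeries₂ where
  toFun x := ⟨_, component₂_mem s k x⟩
  map_add' _ _ := rfl
  map_smul' _ _ := rfl

theorem coeff_component₂ (s : ℕ+) (k : ℕ) (x : convPowerSeries₂) (d : Fin 2 →₀ ℕ) :
    MvPowerSeries.coeff d (component₂ s k x : MvPowerSeries (Fin 2) ℂ) =
      MvPowerSeries.coeff (biexp (s * d 0 + k) (d 1)) (x : MvPowerSeries (Fin 2) ℂ) := rfl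

theorem dilate₂_mem (s : ℕ+) (x : convPowerSeries₂) :
    (fun d => if (s : ℕ) ∣ d 0 then
      MvPowerSeries.coeff (biexp (d 0 / s) (d 1)) (x : MvPowerSeries (Fin 2) ℂ) else 0 :
      MvPowerSeries (Fin 2) ℂ) ∈ convPowerSeries₂ := by
  obtain ⟨ρ, hρ, hρ1, hs⟩ := exists_summable_le_one x
  refine ⟨ρ, hρ, ?_⟩
  have hinj : Function.Injective fun d : Fin 2 →₀ ℕ => biexp (s * d 0) (d 1) := by
    intro d d' h
    have h0 : (s : ℕ) * d 0 = s * d' 0 := by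
      simpa using congrArg (fun d : Fin 2 →₀ ℕ => d 0) h
    refine ext_biexp (Nat.eq_of_mul_eq_mul_left s.pos h0) ?_
    simpa using congrArg (fun d : Fin 2 →₀ ℕ => d 1) h
  refine (hinj.summable_iff fun d hd => ?_).mp
    (hs.of_nonneg_of_le (fun _ => ?_) fun (d : Fin 2 →₀ ℕ) => ?_)
  · have : ¬ (s : ℕ) ∣ d 0 := fun ⟨a, ha⟩ => hd ⟨biexp a (d 1), by simp [← ha, biexp_eta]⟩
    have h1 : MvPowerSeries.coeff d (fun d => if (s : ℕ) ∣ d 0 then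
      MvPowerSeries.coeff (biexp (d 0 / s) (d 1)) (x : MvPowerSeries (Fin 2) ℂ) else 0 :
      MvPowerSeries (Fin 2) ℂ) = 0 := if_neg this
    rw [h1, norm_zero, zero_mul]
  · exact mul_nonneg (norm_nonneg _) (pow_nonneg hρ.le _)
  · have h1 : MvPowerSeries.coeff (biexp (s * d 0) (d 1)) (fun d => if (s : ℕ) ∣ d 0 then
        MvPowerSeries.coeff (biexp (d 0 / s) (d 1)) (x : MvPowerSeries (Fin 2) ℂ) else 0 :
        MvPowerSeries (Fin 2) ℂ) = MvPowerSeries.coeff d (x : MvPowerSeries (Fin 2) ℂ) := by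
      refine (if_pos ?_).trans ?_
      · simp
      · simp [Nat.mul_div_cancel_left _ s.pos, biexp_eta]
    rw [Function.comp_apply, h1, biexp_zero, biexp_one]
    refine mul_le_mul_of_nonneg_left (pow_le_pow_of_le_one hρ.le hρ1 ?_) (norm_nonneg _)
    exact Nat.add_le_add_right (Nat.le_mul_of_pos_left _ s.pos) _

/-- The series `f(t ^ s, ζ)`. -/
noncomputable def dilate₂ (s : ℕ+) (x : convPowerSeries₂) : convPowerSeries₂ :=
  ⟨_, dilate₂_mem s x⟩

theorem coeff_dilate₂ (s : ℕ+) (x : convPowerSeries₂) (d : Fin 2 →₀ ℕ) :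
    MvPowerSeries.coeff d (dilate₂ s x : MvPowerSeries (Fin 2) ℂ) =
      if (s : ℕ) ∣ d 0 then
        MvPowerSeries.coeff (biexp (d 0 / s) (d 1)) (x : MvPowerSeries (Fin 2) ℂ) else 0 := rfl

theorem coeff_dilate₂_biexp (s : ℕ+) (x : convPowerSeries₂) (a b : ℕ) :
    MvPowerSeries.coeff (biexp (s * a) b) (dilate₂ s x : MvPowerSeries (Fin 2) ℂ) =
      MvPowerSeries.coeff (biexp a b) (x : MvPowerSeries (Fin 2) ℂ) := by
  rw [coeff_dilate₂, biexp_zero, biexp_one, if_pos (dvd_mul_right _ _),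
    Nat.mul_div_cancel_left _ s.pos]

/-- Linearity of the components over ℂ{z,ζ}: multiplication by f(t^s, ζ) keeps the t-exponent modulo
s. -/
theorem component₂_dilate₂_mul {s : ℕ+} (k : Fin s) (f x : convPowerSeries₂) :
    component₂ s k (dilate₂ s f * x) = f * component₂ s k x := by
  classical
  refine Subtype.ext (MvPowerSeries.ext fun n => ?_)
  rw [coeff_component₂]
  change MvPowerSeries.coeff _ ((dilate₂ s f : MvPowerSeries (Fin 2) ℂ) *
    (x : MvPowerSeries (Fin 2) ℂ)) = MvPowerSeries.coeff n ((f : MvPowerSeries (Fin 2) ℂ) *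
      (component₂ s k x : MvPowerSeries (Fin 2) ℂ))
  rw [MvPowerSeries.coeff_mul, MvPowerSeries.coeff_mul]
  symm
  refine Finset.sum_bij_ne_zero
    (fun p _ _ => (biexp (s * p.1 0) (p.1 1), biexp (s * p.2 0 + k) (p.2 1))) ?_ ?_ ?_ ?_
  · intro p hp _
    rw [Finset.HasAntidiagonal.mem_antidiagonal] at hp ⊢
    rw [← hp]
    refine ext_biexp ?_ ?_ <;> simp
    ring
  · rintro p _ _ p' _ _ h
    rw [Prod.mk.injEq] at h
    have e (d d' : Fin 2 →₀ ℕ) (i : Fin 2) (h : d = d') : d i = d' i := h ▸ rfl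
    have h10 := e _ _ 0 h.1
    have h11 := e _ _ 1 h.1
    have h20 := e _ _ 0 h.2
    have h21 := e _ _ 1 h.2
    simp only [biexp_zero, biexp_one] at h10 h11 h20 h21
    exact Prod.ext (ext_biexp (Nat.eq_of_mul_eq_mul_left s.pos h10) h11)
      (ext_biexp (Nat.eq_of_mul_eq_mul_left s.pos (Nat.add_right_cancel h20)) h21)
  · rintro ⟨c, d⟩ hp hne
    rw [Finset.HasAntidiagonal.mem_antidiagonal] at hp
    simp only at hp hne
    have hp0 : c 0 + d 0 = s * n 0 + k := by
      rw [← Finsupp.add_apply, hp, biexp_zero]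
    have hp1 : c 1 + d 1 = n 1 := by
      rw [← Finsupp.add_apply, hp, biexp_one]
    have hc : (s : ℕ) ∣ c 0 := by
      by_contra hc
      exact hne (by rw [coeff_dilate₂, if_neg hc, zero_mul])
    obtain ⟨i, hi⟩ := hc
    -- Here k < s is needed: i > n 0 would give s i ≥ s n 0 + s, beyond the total degree s n 0 + k
    -- in t.
    have hin : i ≤ n 0 := by
      by_contra hlt
      have h1 := Nat.mul_le_mul_left (s : ℕ) (not_le.mp hlt)
      have h2 := k.2
      rw [Nat.mul_succ] at h1
      omega
    have h3 : (s : ℕ) * n 0 = s * i + s * (n 0 - i) := by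
      rw [← mul_add, Nat.add_sub_cancel' hin]
    have ec : biexp (s * i) (c 1) = c := by rw [← hi, biexp_eta]
    have ed : biexp (s * (n 0 - i) + k) (d 1) = d := by
      rw [show (s : ℕ) * (n 0 - i) + k = d 0 by omega, biexp_eta]
    refine ⟨(biexp i (c 1), biexp (n 0 - i) (d 1)), ?_, ?_, ?_⟩
    · rw [Finset.HasAntidiagonal.mem_antidiagonal]
      refine ext_biexp ?_ ?_
      · simp only [Finsupp.add_apply, biexp_zero]; omega
      · simp only [Finsupp.add_apply, biexp_one]; omega
    · simp only
      rwa [← coeff_dilate₂_biexp s, coeff_component₂, biexp_zero, biexp_one, ec, ed]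
    · simp only [biexp_zero, biexp_one, ec, ed]
  · intro p _ _
    rw [coeff_dilate₂_biexp, biexp_eta, coeff_component₂]

theorem dilate₂_eq_component_zero {s : ℕ+} {x : convPowerSeries₂}
    (h : ∀ d : Fin 2 →₀ ℕ, ¬ (s : ℕ) ∣ d 0 →
      MvPowerSeries.coeff d (x : MvPowerSeries (Fin 2) ℂ) = 0) :
    dilate₂ s (component₂ s 0 x) = x := by
  refine Subtype.ext (MvPowerSeries.ext fun d => ?_)
  rw [coeff_dilate₂]
  split_ifs with hd
  · rw [coeff_component₂, biexp_zero, biexp_one, Nat.mul_div_cancel' hd, add_zero, biexp_eta]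
  · exact (h d hd).symm

theorem component₂_convVar_pow (s : ℕ+) (j k : Fin s) :
    component₂ s k (convVar 0 ^ (j : ℕ)) = if j = k then 1 else 0 := by
  refine Subtype.ext (MvPowerSeries.ext fun d => ?_)
  rw [coeff_component₂]
  classical
  change MvPowerSeries.coeff _ ((MvPowerSeries.X 0 : MvPowerSeries (Fin 2) ℂ) ^ (j : ℕ)) = _
  have h1 : biexp (s * d 0 + k) (d 1) = Finsupp.single 0 (j : ℕ) ↔ j = k ∧ d = 0 := by
    constructor
    · intro h
      have e0 : (s : ℕ) * d 0 + k = j := by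
        simpa using congrArg (fun d : Fin 2 →₀ ℕ => d 0) h
      have e1 : d 1 = 0 := by simpa using congrArg (fun d : Fin 2 →₀ ℕ => d 1) h
      have e2 : d 0 = 0 := by
        by_contra hd
        have := Nat.le_mul_of_pos_right (s : ℕ) (Nat.pos_of_ne_zero hd)
        have := j.2
        omega
      rw [e2, mul_zero, zero_add] at e0
      exact ⟨Fin.ext e0.symm, ext_biexp e2 e1⟩
    · rintro ⟨rfl, rfl⟩
      simp [biexp]
  rw [MvPowerSeries.coeff_X_pow]
  simp only [h1]
  by_cases hjk : j = k
  · rw [if_pos hjk]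
    change _ = MvPowerSeries.coeff d (1 : MvPowerSeries (Fin 2) ℂ)
    simp [hjk, MvPowerSeries.coeff_one]
  · rw [if_neg hjk, if_neg fun h => hjk h.1]
    rfl

theorem ext_component₂ {s : ℕ+} {x y : convPowerSeries₂}
    (h : ∀ k : Fin s, component₂ s k x = component₂ s k y) : x = y := by
  refine Subtype.ext (MvPowerSeries.ext fun d => ?_)
  have h1 := congrArg (fun x : convPowerSeries₂ => MvPowerSeries.coeff
    (biexp (d 0 / s) (d 1)) (x : MvPowerSeries (Fin 2) ℂ)) (h ⟨d 0 % s, Nat.mod_lt _ s.pos⟩)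
  simpa only [coeff_component₂, biexp_zero, biexp_one, Nat.div_add_mod, biexp_eta] using h1

/-- The decomposition `ℂ{t, ζ} = ⨁ t ^ k ℂ{z, ζ}`, where `z = t ^ s`. -/
noncomputable def components₂ (s : ℕ+) : convPowerSeries₂ →ₗ[ℂ] (Fin s → convPowerSeries₂) :=
  LinearMap.pi fun k => component₂ s k

theorem components₂_bijective (s : ℕ+) : Function.Bijective (components₂ s) := by
  refine ⟨fun x y h => ext_component₂ (congrFun h), fun u => ?_⟩
  refine ⟨∑ j, dilate₂ s (u j) * convVar 0 ^ (j : ℕ), funext fun k => ?_⟩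
  change component₂ s k _ = _
  simp [map_sum, component₂_dilate₂_mul, component₂_convVar_pow]

/-- ℂ{t,ζ} is free over ℂ{z,ζ} on 1, t, …, t^(s-1). In this basis the extended ideal consists of the
vectors with all s components in the original ideal, and so does the quotient split. -/
theorem pairLength_dilate₂ (s : ℕ+) (f g : convPowerSeries₂) :
    pairLength ℂ (dilate₂ s f) (dilate₂ s g) = (s : ℕ) * pairLength ℂ f g := by
  have e : (Ideal.span {dilate₂ s f, dilate₂ s g}).restrictScalars ℂ =
      (Submodule.pi Set.univ fun _ => (Ideal.span {f, g}).restrictScalars ℂ).comap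
        (components₂ s) := by
    ext x
    simp only [Submodule.mem_comap, Submodule.mem_pi, Set.mem_univ, true_imp_iff,
      Submodule.restrictScalars_mem]
    constructor
    · intro hx k
      obtain ⟨a, b, rfl⟩ := Ideal.mem_span_pair.mp hx
      refine Ideal.mem_span_pair.mpr ⟨component₂ s k a, component₂ s k b, ?_⟩
      change _ = component₂ s k _
      rw [mul_comm a, mul_comm b, map_add, component₂_dilate₂_mul, component₂_dilate₂_mul,
        mul_comm f, mul_comm g]
    · intro hx
      choose a b hab using fun k => Ideal.mem_span_pair.mp (hx k)
      obtain ⟨a', ha'⟩ := (components₂_bijective s).2 a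
      obtain ⟨b', hb'⟩ := (components₂_bijective s).2 b
      refine Ideal.mem_span_pair.mpr ⟨a', b', ext_component₂ (s := s) fun k => ?_⟩
      have h1 : component₂ s k a' = a k := congrFun ha' k
      have h2 : component₂ s k b' = b k := congrFun hb' k
      rw [mul_comm a', mul_comm b', map_add, component₂_dilate₂_mul, component₂_dilate₂_mul,
        h1, h2, mul_comm f, mul_comm g]
      exact hab k
  have e' : (⊤ : Submodule ℂ convPowerSeries₂) =
      (Submodule.pi Set.univ fun _ : Fin s => (⊤ : Submodule ℂ convPowerSeries₂)).comap
        (components₂ s) := by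
    ext x
    simp
  rw [pairLength_eq_relLength, e, e', relLength_comap (components₂_bijective s), relLength_pi,
    ← pairLength_eq_relLength]
  simp

end Dilation₂


/-! ### Closure properties of convergent Laurent series -/

section Closure

/-- The recursion for the coefficients of 1/f gives, by strong induction, a bound at the shrunken
radius θρ; one more halving makes the series summable. -/
theorem inv_mem_convPowerSeries {f : PowerSeries ℂ} (hf : f ∈ convPowerSeries)
    (h0 : PowerSeries.constantCoeff f ≠ 0) : f⁻¹ ∈ convPowerSeries := by
  obtain ⟨ρ, hρ, hs⟩ := hf
  let S := ∑' n : ℕ, ‖PowerSeries.coeff n f‖ * ρ ^ n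
  have hS : 0 ≤ S := tsum_nonneg fun n => by positivity
  let c := ‖PowerSeries.constantCoeff f‖
  have hc : 0 < c := norm_pos_iff.mpr h0
  -- Chosen so that θ ≤ 1 and θ S ≤ c, which closes the induction with the constant c⁻¹.
  let θ := c / (c + S)
  have hθ : 0 < θ := by positivity
  have hθ1 : θ ≤ 1 := (div_le_one (by positivity)).mpr (by linarith)
  have hθS : θ * S ≤ c := by
    rw [div_mul_eq_mul_div, div_le_iff₀ (by positivity)]
    nlinarith
  have key : ∀ n, ‖PowerSeries.coeff n f⁻¹‖ * (θ * ρ) ^ n ≤ c⁻¹ := by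
    intro n
    induction n using Nat.strong_induction_on with
    | _ n ih =>
    rw [PowerSeries.coeff_inv]
    split_ifs with hn
    · simp [hn, c]
    · have h1 : ∀ x ∈ Finset.HasAntidiagonal.antidiagonal n,
          ‖if x.2 < n then PowerSeries.coeff x.1 f * PowerSeries.coeff x.2 f⁻¹ else 0‖ *
            (θ * ρ) ^ n ≤ θ * c⁻¹ * (‖PowerSeries.coeff x.1 f‖ * ρ ^ x.1) := by
        rintro ⟨a, b⟩ hx
        rw [Finset.HasAntidiagonal.mem_antidiagonal] at hx
        simp only at hx ⊢
        split_ifs with hb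
        -- One factor θ is gained because a ≥ 1, which follows from b < n.
        · have h2 : (θ * ρ) ^ a ≤ θ * ρ ^ a := by
            rw [mul_pow]
            exact mul_le_mul_of_nonneg_right (pow_le_of_le_one hθ.le hθ1 (by omega))
              (by positivity)
          rw [norm_mul, ← hx, pow_add]
          calc _ = (‖PowerSeries.coeff a f‖ * (θ * ρ) ^ a) *
                (‖PowerSeries.coeff b f⁻¹‖ * (θ * ρ) ^ b) := by ring
            _ ≤ (‖PowerSeries.coeff a f‖ * (θ * ρ ^ a)) * c⁻¹ := by
                gcongr
                exact ih b hb
            _ = _ := by ring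
        · rw [norm_zero, zero_mul]
          positivity
      have h2 : ∑ x ∈ Finset.HasAntidiagonal.antidiagonal n,
          ‖PowerSeries.coeff x.1 f‖ * ρ ^ x.1 ≤ S := by
        rw [Finset.Nat.sum_antidiagonal_eq_sum_range_succ_mk]
        exact hs.sum_le_tsum _ fun _ _ => by positivity
      rw [norm_mul, norm_neg, norm_inv, mul_assoc]
      calc c⁻¹ * (‖_‖ * (θ * ρ) ^ n) ≤ c⁻¹ * (θ * c⁻¹ * S) := by
            refine mul_le_mul_of_nonneg_left ?_ (by positivity)
            refine (mul_le_mul_of_nonneg_right (norm_sum_le _ _) (by positivity)).trans ?_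
            rw [Finset.sum_mul]
            refine (Finset.sum_le_sum h1).trans ?_
            rw [← Finset.mul_sum]
            exact mul_le_mul_of_nonneg_left h2 (by positivity)
        _ = c⁻¹ * (c⁻¹ * (θ * S)) := by ring
        _ ≤ c⁻¹ * (c⁻¹ * c) := by gcongr
        _ = c⁻¹ := by rw [inv_mul_cancel₀ hc.ne', mul_one]
  refine ⟨θ * ρ / 2, by positivity, ?_⟩
  refine (summable_geometric_two.mul_left c⁻¹).of_nonneg_of_le (fun _ => by positivity) fun n => ?_
  calc _ = ‖PowerSeries.coeff n f⁻¹‖ * (θ * ρ) ^ n * (1 / 2) ^ n := by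
        rw [mul_assoc, ← mul_pow]; ring
    _ ≤ _ := mul_le_mul_of_nonneg_right (key n) (by positivity)

theorem isUnit_convPowerSeries {f : convPowerSeries}
    (h0 : PowerSeries.constantCoeff (f : PowerSeries ℂ) ≠ 0) : IsUnit f :=
  IsUnit.of_mul_eq_one ⟨_, inv_mem_convPowerSeries f.2 h0⟩
    (Subtype.ext (PowerSeries.mul_inv_cancel _ h0))

/-- A convergent Laurent series of order at least `m` is `z ^ m` times a convergent power
series. -/
theorem exists_convPowerSeries {f : LaurentSeries ℂ} (hf : f ∈ convLaurent) {m : ℤ}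
    (hm : f ∈ ordGE m) : ∃ h ∈ convPowerSeries,
      f = HahnSeries.single m 1 * HahnSeries.ofPowerSeries ℤ ℂ h ∧
      ∀ n : ℕ, PowerSeries.coeff n h = f.coeff (n + m) := by
  have h0 : HahnSeries.single (-m) 1 * f ∈ ordGE 0 := fun j hj => by
    rw [HahnSeries.coeff_single_mul, hm _ (by omega), mul_zero]
  obtain ⟨h, hh⟩ := exists_ofPowerSeries_eq h0
  refine ⟨h, convPowerSeries_of_ofPowerSeries ?_, ?_, fun n => ?_⟩
  · rw [hh]
    exact mul_mem (single_mem_convLaurent _ _) hf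
  · rw [hh, ← mul_assoc, HahnSeries.single_mul_single, add_neg_cancel, one_mul,
      HahnSeries.single_zero_one, one_mul]
  · rw [← HahnSeries.ofPowerSeries_apply_coeff (Γ := ℤ), hh, HahnSeries.coeff_single_mul, one_mul,
      sub_neg_eq_add]

theorem inv_mem_convLaurent {f : LaurentSeries ℂ} (hf : f ∈ convLaurent) :
    f⁻¹ ∈ convLaurent := by
  by_cases h0 : f = 0
  · rw [h0, inv_zero]; exact zero_mem _
  obtain ⟨h, hh, e, hc⟩ := exists_convPowerSeries hf (m := f.order)
    fun j hj => HahnSeries.coeff_eq_zero_of_lt_order hj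
  have h1 : PowerSeries.constantCoeff h ≠ 0 := by
    rw [← PowerSeries.coeff_zero_eq_constantCoeff_apply, hc, Nat.cast_zero, zero_add]
    exact HahnSeries.coeff_order_eq_zero.not.mpr h0
  have h2 : f⁻¹ = HahnSeries.single (-f.order) 1 * HahnSeries.ofPowerSeries ℤ ℂ h⁻¹ := by
    refine inv_eq_of_mul_eq_one_right ?_
    conv_lhs => enter [1]; rw [e]
    rw [mul_mul_mul_comm, HahnSeries.single_mul_single, add_neg_cancel, one_mul, ← map_mul,
      PowerSeries.mul_inv_cancel _ h1, HahnSeries.single_zero_one, map_one, one_mul]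
  rw [h2]
  exact mul_mem (single_mem_convLaurent _ _)
    (ofPowerSeries_mem_convLaurent (inv_mem_convPowerSeries hh h1))

theorem mem_convLaurent_of_norm_le {f g : LaurentSeries ℂ} (hg : g ∈ convLaurent)
    (h : ∀ j, ‖f.coeff j‖ ≤ ‖g.coeff j‖) : f ∈ convLaurent := by
  obtain ⟨m, hm⟩ := exists_mem_ordGE g
  obtain ⟨u, ⟨ρ, hρ, hs⟩, -, hu⟩ := exists_convPowerSeries hg hm
  have h0 : HahnSeries.single (-m) 1 * f ∈ ordGE 0 := fun j hj => by
    rw [HahnSeries.coeff_single_mul, norm_le_zero_iff.mp ((h _).trans_eq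
      (norm_eq_zero.mpr (hm (j - -m) (by omega)))), mul_zero]
  obtain ⟨v, hv⟩ := exists_ofPowerSeries_eq h0
  have hf : f = HahnSeries.single m 1 * HahnSeries.ofPowerSeries ℤ ℂ v := by
    rw [hv, ← mul_assoc, HahnSeries.single_mul_single, add_neg_cancel, one_mul,
      HahnSeries.single_zero_one, one_mul]
  rw [hf]
  refine mul_mem (single_mem_convLaurent _ _) (ofPowerSeries_mem_convLaurent ⟨ρ, hρ, ?_⟩)
  refine hs.of_nonneg_of_le (fun _ => by positivity) fun n => ?_
  refine mul_le_mul_of_nonneg_right ?_ (by positivity)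
  rw [← HahnSeries.ofPowerSeries_apply_coeff (Γ := ℤ), hv, HahnSeries.coeff_single_mul, one_mul,
    sub_neg_eq_add, hu]
  exact h _

theorem dilate_mem_convLaurent (s : ℕ+) {f : LaurentSeries ℂ} (hf : f ∈ convLaurent) :
    dilate s f ∈ convLaurent := by
  obtain ⟨N, h, ⟨ρ, hρ, hs⟩, rfl⟩ := hf
  rw [map_mul, dilate_single]
  refine mul_mem (single_mem_convLaurent _ _) ?_
  obtain ⟨v, hv⟩ := exists_ofPowerSeries_eq (f := dilate s (HahnSeries.ofPowerSeries ℤ ℂ h)) (by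
    simpa using dilate_mem_ordGE s (ofPowerSeries_mem_ordGE h))
  have hc (n : ℕ) : PowerSeries.coeff n v =
      (dilate s (HahnSeries.ofPowerSeries ℤ ℂ h)).coeff n := by
    rw [← hv]; exact (HahnSeries.ofPowerSeries_apply_coeff v n).symm
  rw [← hv]
  refine ofPowerSeries_mem_convLaurent ⟨min ρ 1, lt_min hρ one_pos, ?_⟩
  have hs' := summable_shrink (fun n : ℕ => n) (lt_min hρ one_pos) (min_le_left ρ 1) hs
  have hinj : Function.Injective fun n : ℕ => (s : ℕ) * n :=
    fun _ _ h => Nat.eq_of_mul_eq_mul_left s.pos h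
  refine (hinj.summable_iff fun n hn => ?_).mp
    (hs'.of_nonneg_of_le (fun _ =>
      mul_nonneg (norm_nonneg _) (pow_nonneg (le_min hρ.le zero_le_one) _)) fun n => ?_)
  · rw [hc, dilate_coeff_of_not_dvd, norm_zero, zero_mul]
    rintro ⟨a, ha⟩
    have ha0 : 0 ≤ a := by
      by_contra h
      have h1 : (0 : ℤ) < (s : ℕ) := by exact_mod_cast s.pos
      nlinarith
    obtain ⟨a, rfl⟩ := Int.eq_ofNat_of_zero_le ha0
    exact hn ⟨a, by exact_mod_cast ha.symm⟩
  · have h1 : PowerSeries.coeff (s * n) v = PowerSeries.coeff n h := by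
      rw [hc, Nat.cast_mul, dilate_coeff]
      exact HahnSeries.ofPowerSeries_apply_coeff h n
    rw [Function.comp_apply, h1]
    refine mul_le_mul_of_nonneg_left ?_ (norm_nonneg _)
    exact pow_le_pow_of_le_one (le_min hρ.le zero_le_one) (min_le_right _ _)
      (Nat.le_mul_of_pos_left _ s.pos)

theorem rotate_mem_convLaurent (s : ℕ+) {f : LaurentSeries ℂ} (hf : f ∈ convLaurent) :
    rotate s f ∈ convLaurent := by
  refine mem_convLaurent_of_norm_le hf fun j => ?_
  rw [rotate, coeffMul_coeff, norm_mul]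
  have : ‖Complex.exp (2 * Real.pi * Complex.I * ((j / (s : ℕ) : ℚ) : ℂ))‖ = 1 := by
    rw [Complex.norm_exp]
    simp
  rw [this, one_mul]

theorem iterate_rotate_mem_convLaurent (s : ℕ+) {f : LaurentSeries ℂ} (hf : f ∈ convLaurent)
    (k : ℕ) : (rotate s)^[k] f ∈ convLaurent := by
  induction k with
  | zero => exact hf
  | succ k ih =>
    rw [Function.iterate_succ_apply']
    exact rotate_mem_convLaurent s ih

end Closure

/-! ### The monodromy -/

section Monodromy

/-- The coefficientwise product with a character of `ℚ`. -/
noncomputable def twist (χ : AddChar ℚ ℂ) (f : HahnSeries ℚ ℂ) : HahnSeries ℚ ℂ where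
  coeff e := χ e * f.coeff e
  isPWO_support' := f.isPWO_support.mono fun e he h => he (by simp only [h, mul_zero])

theorem twist_coeff (χ : AddChar ℚ ℂ) (f : HahnSeries ℚ ℂ) (e : ℚ) :
    (twist χ f).coeff e = χ e * f.coeff e := rfl

theorem mem_support_twist {χ : AddChar ℚ ℂ} {f : HahnSeries ℚ ℂ} {e : ℚ} :
    e ∈ (twist χ f).support ↔ e ∈ f.support := by
  have : χ e ≠ 0 := (χ.val_isUnit e).ne_zero
  simp [HahnSeries.mem_support, twist_coeff, this]

/-- The coefficientwise product with a character of `ℚ`, as a ring homomorphism. -/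
noncomputable def twistHom (χ : AddChar ℚ ℂ) : HahnSeries ℚ ℂ →+* HahnSeries ℚ ℂ where
  toFun := twist χ
  map_one' := by
    ext e
    by_cases he : e = 0
    · simp [he, twist_coeff]
    · simp [HahnSeries.coeff_one, he, twist_coeff]
  map_mul' f g := by
    ext n
    rw [twist_coeff, HahnSeries.coeff_mul, HahnSeries.coeff_mul, Finset.mul_sum]
    refine Finset.sum_congr ?_ fun p hp => ?_
    · ext p
      simp only [Finset.mem_antidiagonal, mem_support_twist]
    · rw [← (Finset.mem_antidiagonal.mp hp).2.2, AddChar.map_add_eq_mul, twist_coeff, twist_coeff]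
      ring
  map_zero' := by ext; simp [twist_coeff]
  map_add' f g := by ext; simp [twist_coeff, mul_add]

/-- The character `e ↦ exp (2πi e)`. -/
noncomputable def expChar : AddChar ℚ ℂ where
  toFun e := Complex.exp (2 * Real.pi * Complex.I * (e : ℂ))
  map_zero_eq_one' := by simp
  map_add_eq_mul' a b := by rw [← Complex.exp_add, ← mul_add]; push_cast; rfl

theorem xi_eq_twistHom (f : HahnSeries ℚ ℂ) : xi f = twistHom expChar f := rfl

theorem expChar_eq_one_iff {e : ℚ} : expChar e = 1 ↔ ∃ n : ℤ, e = n := by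
  change Complex.exp _ = 1 ↔ _
  rw [Complex.exp_eq_one_iff]
  refine exists_congr fun n => ?_
  have h : (2 * Real.pi * Complex.I : ℂ) ≠ 0 := Complex.two_pi_I_ne_zero
  rw [mul_comm, mul_left_inj' h]
  exact_mod_cast Iff.rfl

/-- The criterion for descent from t to z: the fixed series of the monodromy are those with integral
exponents. -/
theorem xi_eq_self_iff {f : HahnSeries ℚ ℂ} :
    xi f = f ↔ ∀ e, f.coeff e ≠ 0 → ∃ n : ℤ, e = n := by
  rw [HahnSeries.ext_iff, funext_iff]
  refine forall_congr' fun e => ?_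
  rw [← expChar_eq_one_iff]
  change expChar e * f.coeff e = f.coeff e ↔ _
  by_cases h : f.coeff e = 0
  · simp [h]
  · simp [h]

theorem iterate_xi_coeff (f : HahnSeries ℚ ℂ) (k : ℕ) (e : ℚ) :
    (xi^[k] f).coeff e = expChar (k * e) * f.coeff e := by
  induction k with
  | zero => simp
  | succ k ih =>
    rw [Function.iterate_succ_apply']
    change expChar e * _ = _
    rw [ih, ← mul_assoc, ← AddChar.map_add_eq_mul]
    congr 2
    push_cast
    ring

theorem iterate_xi_ramify_self (s : ℕ+) (g : LaurentSeries ℂ) :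
    xi^[(s : ℕ)] (ramify s g) = ramify s g := by
  ext e
  rw [iterate_xi_coeff]
  by_cases h : (ramify s g).coeff e = 0
  · rw [h, mul_zero]
  · obtain ⟨n, rfl⟩ := exists_of_ramify_coeff_ne_zero s g h
    rw [expChar_eq_one_iff.mpr ⟨n, mul_div_cancel₀ _ (by exact_mod_cast s.ne_zero)⟩, one_mul]

theorem xi_ramify_one (f : LaurentSeries ℂ) : xi (ramify 1 f) = ramify 1 f :=
  xi_eq_self_iff.mpr fun e he => by
    obtain ⟨n, rfl⟩ := exists_of_ramify_coeff_ne_zero 1 f he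
    exact ⟨n, by simp⟩

theorem twistHom_twistHom_neg (χ : AddChar ℚ ℂ) (f : HahnSeries ℚ ℂ) :
    twistHom χ (twistHom χ⁻¹ f) = f := by
  ext e
  change χ e * (χ⁻¹ e * f.coeff e) = f.coeff e
  rw [← mul_assoc, ← AddChar.mul_apply, mul_inv_cancel, AddChar.one_apply, one_mul]

/-- The monodromy as an element of `Gal(𝒫 / ℂ((z)))`. -/
noncomputable def xiEquiv : Puiseux ≃ₐ[LaurentSeries ℂ] Puiseux where
  toFun := xiP
  invFun f := ⟨twist expChar⁻¹ f, f.2.imp fun _ hs e he => hs e (right_ne_zero_of_mul he)⟩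
  left_inv f := Subtype.ext (by
    have := twistHom_twistHom_neg expChar⁻¹ (f : HahnSeries ℚ ℂ)
    rwa [inv_inv] at this)
  right_inv f := Subtype.ext (twistHom_twistHom_neg expChar (f : HahnSeries ℚ ℂ))
  map_mul' f g := Subtype.ext (map_mul (twistHom expChar) (f : HahnSeries ℚ ℂ) g)
  map_add' f g := Subtype.ext (map_add (twistHom expChar) (f : HahnSeries ℚ ℂ) g)
  commutes' f := Subtype.ext (xi_ramify_one f)

theorem iterate_xiP_mem_galoisOrbit (q : Puiseux) (k : ℕ) : xiP^[k] q ∈ galoisOrbit q := by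
  induction k with
  | zero => exact MulAction.mem_orbit_self q
  | succ k ih =>
    rw [Function.iterate_succ_apply']
    exact MulAction.mem_orbit_of_mem_orbit xiEquiv ih

end Monodromy


/-! ### Equations of germs -/

section Germs

theorem xi_inv (f : HahnSeries ℚ ℂ) : xi f⁻¹ = (xi f)⁻¹ := by
  simp only [xi_eq_twistHom, map_inv₀]

theorem xi_zpow_one : xi (zpow 1) = zpow 1 :=
  xi_eq_self_iff.mpr fun e he => by
    refine ⟨1, ?_⟩
    by_contra h
    exact he (HahnSeries.coeff_single_of_ne (by simpa using h))

/-- The monodromy permutes the r factors cyclically. -/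
theorem map_branchPolynomial {r : ℕ} {qt : HahnSeries ℚ ℂ} (h : xi^[r] qt = qt) :
    (branchPolynomial r qt).map (twistHom expChar) = branchPolynomial r qt := by
  let F : ℕ → Polynomial (HahnSeries ℚ ℂ) := fun k =>
    Polynomial.X - Polynomial.C (zpow 1 * (xi^[k] qt)⁻¹)
  have h1 (k : ℕ) : (F k).map (twistHom expChar) = F (k + 1) := by
    rw [Polynomial.map_sub, Polynomial.map_X, Polynomial.map_C, map_mul,
      ← xi_eq_twistHom, ← xi_eq_twistHom, xi_zpow_one, xi_inv, ← Function.iterate_succ_apply' xi]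
  have h2 : F r = F 0 := by simp only [F, h, Function.iterate_zero, id_eq]
  have h3 : F 0 ≠ 0 := Polynomial.X_sub_C_ne_zero _
  -- Both sides are the product of F 0, …, F r, as F r = F 0; cancelling F 0 avoids reindexing
  -- modulo r.
  have h4 : (∏ k ∈ Finset.range r, F (k + 1)) * F 0 = (∏ k ∈ Finset.range r, F k) * F 0 := by
    rw [← Finset.prod_range_succ', Finset.prod_range_succ, h2]
  change (∏ k ∈ Finset.range r, F k).map _ = ∏ k ∈ Finset.range r, F k
  rw [Polynomial.map_prod]
  simp only [h1]
  exact mul_right_cancel₀ h3 h4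

theorem exists_int_of_coeff_branchPolynomial {r : ℕ} {qt : HahnSeries ℚ ℂ} (h : xi^[r] qt = qt)
    (b : ℕ) {e : ℚ} (he : ((branchPolynomial r qt).coeff b).coeff e ≠ 0) : ∃ n : ℤ, e = n := by
  refine xi_eq_self_iff.mp ?_ e he
  conv_rhs => rw [← map_branchPolynomial h]
  rw [Polynomial.coeff_map, xi_eq_twistHom]

/-- A polynomial in `ζ` as a power series. -/
noncomputable def evalZeta : Polynomial (PowerSeries ℂ) →+* MvPowerSeries (Fin 2) ℂ :=
  Polynomial.eval₂RingHom constSeries.toRingHom (MvPowerSeries.X 1)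

theorem coeff_evalZeta (P : Polynomial (PowerSeries ℂ)) (d : Fin 2 →₀ ℕ) :
    MvPowerSeries.coeff d (evalZeta P) = PowerSeries.coeff (d 0) (P.coeff (d 1)) := by
  classical
  induction P using Polynomial.induction_on' with
  | add P Q hP hQ => rw [map_add, map_add, hP, hQ, Polynomial.coeff_add, map_add]
  | monomial n f =>
    have h1 : evalZeta (Polynomial.monomial n f) = constSeries f * MvPowerSeries.X 1 ^ n := by
      exact Polynomial.eval₂_monomial _ _
    rw [h1, Polynomial.coeff_monomial, MvPowerSeries.X_pow_eq, MvPowerSeries.coeff_mul_monomial]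
    have h2 : Finsupp.single 1 n ≤ d ↔ n ≤ d 1 := by
      rw [Finsupp.single_le_iff]
    simp only [h2, coeff_constSeries, mul_one]
    have h3 : (d - Finsupp.single 1 n : Fin 2 →₀ ℕ) 1 = d 1 - n := by simp
    have h4 : (d - Finsupp.single 1 n : Fin 2 →₀ ℕ) 0 = d 0 := by simp
    rw [h3, h4]
    by_cases hn : n = d 1
    · subst hn; simp
    · rw [if_neg hn, (PowerSeries.coeff (d 0)).map_zero]
      split_ifs
      · omega
      · rfl
      · rfl

theorem orderTop_congr {f g : LaurentSeries ℂ} (h : ∀ j, f.coeff j = 0 ↔ g.coeff j = 0) :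
    f.orderTop = g.orderTop :=
  eq_of_forall_le_iff fun i => by
    simp only [HahnSeries.le_orderTop_iff_forall, h]

theorem orderTop_iterate_rotate (s : ℕ+) (f : LaurentSeries ℂ) (k : ℕ) :
    ((rotate s)^[k] f).orderTop = f.orderTop := by
  induction k with
  | zero => rfl
  | succ k ih =>
    rw [Function.iterate_succ_apply', ← ih]
    exact orderTop_congr fun j => by simp [rotate, Complex.exp_ne_zero]

/-- The branch t^s / ξ^k(g) has order s - n > 0, because the monodromy preserves orders. It is
convergent and passes through the origin. -/
theorem exists_branch {s : ℕ+} {g : LaurentSeries ℂ} (hg : g ∈ convLaurent) {n : ℤ}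
    (hn : g.orderTop = n) (hlt : n < (s : ℕ)) (k : ℕ) :
    ∃ α : convPowerSeries, PowerSeries.constantCoeff (α : PowerSeries ℂ) = 0 ∧
      HahnSeries.ofPowerSeries ℤ ℂ α =
        HahnSeries.single ((s : ℕ) : ℤ) 1 * ((rotate s)^[k] g)⁻¹ := by
  have h1 : (HahnSeries.single ((s : ℕ) : ℤ) 1 * ((rotate s)^[k] g)⁻¹ : LaurentSeries ℂ) ∈
      ordGE 1 := by
    rw [mem_ordGE_iff_le_orderTop, HahnSeries.orderTop_mul, HahnSeries.orderTop_single one_ne_zero,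
      orderTop_inv ((orderTop_iterate_rotate s g k).trans hn), ← WithTop.coe_add,
      WithTop.coe_le_coe]
    omega
  obtain ⟨α, hα⟩ := exists_ofPowerSeries_eq (ordGE_anti zero_le_one h1)
  have hc : α ∈ convPowerSeries := convPowerSeries_of_ofPowerSeries (by
    rw [hα]
    exact mul_mem (single_mem_convLaurent _ _)
      (inv_mem_convLaurent (iterate_rotate_mem_convLaurent s hg k)))
  refine ⟨⟨α, hc⟩, ?_, hα⟩
  rw [← PowerSeries.coeff_zero_eq_constantCoeff_apply,
    ← HahnSeries.ofPowerSeries_apply_coeff (Γ := ℤ)]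
  exact hα ▸ h1 _ (by simp)

theorem ramify_branch {s : ℕ+} {g : LaurentSeries ℂ} (k : ℕ) :
    ramify s (HahnSeries.single ((s : ℕ) : ℤ) 1 * ((rotate s)^[k] g)⁻¹) =
      zpow 1 * (xi^[k] (ramify s g))⁻¹ := by
  rw [map_mul, map_inv₀, iterate_xi_ramify, ramify_single, Int.cast_natCast,
    div_self (by exact_mod_cast s.ne_zero), zpow]

theorem exists_pow_mul_isUnit {f : convPowerSeries} {e : ℤ}
    (h : (HahnSeries.ofPowerSeries ℤ ℂ (f : PowerSeries ℂ)).orderTop = e) :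
    0 ≤ e ∧ ∃ w : convPowerSeries, IsUnit w ∧
      (f : PowerSeries ℂ) = PowerSeries.X ^ e.toNat * (w : PowerSeries ℂ) := by
  have h0 : (0 : ℤ) ≤ e := by
    have := mem_ordGE_iff_le_orderTop.mp (ofPowerSeries_mem_ordGE (f : PowerSeries ℂ))
    rwa [h, WithTop.coe_le_coe] at this
  obtain ⟨w, hw, hf, hc⟩ := exists_convPowerSeries (ofPowerSeries_mem_convLaurent f.2)
    (mem_ordGE_iff_le_orderTop.mpr h.ge)
  refine ⟨h0, ⟨w, hw⟩, isUnit_convPowerSeries ?_, HahnSeries.ofPowerSeries_injective (Γ := ℤ) ?_⟩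
  · rw [← PowerSeries.coeff_zero_eq_constantCoeff_apply, hc, Nat.cast_zero, zero_add]
    exact HahnSeries.coeff_orderTop_ne h
  · rw [hf, map_mul, HahnSeries.ofPowerSeries_X_pow, Int.toNat_of_nonneg h0]

/-- The product of the branches converges in ℂ{t,ζ} and is invariant under the monodromy. Only
powers of t^s occur in it, so it is the pullback of its component 0, the equation over ℂ{z,ζ}. -/
theorem exists_equation {s : ℕ+} {r : ℕ} {g : LaurentSeries ℂ}
    (hr : xi^[r] (ramify s g) = ramify s g)
    {α : ℕ → convPowerSeries}
    (hα : ∀ k, ramify s (HahnSeries.ofPowerSeries ℤ ℂ (α k)) = zpow 1 * (xi^[k] (ramify s g))⁻¹) :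
    ∃ f, IsEquationOfGerm f r (ramify s g) ∧
      dilate₂ s f = ∏ k ∈ Finset.range r, (convVar 1 - convConst (α k)) := by
  let P : Polynomial (PowerSeries ℂ) :=
    ∏ k ∈ Finset.range r, (Polynomial.X - Polynomial.C (α k : PowerSeries ℂ))
  let φ : PowerSeries ℂ →+* HahnSeries ℚ ℂ :=
    (ramify s).comp (HahnSeries.ofPowerSeries ℤ ℂ)
  have hP : P.map φ = branchPolynomial r (ramify s g) := by
    simp only [P, branchPolynomial, Polynomial.map_prod, Polynomial.map_sub, Polynomial.map_X,
      Polynomial.map_C]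
    exact Finset.prod_congr rfl fun k _ => by rw [← hα k]; rfl
  have hP' : evalZeta P =
      ((∏ k ∈ Finset.range r, (convVar 1 - convConst (α k)) : convPowerSeries₂) :
        MvPowerSeries (Fin 2) ℂ) := by
    rw [SubmonoidClass.coe_finsetProd, map_prod]
    refine Finset.prod_congr rfl fun k _ => ?_
    simp only [evalZeta, map_sub, Polynomial.coe_eval₂RingHom, Polynomial.eval₂_X,
      Polynomial.eval₂_C]
    rfl
  have hc (a b : ℕ) : PowerSeries.coeff a (P.coeff b) =
      ((branchPolynomial r (ramify s g)).coeff b).coeff ((a : ℚ) / (s : ℕ)) := by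
    have h1 := ramify_coeff s (HahnSeries.ofPowerSeries ℤ ℂ (P.coeff b)) a
    rw [← hP, Polynomial.coeff_map]
    refine (HahnSeries.ofPowerSeries_apply_coeff (Γ := ℤ) (P.coeff b) a).symm.trans ?_
    exact h1.symm
  have hs : ((s : ℕ) : ℚ) ≠ 0 := by exact_mod_cast s.ne_zero
  have hd : dilate₂ s (component₂ s 0 (∏ k ∈ Finset.range r, (convVar 1 - convConst (α k)))) =
      ∏ k ∈ Finset.range r, (convVar 1 - convConst (α k)) := by
    refine dilate₂_eq_component_zero fun d h => ?_
    rw [← hP', coeff_evalZeta, hc]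
    by_contra hne
    obtain ⟨n, hn⟩ := exists_int_of_coeff_branchPolynomial hr _ hne
    rw [div_eq_iff hs] at hn
    have h2 : ((d 0 : ℕ) : ℤ) = n * (s : ℕ) := by exact_mod_cast hn
    exact h (Int.natCast_dvd_natCast.mp ⟨n, by rw [h2, mul_comm]⟩)
  refine ⟨_, fun b => ?_, hd⟩
  ext e
  by_cases he : ∃ n : ℕ, e = n
  · obtain ⟨n, rfl⟩ := he
    rw [HahnSeries.ofPowerSeries_apply_coeff, PowerSeries.coeff_mk]
    change _ = MvPowerSeries.coeff (biexp n b) _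
    rw [coeff_component₂, ← hP', coeff_evalZeta]
    simp only [biexp_zero, biexp_one]
    rw [hc]
    congr 1
    push_cast
    field_simp
    simp
  · have h1 : (HahnSeries.ofPowerSeries ℚ ℂ (PowerSeries.mk fun a =>
        MvPowerSeries.coeff (Finsupp.single 0 a + Finsupp.single 1 b)
        (component₂ s 0 (∏ k ∈ Finset.range r, (convVar 1 - convConst (α k))) :
          MvPowerSeries (Fin 2) ℂ))).coeff e = 0 := by
      rw [HahnSeries.ofPowerSeries_apply]
      refine HahnSeries.embDomain_of_notMem_range ?_
      rintro ⟨n, hn⟩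
      exact he ⟨n, by simpa using hn.symm⟩
    rw [h1]
    by_contra hne
    obtain ⟨n, rfl⟩ := exists_int_of_coeff_branchPolynomial hr _ hne
    rw [← hP, Polynomial.coeff_map] at hne
    have h2 : (n : ℚ) = ((n * (s : ℕ) : ℤ) : ℚ) / (s : ℕ) := by
      push_cast; field_simp
    change (ramify s (HahnSeries.ofPowerSeries ℤ ℂ (P.coeff b))).coeff _ ≠ 0 at hne
    rw [h2, ramify_coeff] at hne
    have h3 : 0 ≤ n := by
      by_contra hneg
      refine hne (ofPowerSeries_mem_ordGE _ _ ?_)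
      exact mul_neg_of_neg_of_pos (not_le.mp hneg) (by exact_mod_cast s.pos)
    obtain ⟨n, rfl⟩ := Int.eq_ofNat_of_zero_le h3
    exact he ⟨n, by simp⟩

end Germs


/-! ### Orders of differences of conjugates -/

section Orders

theorem orderTop_ramify (s : ℕ+) (f : LaurentSeries ℂ) :
    (ramify s f).orderTop = WithTop.map (fun n : ℤ => (n : ℚ) / (s : ℕ)) f.orderTop := by
  exact HahnSeries.orderTop_embDomain (f :=
    OrderEmbedding.ofMapLEIff (fun n : ℤ => (n : ℚ) / (s : ℕ)) _)

/-- A pole order ignores holomorphic perturbations. This is why the constants R and the nonpolar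
part of q̃ do not enter the formula. -/
theorem orderTop_add_of_mem_ordGE {b c : LaurentSeries ℂ} {n : ℤ} (hb : b.orderTop = n)
    (hn : n < 0) (hc : c ∈ ordGE 0) : (b + c).orderTop = n := by
  rw [HahnSeries.orderTop_add_eq_left, hb]
  rw [hb]
  exact (WithTop.coe_lt_coe.mpr hn).trans_le (mem_ordGE_iff_le_orderTop.mp hc)

theorem rotate_iterate_mem_ordGE {s : ℕ+} {f : LaurentSeries ℂ} {m : ℤ} (hf : f ∈ ordGE m)
    (k : ℕ) : (rotate s)^[k] f ∈ ordGE m := by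
  rw [mem_ordGE_iff_le_orderTop] at *
  rwa [orderTop_iterate_rotate]

theorem rotate_iterate_sub (s : ℕ+) (f g : LaurentSeries ℂ) (k : ℕ) :
    (rotate s)^[k] (f - g) = (rotate s)^[k] f - (rotate s)^[k] g := by
  rw [← Module.End.pow_apply, ← Module.End.pow_apply, ← Module.End.pow_apply, map_sub]

theorem single_zero_mem_ordGE (c : ℂ) : (HahnSeries.single 0 c : LaurentSeries ℂ) ∈ ordGE 0 :=
  fun _ hj => HahnSeries.coeff_single_of_ne hj.ne

theorem rotate_iterate_coeff_eq_zero {s : ℕ+} {f : LaurentSeries ℂ} {j : ℤ} (h : f.coeff j = 0)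
    (k : ℕ) : ((rotate s)^[k] f).coeff j = 0 := by
  induction k with
  | zero => exact h
  | succ k ih =>
    rw [Function.iterate_succ_apply']
    exact mul_eq_zero_of_right _ ih

theorem exists_orderTop_eq_neg {b : LaurentSeries ℂ} (h0 : b ≠ 0)
    (hb : ∀ j, 0 ≤ j → b.coeff j = 0) :
    ∃ P : ℕ, 0 < P ∧ b.orderTop = ((-(P : ℤ) : ℤ) : WithTop ℤ) := by
  obtain ⟨n, hn⟩ := WithTop.ne_top_iff_exists.mp (HahnSeries.orderTop_ne_top.mpr h0)
  have hneg : n < 0 := by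
    by_contra h
    exact HahnSeries.coeff_orderTop_ne hn.symm (hb n (not_lt.mp h))
  exact ⟨(-n).toNat, by omega, by rw [← hn, WithTop.coe_inj]; omega⟩

theorem ramIndex_zero : ramIndex 0 = 1 := by
  classical
  refine (PNat.find_eq_one _).mpr fun e he => ?_
  exact absurd HahnSeries.coeff_zero he

/-- `q̃` and `q = pr⁻ q̃` as series in `t = z ^ (1 / s)`, where `s = r u`. -/
theorem exists_uniformization {q : Puiseux} {qt : HahnSeries ℚ ℂ} {p : ℤ} (hq : q ∈ PuiseuxNeg)
    (hqt : qt ∈ convPuiseux (ramIndex q)) (hpr : HahnSeries.truncLT 0 qt = (q : HahnSeries ℚ ℂ))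
    (hp : q ≠ 0 → (q : HahnSeries ℚ ℂ).orderTop =
      ((-(p : ℚ) / (ramIndex q : ℕ) : ℚ) : WithTop ℚ))
    (hp0 : q = 0 → p = 0) (hlt : (qt * (zpow 1)⁻¹).orderTop < 0) {s u : ℕ+}
    (hs : s = ramIndex q * u) :
    ∃ g q' : LaurentSeries ℂ, g ∈ convLaurent ∧ ramify s g = qt ∧ ramify s q' = q ∧
      g - q' ∈ ordGE 0 ∧ (∀ j, 0 ≤ j → q'.coeff j = 0) ∧
      g.orderTop = ((-(p * (u : ℕ)) : ℤ) : WithTop ℤ) ∧ 0 ≤ p := by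
  have hs0 : (0 : ℚ) < ((s : ℕ) : ℚ) := by exact_mod_cast s.pos
  obtain ⟨g₀, hg₀, rfl⟩ := hqt
  classical
  obtain ⟨q₀, hq₀⟩ := exists_ramify_eq (s := ramIndex q) (f := q) (PNat.find_spec q.2)
  obtain ⟨q', hq'⟩ := exists_ramify_eq_of_dvd (Dvd.intro u hs.symm) q₀
  rw [hq₀] at hq'
  have hg : ramify s (dilate u g₀) = ramify (ramIndex q) g₀ := by rw [hs, ramify_mul_dilate]
  have hneg : ∀ j, 0 ≤ j → q'.coeff j = 0 := fun j hj => by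
    rw [← ramify_coeff s, hq']
    exact hq _ (by positivity)
  have hsub : dilate u g₀ - q' ∈ ordGE 0 := fun j hj => by
    rw [HahnSeries.coeff_sub, ← ramify_coeff s, ← ramify_coeff s, hg, hq', ← hpr,
      HahnSeries.coeff_truncLT_of_lt (div_neg_of_neg_of_pos (by exact_mod_cast hj) hs0), sub_self]
  refine ⟨dilate u g₀, q', dilate_mem_convLaurent u hg₀, hg, hq', hsub, hneg, ?_⟩
  by_cases h0 : q = 0
  · have hq'0 : q' = 0 := ramify_injective s (by rw [hq', h0, map_zero]; rfl)
    rw [hq'0, sub_zero] at hsub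
    refine ⟨?_, (hp0 h0).ge⟩
    rw [hp0 h0, zero_mul, neg_zero]
    refine le_antisymm ?_ (mem_ordGE_iff_le_orderTop.mp hsub)
    -- For q = 0 the ramification index is 1 and q̃ is a power series in z. A vanishing constant
    -- term would make q̃/z holomorphic, against ord(q̃/z) < 0; hence q̃ has order exactly 0.
    refine HahnSeries.orderTop_le_of_coeff_ne_zero fun hc => ?_
    refine hlt.not_ge ?_
    have hr : ramIndex q = 1 := by rw [h0, ramIndex_zero]
    have h1 : (zpow 1)⁻¹ = ramify (ramIndex q) (HahnSeries.single (-1) 1) := by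
      rw [ramify_single, hr, zpow]
      refine inv_eq_of_mul_eq_one_right ?_
      simp [HahnSeries.single_mul_single]
    have h2 : g₀ * HahnSeries.single (-1) 1 ∈ ordGE 0 := fun j hj => by
      rw [mul_comm, HahnSeries.coeff_single_mul, one_mul]
      rcases (show j - -1 ≤ 0 by omega).lt_or_eq with h | h
      · rw [← dilate_coeff u]
        exact hsub _ (mul_neg_of_pos_of_neg (by exact_mod_cast u.pos) h)
      · rw [h, ← dilate_coeff u, mul_zero, hc]
    rw [h1, ← map_mul, HahnSeries.le_orderTop_iff_forall]
    intro e he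
    by_contra hne
    obtain ⟨n, rfl⟩ := exists_of_ramify_coeff_ne_zero _ _ hne
    rw [ramify_coeff] at hne
    refine hne (h2 n ?_)
    have hr0 : (0 : ℚ) < ((ramIndex q : ℕ) : ℚ) := by exact_mod_cast (ramIndex q).pos
    have h3 := neg_of_div_neg_left (WithTop.coe_lt_coe.mp he) hr0.le
    exact_mod_cast h3
  · have hq'0 : q' ≠ 0 := fun h => h0 (Subtype.ext (by rw [← hq', h, map_zero]; rfl))
    obtain ⟨P, hP, hord⟩ := exists_orderTop_eq_neg hq'0 hneg
    have h1 := hp h0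
    rw [← hq', orderTop_ramify, hord, WithTop.map_coe, WithTop.coe_inj, hs] at h1
    have hr0 : ((ramIndex q : ℕ) : ℚ) ≠ 0 := by exact_mod_cast (ramIndex q).ne_zero
    have hu0 : ((u : ℕ) : ℚ) ≠ 0 := by exact_mod_cast u.ne_zero
    -- Comparison of -p/r with -P/s, where s = r u.
    have h2 : (P : ℤ) = p * (u : ℕ) := by
      rw [PNat.mul_coe] at h1
      push_cast at h1
      field_simp at h1
      rw [mul_comm]
      exact_mod_cast neg_injective h1
    constructor
    · have : dilate u g₀ = q' + (dilate u g₀ - q') := by ring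
      rw [this, ← h2]
      exact orderTop_add_of_mem_ordGE hord (by omega) hsub
    · by_contra hlt
      have : (0 : ℤ) < (u : ℕ) := by exact_mod_cast u.pos
      nlinarith

end Orders


/-! ### The intersection number and the irregularity -/

section Comparison

variable {q₁ q₂ g₁ g₂ : LaurentSeries ℂ} {s : ℕ+} {P : ℕ → ℕ → ℕ}

/-- The exponents of the local intersections `(ζ - t ^ s / g₁, ζ - t ^ s / g₂)` of branches, in
terms of the orders of differences of conjugates of the polar parts. -/
theorem exists_germs (h₁ : g₁ ∈ convLaurent) (h₂ : g₂ ∈ convLaurent) {n₁ n₂ : ℤ}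
    (hn₁ : g₁.orderTop = ((-n₁ : ℤ) : WithTop ℤ)) (hn₂ : g₂.orderTop = ((-n₂ : ℤ) : WithTop ℤ))
    (h0₁ : 0 ≤ n₁) (h0₂ : 0 ≤ n₂) (hs₁ : g₁ - q₁ ∈ ordGE 0) (hs₂ : g₂ - q₂ ∈ ordGE 0)
    (hP0 : ∀ l k, 0 < P l k)
    (hP : ∀ l k, ((rotate s)^[l] q₂ - (rotate s)^[k] q₁).orderTop =
      ((-(P l k : ℤ) : ℤ) : WithTop ℤ))
    {r₁ r₂ : ℕ} (hr₁ : xi^[r₁] (ramify s g₁) = ramify s g₁)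
    (hr₂ : xi^[r₂] (ramify s g₂) = ramify s g₂) :
    ∃ f₁ f₂, IsEquationOfGerm f₁ r₁ (ramify s g₁) ∧ IsEquationOfGerm f₂ r₂ (ramify s g₂) ∧
      ∃ d : ℕ, pairLength ℂ f₁ f₂ = d ∧ ((s : ℕ) * d : ℤ) =
        ∑ k ∈ Finset.range r₁, ∑ l ∈ Finset.range r₂, ((s : ℕ) + n₁ + n₂ - P l k : ℤ) := by
  have hspos : (0 : ℤ) < (s : ℕ) := by exact_mod_cast s.pos
  choose α hα0 hα using exists_branch h₁ hn₁ (by omega : -n₁ < (s : ℕ))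
  choose β hβ0 hβ using exists_branch h₂ hn₂ (by omega : -n₂ < (s : ℕ))
  obtain ⟨f₁, hf₁, hd₁⟩ := exists_equation hr₁ (α := α) fun k => by rw [hα, ramify_branch]
  obtain ⟨f₂, hf₂, hd₂⟩ := exists_equation hr₂ (α := β) fun k => by rw [hβ, ramify_branch]
  refine ⟨f₁, f₂, hf₁, hf₂, ?_⟩
  have hord : ∀ k l, (HahnSeries.ofPowerSeries ℤ ℂ ((α k - β l : convPowerSeries) :
      PowerSeries ℂ)).orderTop = (((s : ℕ) + n₁ + n₂ - P l k : ℤ) : WithTop ℤ) := by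
    intro k l
    have e₁ := (orderTop_iterate_rotate s g₁ k).trans hn₁
    have e₂ := (orderTop_iterate_rotate s g₂ l).trans hn₂
    have z₁ : (rotate s)^[k] g₁ ≠ 0 := HahnSeries.orderTop_ne_top.mp (e₁ ▸ WithTop.coe_ne_top)
    have z₂ : (rotate s)^[l] g₂ ≠ 0 := HahnSeries.orderTop_ne_top.mp (e₂ ▸ WithTop.coe_ne_top)
    -- The conjugates of g and q differ by holomorphic terms, and the difference of the q conjugates
    -- has a pole.
    have e₃ : ((rotate s)^[l] g₂ - (rotate s)^[k] g₁).orderTop =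
        ((-(P l k : ℤ) : ℤ) : WithTop ℤ) := by
      have : (rotate s)^[l] g₂ - (rotate s)^[k] g₁ =
          ((rotate s)^[l] q₂ - (rotate s)^[k] q₁) +
            ((rotate s)^[l] (g₂ - q₂) - (rotate s)^[k] (g₁ - q₁)) := by
        rw [rotate_iterate_sub, rotate_iterate_sub]; ring
      rw [this]
      have := hP0 l k
      exact orderTop_add_of_mem_ordGE (hP l k) (by omega)
        (sub_mem (rotate_iterate_mem_ordGE hs₂ l) (rotate_iterate_mem_ordGE hs₁ k))
    -- The identity t^s/g - t^s/h = t^s (h - g)/(gh), which gives the order s - P + n₁ + n₂.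
    have e₄ : HahnSeries.ofPowerSeries ℤ ℂ ((α k - β l : convPowerSeries) : PowerSeries ℂ) =
        HahnSeries.single ((s : ℕ) : ℤ) 1 * ((rotate s)^[l] g₂ - (rotate s)^[k] g₁) *
          (((rotate s)^[k] g₁)⁻¹ * ((rotate s)^[l] g₂)⁻¹) := by
      rw [AddSubgroupClass.coe_sub, map_sub, hα, hβ]
      field_simp
    rw [e₄, HahnSeries.orderTop_mul, HahnSeries.orderTop_mul, HahnSeries.orderTop_mul,
      HahnSeries.orderTop_single one_ne_zero, e₃, orderTop_inv e₁, orderTop_inv e₂,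
      ← WithTop.coe_add, ← WithTop.coe_add, ← WithTop.coe_add, WithTop.coe_inj]
    ring
  have hlen := pairLength_prod_branches (r := r₁) (r' := r₂) hα0 hβ0
    (e := fun k l => ((s : ℕ) + n₁ + n₂ - P l k : ℤ).toNat)
    fun k _ l _ => (exists_pow_mul_isUnit (hord k l)).2
  rw [← hd₁, ← hd₂, pairLength_dilate₂] at hlen
  have hfin : pairLength ℂ f₁ f₂ ≠ ⊤ := by
    intro h
    rw [h, ENat.mul_top (by exact_mod_cast s.ne_zero)] at hlen
    exact ENat.top_ne_natCast _ hlen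
  obtain ⟨d, hd⟩ := ENat.ne_top_iff_exists.mp hfin
  refine ⟨d, hd.symm, ?_⟩
  rw [← hd] at hlen
  have hlen' : (s : ℕ) * d = ∑ k ∈ Finset.range r₁, ∑ l ∈ Finset.range r₂,
      ((s : ℕ) + n₁ + n₂ - P l k : ℤ).toNat := by exact_mod_cast hlen
  have hlen'' := congrArg (fun n : ℕ => (n : ℤ)) hlen'
  push_cast at hlen''
  rw [hlen'']
  refine Finset.sum_congr rfl fun k _ => Finset.sum_congr rfl fun l _ => ?_
  -- The exponents are nonnegative, being orders of power series, so the truncation to ℕ is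
  -- harmless.
  exact Int.toNat_of_nonneg (exists_pow_mul_isUnit (hord k l)).1

theorem ramify_cell_entry {q : Puiseux} {q' : LaurentSeries ℂ} (h : ramify s q' = q) (R : ℂ)
    (k : ℕ) : ramify s ((rotate s)^[k] q' + HahnSeries.single 0 R) =
      ((xiP^[k] q + algebraMap ℂ Puiseux R : Puiseux) : HahnSeries ℚ ℂ) := by
  rw [map_add, ← iterate_xi_ramify, h, ← coe_iterate_xiP, ramify_single, Int.cast_zero, zero_div]
  rfl

/-- The exponents of Hom are the differences of conjugates plus R₂ - R₁, and the constant leaves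
their pole orders P unchanged. -/
theorem irregularity_homMatrix {r₁ r₂ : ℕ} {G₁ : Matrix (Fin r₁) (Fin r₁) convLaurent}
    {G₂ : Matrix (Fin r₂) (Fin r₂) convLaurent} {R₁ R₂ : ℂ}
    {X₁ Y₁ : Matrix (Fin r₁) (Fin r₁) (LaurentSeries ℂ)}
    {X₂ Y₂ : Matrix (Fin r₂) (Fin r₂) (LaurentSeries ℂ)}
    (h₁ : Diagonalizes s (thetaMatrix G₁) X₁ Y₁
      fun k => (rotate s)^[k] q₁ + HahnSeries.single 0 R₁)
    (h₂ : Diagonalizes s (thetaMatrix G₂) X₂ Y₂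
      fun k => (rotate s)^[k] q₂ + HahnSeries.single 0 R₂)
    (hP0 : ∀ l k, 0 < P l k)
    (hP : ∀ l k, ((rotate s)^[l] q₂ - (rotate s)^[k] q₁).orderTop =
      ((-(P l k : ℤ) : ℤ) : WithTop ℤ)) :
    HasIrregularity (homMatrix G₁ G₂) ∧ (s : ℕ) * irregularity (homMatrix G₁ G₂) =
      ∑ k ∈ Finset.range r₁, ∑ l ∈ Finset.range r₂, (P l k : ℤ) := by
  have h := h₁.hom h₂
  have hdiag : IsDiagonalization s (thetaMatrix (homMatrix G₁ G₂)) _ _ _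
      (fun c : Fin r₂ × Fin r₁ => P c.1 c.2) :=
    { mul_eq_one := h.mul_eq_one
      eq := h.eq
      pos := fun c => hP0 _ _
      order := fun c => by
        have : (rotate s)^[c.1] q₂ + HahnSeries.single 0 R₂ -
            ((rotate s)^[c.2] q₁ + HahnSeries.single 0 R₁) =
            ((rotate s)^[c.1] q₂ - (rotate s)^[c.2] q₁) +
              (HahnSeries.single 0 R₂ - HahnSeries.single 0 R₁) := by ring
        rw [this]
        have := hP0 c.1 c.2
        exact orderTop_add_of_mem_ordGE (hP _ _) (by omega)
          (sub_mem (single_zero_mem_ordGE _) (single_zero_mem_ordGE _)) }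
  refine ⟨hdiag.irregularity.1, hdiag.irregularity.2.trans ?_⟩
  push_cast
  rw [Fintype.sum_prod_type, Finset.sum_comm,
    ← Fin.sum_univ_eq_sum_range (fun k => ∑ l ∈ Finset.range r₂, (P l k : ℤ))]
  refine Finset.sum_congr rfl fun k _ => ?_
  rw [← Fin.sum_univ_eq_sum_range (fun l => (P l k : ℤ))]

end Comparison

end HTL

/-! ### The proposition: comparison of both sides after multiplication by s. -/

theorem mainTheorem8 (m : ℕ) (q : Fin m → HTL.Puiseux) (R : Fin m → ℂ)
    (qt : Fin m → HahnSeries ℚ ℂ) (p : Fin m → ℤ)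
    -- the data of a multiplicity free HTL normal form `diag(E_{q₁,R₁}, …, E_{qₘ,Rₘ})`
    (hq : ∀ i, q i ∈ HTL.PuiseuxNeg)
    (horbit : ∀ i j, i ≠ j → HTL.galoisOrbit (q i) ∩ HTL.galoisOrbit (q j) = ∅)
    -- `q̃ᵢ ∈ ℂ({z ^ (1 / rᵢ)})` with `pr⁻(q̃ᵢ) = qᵢ`
    (hqt : ∀ i, qt i ∈ HTL.convPuiseux (HTL.ramIndex (q i)))
    (hpr : ∀ i, HahnSeries.truncLT 0 (qt i) = (q i : HahnSeries ℚ ℂ))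
    -- `ord qᵢ = - pᵢ / rᵢ`, where `pᵢ = 0` if `qᵢ = 0`
    (hp : ∀ i, q i ≠ 0 →
      (q i : HahnSeries ℚ ℂ).orderTop = ((-(p i : ℚ) / (HTL.ramIndex (q i) : ℕ) : ℚ) : WithTop ℚ))
    (hp0 : ∀ i, q i = 0 → p i = 0)
    (i j : Fin m) (hij : i ≠ j)
    -- `ord (q̃ᵢ / z) < 0` and `ord (q̃ⱼ / z) < 0`
    (hi : (qt i * (HTL.zpow 1)⁻¹).orderTop < 0)
    (hj : (qt j * (HTL.zpow 1)⁻¹).orderTop < 0)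
    -- `M_{Gᵢ}`, `M_{Gⱼ}` are differential modules over `ℂ({z})` with HTL normal forms
    -- `E_{qᵢ,Rᵢ}`, `E_{qⱼ,Rⱼ}`
    (Gi : Matrix (Fin (HTL.ramIndex (q i))) (Fin (HTL.ramIndex (q i))) HTL.convLaurent)
    (Gj : Matrix (Fin (HTL.ramIndex (q j))) (Fin (HTL.ramIndex (q j))) HTL.convLaurent)
    (hGi : HTL.IsPuiseuxMatrixOf Gi (HTL.cell (q i) (R i)))
    (hGj : HTL.IsPuiseuxMatrixOf Gj (HTL.cell (q j) (R j))) :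
    ∃ f g : HTL.convPowerSeries₂,
      HTL.IsEquationOfGerm f (HTL.ramIndex (q i)) (qt i) ∧
      HTL.IsEquationOfGerm g (HTL.ramIndex (q j)) (qt j) ∧
      Module.Finite ℂ (HTL.IntersectionRing f g) ∧
      HTL.HasIrregularity (HTL.homMatrix Gi Gj) ∧
      (HTL.intersectionNumber f g : ℤ) =
        p i * (HTL.ramIndex (q j) : ℕ) + p j * (HTL.ramIndex (q i) : ℕ) +
          (HTL.ramIndex (q i) : ℕ) * (HTL.ramIndex (q j) : ℕ) -
          HTL.irregularity (HTL.homMatrix Gi Gj) := by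
  obtain ⟨s₁, hs₁⟩ := HTL.exists_diagonalizes hGi
  obtain ⟨s₂, hs₂⟩ := HTL.exists_diagonalizes hGj
  -- One ramification that uniformizes both q̃ and both gauge transformations.
  obtain ⟨s, hs⟩ : ∃ s : ℕ+, s = HTL.ramIndex (q i) * (HTL.ramIndex (q j) * (s₁ * s₂)) := ⟨_, rfl⟩
  have hsi := hs
  have hsj : s = HTL.ramIndex (q j) * (HTL.ramIndex (q i) * (s₁ * s₂)) := by
    rw [hs, mul_left_comm]
  obtain ⟨ui, hui⟩ : ∃ u, u = HTL.ramIndex (q j) * (s₁ * s₂) := ⟨_, rfl⟩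
  obtain ⟨uj, huj⟩ : ∃ u, u = HTL.ramIndex (q i) * (s₁ * s₂) := ⟨_, rfl⟩
  rw [← hui] at hsi
  rw [← huj] at hsj
  obtain ⟨gi, qi, hgi, egi, eqi, hsubi, hnegi, hordi, hpi⟩ :=
    HTL.exists_uniformization (hq i) (hqt i) (hpr i) (hp i) (hp0 i) hi hsi
  obtain ⟨gj, qj, hgj, egj, eqj, hsubj, hnegj, hordj, hpj⟩ :=
    HTL.exists_uniformization (hq j) (hqt j) (hpr j) (hp j) (hp0 j) hj hsj
  have hd₁ : s₁ ∣ s := ⟨HTL.ramIndex (q i) * HTL.ramIndex (q j) * s₂, by rw [hs]; ring⟩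
  have hd₂ : s₂ ∣ s := ⟨HTL.ramIndex (q i) * HTL.ramIndex (q j) * s₁, by rw [hs]; ring⟩
  obtain ⟨X₁, Y₁, hX₁⟩ := hs₁ s hd₁ _ fun k => HTL.ramify_cell_entry eqi (R i) k
  obtain ⟨X₂, Y₂, hX₂⟩ := hs₂ s hd₂ _ fun k => HTL.ramify_cell_entry eqj (R j) k
  -- The disjointness of the orbits is used here: the conjugates under ξ lie in the Galois orbits,
  -- so they cannot coincide.
  have hne : ∀ l k : ℕ, (HTL.rotate s)^[l] qj - (HTL.rotate s)^[k] qi ≠ 0 := by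
    intro l k h
    have h1 : HTL.xiP^[l] (q j) = HTL.xiP^[k] (q i) := Subtype.ext (by
      rw [HTL.coe_iterate_xiP, HTL.coe_iterate_xiP, ← eqi, ← eqj, HTL.iterate_xi_ramify,
        HTL.iterate_xi_ramify, sub_eq_zero.mp h])
    have h2 : HTL.xiP^[l] (q j) ∈ HTL.galoisOrbit (q i) ∩ HTL.galoisOrbit (q j) :=
      ⟨h1 ▸ HTL.iterate_xiP_mem_galoisOrbit (q i) k, HTL.iterate_xiP_mem_galoisOrbit (q j) l⟩
    rw [horbit i j hij] at h2
    exact h2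
  choose P hP0 hP using fun l k => HTL.exists_orderTop_eq_neg (hne l k) fun n hn => by
    rw [HahnSeries.coeff_sub, HTL.rotate_iterate_coeff_eq_zero (hnegj n hn),
      HTL.rotate_iterate_coeff_eq_zero (hnegi n hn), sub_zero]
  have hri : HTL.xi^[(HTL.ramIndex (q i) : ℕ)] (HTL.ramify s gi) = HTL.ramify s gi := by
    obtain ⟨g, -, hg⟩ := hqt i
    rw [egi, hg, HTL.iterate_xi_ramify_self]
  have hrj : HTL.xi^[(HTL.ramIndex (q j) : ℕ)] (HTL.ramify s gj) = HTL.ramify s gj := by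
    obtain ⟨g, -, hg⟩ := hqt j
    rw [egj, hg, HTL.iterate_xi_ramify_self]
  obtain ⟨f, g, hf, hg, d, hd, hsd⟩ := HTL.exists_germs hgi hgj hordi hordj
    (mul_nonneg hpi (Int.natCast_nonneg _)) (mul_nonneg hpj (Int.natCast_nonneg _)) hsubi hsubj
    hP0 hP hri hrj
  obtain ⟨hirr, hsirr⟩ := HTL.irregularity_homMatrix hX₁ hX₂ hP0 hP
  obtain ⟨hfin, hrank⟩ := HTL.finite_of_length_eq hd
  rw [egi] at hf
  rw [egj] at hg
  refine ⟨f, g, hf, hg, hfin, hirr, ?_⟩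
  have hspos : ((s : ℕ) : ℤ) ≠ 0 := by exact_mod_cast s.ne_zero
  refine mul_left_cancel₀ hspos ?_
  have hnum : HTL.intersectionNumber f g = d := hrank
  rw [hnum, hsd, mul_sub, hsirr]
  have esi : ((s : ℕ) : ℤ) = (HTL.ramIndex (q i) : ℕ) * (ui : ℕ) := by
    rw [hsi, PNat.mul_coe]; push_cast; ring
  have esj : ((s : ℕ) : ℤ) = (HTL.ramIndex (q j) : ℕ) * (uj : ℕ) := by
    rw [hsj, PNat.mul_coe]; push_cast; ring
  simp only [Finset.sum_sub_distrib, Finset.sum_const, Finset.card_range, nsmul_eq_mul]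
  -- The orders of the q̃ in t are -p_i u_i and -p_j u_j, and r_i u_i = s = r_j u_j turns the
  -- constant sums into s p_i r_j and s p_j r_i.
  linear_combination -((HTL.ramIndex (q j) : ℕ) * p i : ℤ) * esi -
    ((HTL.ramIndex (q i) : ℕ) * p j : ℤ) * esj
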